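/- **Setting.** Let a spacetime with a smooth metric $g$ of signature $(+,-,-,-)$ be foliated, near an initial slice $t=0$, by spacelike slices, with unit normal $\tau_a=N\nabla_a t$ and lapse $N>0$. Let $\phi^a$ be a Killing field generating a circle action that preserves the slices, and assume that, off the symmetry axis, $\phi^a$ is on every slice orthogonal to the orbit planes (coordinates $(t,x,y,\phi)$, $\phi^a=\partial_\phi$, orbit planes $\{t,\phi \text{ const}\}$). Let $h_{ab}$ and $K_{ab}$ (the restriction of $\nabla_a\tau_b$) be the metric and second fundamental form of the initial slice, $X=\phi^a\phi_a>0$ (the norm taken in $h$), $\eta^a=X^{-1/2}\phi^a$, $h_{ab}=P_{ab}+\eta_a\eta_b$, and let $D$, $\slashed\nabla$ be the connections of $h$ and $P$. The orbit plane $\Sigma$ of the initial slice, without the axis, is an open domain with coordinates $(x,y)$, $x>0$, diffeomorphic to an open half plane. The initial data are quasi-stationary: $K_{ab}P^a{}_lP^b{}_m=0$ and $K_{ab}\eta^a\eta^b=0$. Put $$V_a=K_{ab}\eta^b,\qquad v_a=XV_a,\qquad w=\tfrac12N^{-1}X^{3/2}.$$ **Statement.** 1. The momentum constraint $D_aK^{ab}=0$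 holds if and only if $\slashed\nabla^a(XV_a)=0$ on $\Sigma$. 2. The field $\tilde V_a=\tfrac12NX^{-1/2}V_a$ is curl-free, $\slashed\nabla_{[a}\tilde V_{b]}=0$. There is a smooth function $\Omega$ on $\Sigma$, unique up to an additive constant, with $$V_a=\tfrac12N^{-1}X^{1/2}\,\partial_a\Omega .$$ 3. Suppose that the momentum constraint holds and the data are asymptotically Euclidean: near infinity $(x,y,\phi)$ are cylindrical coordinates in whose Cartesian coordinates, with $r=\sqrt{x^2+y^2}$, one has $h_{ij}=\delta_{ij}+O(1/r)$, $\partial h=O(1/r^2)$, $\partial^2h=O(1/r^3)$, $K=O(1/r^2)$, $\partial K=O(1/r^3)$, $N=1+O(1/r)$ and $\partial N=O(1/r^2)$, uniformly up to the axis. Then exactly one such potential satisfies $\Omega=O(1/r^3)$ as $r\to\infty$. 4. For every such potential $\Omega$, the momentum constraint is equivalent to $\slashed\nabla^a(w\,\partial_a\Omega)=0$, and also to the existence of a smooth stream function $\Psi$ on $\Sigma$ with $d\Psi=w\star d\Omega$, where $\star$ is the Hodge star of $P$. 5. Suppose that $(x,y)$ are isothermal, $P=e^{2q}(dx^2+dy^2)$.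 Then the momentum constraint is equivalent to the continuity equation $\partial_xv_x+\partial_yv_y=0$ of a steady compressible flow, while $NX^{-3/2}v_a$ is curl-free. For every potential $\Omega$, the momentum constraint is equivalent to $$(w\Omega_x)_x+(w\Omega_y)_y=0 .$$ The stream functions are exactly the smooth $\Psi$ with $$w\Omega_x=\Psi_y,\qquad w\Omega_y=-\Psi_x .$$ Every such $\Psi$ satisfies $(w^{-1}\Psi_x)_x+(w^{-1}\Psi_y)_y=0$ and $\Omega_x\Psi_x+\Omega_y\Psi_y=0$. With $z=x+iy$, the map $f=\Omega+i\Psi$ satisfies the Beltrami (quasi-conformal) equation $$f_{\bar z}=\mu\,\overline{f_z},\qquad \mu=\frac{1-w}{1+w},\quad |\mu|<1 .$$ -/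

import Mathlib

open scoped ContDiff

noncomputable section

namespace QuasiStationary

/-! ### Tensor calculus in a coordinate chart of `ℝⁿ` -/

/-- The `i`-th partial derivative. -/
def pd {n : ℕ} {E : Type*} [NormedAddCommGroup E] [NormedSpace ℝ E]
    (i : Fin n) (f : (Fin n → ℝ) → E) (p : Fin n → ℝ) : E :=
  fderiv ℝ f p (Pi.single i 1)

/-- The components of a covariant (or contravariant) two-tensor field in a chart. -/
abbrev TensorField (n : ℕ) := (Fin n → ℝ) → Matrix (Fin n) (Fin n) ℝ

/-- The components of a covector field in a chart. -/
abbrev CovectorField (n : ℕ) := (Fin n → ℝ) → Fin n → ℝ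

/-- The Christoffel symbols `Γᵏᵢⱼ` of the Levi-Civita connection of `g`. -/
def christoffel {n : ℕ} (g : TensorField n) (p : Fin n → ℝ) (k i j : Fin n) : ℝ :=
  (1 / 2) * ∑ l, (g p)⁻¹ k l *
    (pd i (fun q => g q j l) p + pd j (fun q => g q i l) p - pd l (fun q => g q i j) p)

/-- The covariant derivative `∇ₐ αᵦ` of a covector field. -/
def covDeriv {n : ℕ} (g : TensorField n) (α : CovectorField n) (p : Fin n → ℝ)
    (a b : Fin n) : ℝ :=
  pd a (fun q => α q b) p - ∑ c, christoffel g p c a b * α p c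

/-- The divergence `∇ᵃ αₐ` of a covector field. -/
def divCovector {n : ℕ} (g : TensorField n) (α : CovectorField n) (p : Fin n → ℝ) : ℝ :=
  ∑ a, ∑ b, (g p)⁻¹ a b * covDeriv g α p a b

/-- Raising both indices of a covariant two-tensor: `Tᵃᵇ = gᵃᶜ Tᶜᵈ gᵈᵇ`. -/
def raise {n : ℕ} (g T : TensorField n) : TensorField n :=
  fun p => (g p)⁻¹ * T p * (g p)⁻¹

/-- The divergence `∇ₐ Tᵃᵇ` of a covariant two-tensor field `T` whose indices are raised. -/
def divTensor {n : ℕ} (g T : TensorField n) (p : Fin n → ℝ) (b : Fin n) : ℝ :=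
  (∑ a, pd a (fun q => raise g T q a b) p)
    + (∑ a, ∑ c, christoffel g p a a c * raise g T p c b)
    + ∑ a, ∑ c, christoffel g p b a c * raise g T p a c

/-! ### The spacetime chart and the initial slice

Spacetime coordinates are `(t, x, y, φ)` (indices `0, 1, 2, 3`), coordinates of the slice `t = 0`
are `(x, y, φ)` (indices `0, 1, 2`), and coordinates of the orbit plane `Σ`, the surface
`t = 0`, `φ = 0`, are `(x, y)` (indices `0, 1`). The metric has signature `(+, -, -, -)`. -/

/-- The point `(t, q)` of the spacetime chart. -/
def spacetimePoint (t : ℝ) (q : Fin 3 → ℝ) : Fin 4 → ℝ := Fin.cons t q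

/-- The point of the slice over the point `u` of the orbit plane. -/
def planePoint (u : Fin 2 → ℝ) : Fin 3 → ℝ := ![u 0, u 1, 0]

/-- The part of the spacetime chart over the time interval `(-δ, δ)` and the domain `U` of `Σ`. -/
def slab (U : Set (Fin 2 → ℝ)) (δ : ℝ) : Set (Fin 4 → ℝ) :=
  {p | |p 0| < δ ∧ ![p 1, p 2] ∈ U}

/-- The lapse function of the foliation by the level sets of `t`: `N = (gᵗᵗ)^(-1/2)`. -/
def lapse4 (g : TensorField 4) (p : Fin 4 → ℝ) : ℝ := 1 / √((g p)⁻¹ 0 0)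

/-- The unit normal covector `τ = N dt` of the slices. -/
def unitNormal (g : TensorField 4) : CovectorField 4 :=
  fun p => Pi.single 0 (lapse4 g p)

/-- The Riemannian metric induced on the slice of constant time `t`, with `g = τ ⊗ τ - h`. -/
def sliceMetric (g : TensorField 4) (t : ℝ) : TensorField 3 :=
  fun q => Matrix.of fun i j => -g (spacetimePoint t q) i.succ j.succ

/-- The metric `h` of the initial slice. -/
def metric (g : TensorField 4) : TensorField 3 := sliceMetric g 0

/-- The lapse function on the initial slice. -/
def lapse (g : TensorField 4) (q : Fin 3 → ℝ) : ℝ := lapse4 g (spacetimePoint 0 q)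

/-- The second fundamental form `Kₐᵦ = ∇ₐ τᵦ` of the initial slice. -/
def secondForm (g : TensorField 4) : TensorField 3 :=
  fun q => Matrix.of fun i j =>
    covDeriv g (unitNormal g) (spacetimePoint 0 q) i.succ j.succ

/-- The open half plane `x > 0`. -/
def halfPlane : Set (Fin 2 → ℝ) := {u | 0 < u 0}

/-- `U` is diffeomorphic to the open half plane. -/
def DiffeoHalfPlane (U : Set (Fin 2 → ℝ)) : Prop :=
  ∃ F G : (Fin 2 → ℝ) → (Fin 2 → ℝ),
    ContDiffOn ℝ ∞ F halfPlane ∧ ContDiffOn ℝ ∞ G U ∧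
    Set.MapsTo F halfPlane U ∧ Set.MapsTo G U halfPlane ∧
    Set.LeftInvOn G F halfPlane ∧ Set.RightInvOn G F U

/-- A spacetime with a foliation by axisymmetric spacelike slices, whose initial slice is
quasi-stationary. The chart covers the complement of the symmetry axis: the orbit plane without
the axis is the domain `U` of the half plane `x > 0`, and `∂/∂φ` generates the circle action. -/
structure IsQuasiStationary (g : TensorField 4) (U : Set (Fin 2 → ℝ)) (δ : ℝ) : Prop where
  time_pos : 0 < δ
  isOpen : IsOpen U
  subset : U ⊆ halfPlane
  diffeo : DiffeoHalfPlane U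
  smooth : ∀ μ ν, ContDiffOn ℝ ∞ (fun p => g p μ ν) (slab U δ)
  symm : ∀ p ∈ slab U δ, (g p).IsSymm
  /-- The slices are spacelike. -/
  spacelike : ∀ t q, spacetimePoint t q ∈ slab U δ → (sliceMetric g t q).PosDef
  /-- The conormal `dt` of the slices is timelike. -/
  timelike : ∀ p ∈ slab U δ, 0 < (g p)⁻¹ 0 0
  /-- The field `∂/∂φ` is Killing. -/
  killing : ∀ p ∈ slab U δ, ∀ s : ℝ, g (p + Pi.single 3 s) = g p
  /-- On every slice the field `∂/∂φ` is orthogonal to the surfaces of constant `φ`. -/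
  orthogonal : ∀ t q, spacetimePoint t q ∈ slab U δ →
    sliceMetric g t q 0 2 = 0 ∧ sliceMetric g t q 1 2 = 0
  /-- `Kₐᵦ Pᵃₗ Pᵇₘ = 0` on the initial slice. -/
  secondForm_tangent : ∀ q : Fin 3 → ℝ, ![q 0, q 1] ∈ U →
    ∀ a b : Fin 2, secondForm g q a.castSucc b.castSucc = 0
  /-- `Kₐᵦ ηᵃ ηᵇ = 0` on the initial slice. -/
  secondForm_axial : ∀ q : Fin 3 → ℝ, ![q 0, q 1] ∈ U → secondForm g q 2 2 = 0

/-- The momentum constraint `Dₐ Kᵃᵇ = 0` on the initial slice. -/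
def MomentumConstraint (g : TensorField 4) (U : Set (Fin 2 → ℝ)) : Prop :=
  ∀ q : Fin 3 → ℝ, ![q 0, q 1] ∈ U → ∀ b, divTensor (metric g) (secondForm g) q b = 0

/-! ### Fields on the orbit plane -/

/-- The squared norm `X = φᵃ φₐ` of the axial Killing field. -/
def normSq (g : TensorField 4) (u : Fin 2 → ℝ) : ℝ := metric g (planePoint u) 2 2

/-- The lapse function on `Σ`. -/
def planeLapse (g : TensorField 4) (u : Fin 2 → ℝ) : ℝ := lapse g (planePoint u)

/-- The unit axial field `ηᵃ = X^(-1/2) φᵃ`. -/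
def unitAxial (g : TensorField 4) (u : Fin 2 → ℝ) : Fin 3 → ℝ :=
  Pi.single 2 (1 / √(normSq g u))

/-- The metric `P` of `Σ`. -/
def planeMetric (g : TensorField 4) : TensorField 2 :=
  fun u => Matrix.of fun a b => metric g (planePoint u) a.castSucc b.castSucc

/-- The covector field `Vₐ = Kₐᵦ ηᵇ` on `Σ`. -/
def velocity (g : TensorField 4) : CovectorField 2 :=
  fun u a => ∑ b, secondForm g (planePoint u) a.castSucc b * unitAxial g u b

/-- The mass flow `vₐ = X Vₐ`. -/
def flow (g : TensorField 4) : CovectorField 2 := fun u a => normSq g u * velocity g u a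

/-- The rescaled field `½ N X^(-1/2) Vₐ`. -/
def rescaled (g : TensorField 4) : CovectorField 2 :=
  fun u a => (1 / 2) * planeLapse g u * (√(normSq g u))⁻¹ * velocity g u a

/-- The density `w = ½ N⁻¹ X^(3/2)`. -/
def density (g : TensorField 4) (u : Fin 2 → ℝ) : ℝ :=
  (1 / 2) * (planeLapse g u)⁻¹ * √(normSq g u) ^ 3

/-- `Ω` is an angular velocity potential: `Vₐ = ½ N⁻¹ X^(1/2) ∂ₐ Ω` on `U`. -/
def IsAngularVelocity (g : TensorField 4) (U : Set (Fin 2 → ℝ)) (Ω : (Fin 2 → ℝ) → ℝ) : Prop :=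
  ContDiffOn ℝ ∞ Ω U ∧
    ∀ u ∈ U, ∀ a, velocity g u a = (1 / 2) * (planeLapse g u)⁻¹ * √(normSq g u) * pd a Ω u

/-- The Hodge star of a covector field on an oriented surface with metric `P`. -/
def hodgeStar (P : TensorField 2) (α : CovectorField 2) : CovectorField 2 :=
  fun u => ![-(√(P u).det * ∑ c, (P u)⁻¹ 1 c * α u c), √(P u).det * ∑ c, (P u)⁻¹ 0 c * α u c]

/-- `Ψ` is a stream function of the flow with potential `Ω`: `dΨ = w ⋆dΩ` on `U`. -/
def IsStreamFunction (g : TensorField 4) (U : Set (Fin 2 → ℝ)) (Ω Ψ : (Fin 2 → ℝ) → ℝ) : Prop :=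
  ContDiffOn ℝ ∞ Ψ U ∧ ∀ u ∈ U, ∀ a,
    pd a Ψ u = density g u * hodgeStar (planeMetric g) (fun z b => pd b Ω z) u a

/-- The coordinates `(x, y)` are isothermal: `P = e^(2q) (dx² + dy²)` on `U`. -/
def Isothermal (g : TensorField 4) (U : Set (Fin 2 → ℝ)) : Prop :=
  ∀ u ∈ U, planeMetric g u 0 0 = planeMetric g u 1 1 ∧ planeMetric g u 0 1 = 0

/-- The Wirtinger derivative `∂f/∂z` for `z = x + i y`. -/
def dz (f : (Fin 2 → ℝ) → ℂ) (u : Fin 2 → ℝ) : ℂ :=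
  (1 / 2) * (pd 0 f u - Complex.I * pd 1 f u)

/-- The Wirtinger derivative `∂f/∂z̄` for `z = x + i y`. -/
def dzbar (f : (Fin 2 → ℝ) → ℂ) (u : Fin 2 → ℝ) : ℂ :=
  (1 / 2) * (pd 0 f u + Complex.I * pd 1 f u)

/-! ### Asymptotically Euclidean data

Near infinity `(x, y, φ)` are cylindrical coordinates, `(x cos φ, x sin φ, y)` are the Cartesian
coordinates. -/

/-- The radial parameter. -/
def radius (u : Fin 2 → ℝ) : ℝ := √(u 0 ^ 2 + u 1 ^ 2)

/-- The derivatives of `(x, y, φ)` (row index) by the Cartesian coordinates (column index). -/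
def cartJacobian (q : Fin 3 → ℝ) : Matrix (Fin 3) (Fin 3) ℝ :=
  !![Real.cos (q 2), Real.sin (q 2), 0;
     0, 0, 1;
     -Real.sin (q 2) / q 0, Real.cos (q 2) / q 0, 0]

/-- The Cartesian components of a covariant two-tensor field. -/
def cartComp (T : TensorField 3) (q : Fin 3 → ℝ) (i j : Fin 3) : ℝ :=
  ∑ μ, ∑ ν, T q μ ν * cartJacobian q μ i * cartJacobian q ν j

/-- The partial derivative by the `k`-th Cartesian coordinate. -/
def cartPd (k : Fin 3) (f : (Fin 3 → ℝ) → ℝ) (q : Fin 3 → ℝ) : ℝ :=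
  ∑ μ, cartJacobian q μ k * pd μ f q

/-- The initial data set is asymptotically Euclidean, and its lapse tends to one. -/
def IsAsymptoticallyEuclidean (g : TensorField 4) (U : Set (Fin 2 → ℝ)) : Prop :=
  ∃ C R : ℝ, 0 < R ∧ (∀ u ∈ halfPlane, R < radius u → u ∈ U) ∧
    ∀ q : Fin 3 → ℝ, 0 < q 0 → R < radius ![q 0, q 1] → ∀ i j k l : Fin 3,
      |cartComp (metric g) q i j - (1 : Matrix (Fin 3) (Fin 3) ℝ) i j| ≤
          C / radius ![q 0, q 1] ∧
      |cartPd k (fun z => cartComp (metric g) z i j) q| ≤ C / radius ![q 0, q 1] ^ 2 ∧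
      |cartPd l (cartPd k (fun z => cartComp (metric g) z i j)) q| ≤
          C / radius ![q 0, q 1] ^ 3 ∧
      |cartComp (secondForm g) q i j| ≤ C / radius ![q 0, q 1] ^ 2 ∧
      |cartPd k (fun z => cartComp (secondForm g) z i j) q| ≤ C / radius ![q 0, q 1] ^ 3 ∧
      |lapse g q - 1| ≤ C / radius ![q 0, q 1] ∧
      |cartPd k (lapse g) q| ≤ C / radius ![q 0, q 1] ^ 2

/-- `Ω = O(1/r³)` as `r → ∞`. -/
def CubicDecay (U : Set (Fin 2 → ℝ)) (Ω : (Fin 2 → ℝ) → ℝ) : Prop :=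
  ∃ C R : ℝ, 0 < R ∧ ∀ u ∈ U, R < radius u → |Ω u| ≤ C / radius u ^ 3

end QuasiStationary

end

/-!
# Quasi-stationary axisymmetric initial data

All fields on the initial slice are functions of the two coordinates of the orbit plane, because
`∂/∂φ` is Killing, and the statements reduce to computations with such functions.

*The potential.* Orthogonality of `∂/∂φ` to the orbit planes leaves in `Kₐᵩ = -N Γ⁰ₐᵩ` only the
derivatives of the shift component `gₜᵩ` and of `X = -gᵩᵩ`, and `g⁰⁰ gₜᵩ + g⁰ᵠ gᵩᵩ = 0` turns them
into `Kₐᵩ = ½ N⁻¹ X ∂ₐ(gₜᵩ / gᵩᵩ)`. Hence `Ω = gₜᵩ / gᵩᵩ` (`shiftPotential`) is a global angular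
velocity potential, with no integration, and the curl identities are symmetries of its second
derivatives.

*The momentum constraint.* The slice metric is `P ⊕ X dφ²` and `K` has only mixed components, so the
components of `Dₐ Kᵃᵇ` along the orbit plane vanish identically, and the axial one is
`X^(-3/2) ∇ᵃ(X Vₐ)` (`IsQuasiStationary.divTensor_eq`). As `d ⋆ v = (∇ᵃ vₐ) dA`
(`pd_hodgeStar`), the constraint says that `⋆ v = w ⋆ dΩ` is closed. A closed form on a domain
diffeomorphic to a half plane is exact (`exists_primitive_of_closed`), which gives the stream
function. The isothermal case, including the Beltrami equation, is algebra from there.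

*Decay.* Near infinity the constraint is a perturbation of `Ωₓₓ + Ωᵧᵧ + 3 x⁻¹ Ωₓ = 0`, the
Laplace equation of `ℝ⁵` for functions symmetric about an axis, whose decaying solutions are
`O(r⁻³)`. The Cartesian components rotate along the axial circles, so that a bound for their
derivative in that direction is a bound for `x⁻¹` times a component; therefore the mixed
components of `K` and of `P` vanish at the axis at the rate needed
(`IsQuasiStationary.asymptotic_bounds`). This gives `dΩ = O(r⁻³)`, so `Ω` has a limit at infinity
(`exists_limit_of_pd_bound`). After subtraction of the limit, the maximum principle compares `Ω`
with the strict supersolution `r⁻³ - κ r⁻⁴`, where a small multiple of the supersolution `x⁻¹`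
excludes a maximum near the axis (`le_barrier_of_elliptic`).
-/

namespace QuasiStationary

open Filter Topology

/-! ### Calculus of partial derivatives -/

section PartialDerivatives

variable {n : ℕ} {f g : (Fin n → ℝ) → ℝ} {p : Fin n → ℝ} {U : Set (Fin n → ℝ)}

theorem pd_congr {E : Type*} [NormedAddCommGroup E] [NormedSpace ℝ E]
    {f g : (Fin n → ℝ) → E} (i : Fin n) (h : f =ᶠ[𝓝 p] g) : pd i f p = pd i g p := by
  simp only [pd, h.fderiv_eq]

theorem pd_congr_of_eqOn (i : Fin n) (hU : IsOpen U) (hp : p ∈ U) (h : Set.EqOn f g U) :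
    pd i f p = pd i g p :=
  pd_congr i (h.eventuallyEq_of_mem (hU.mem_nhds hp))

@[simp] theorem pd_const (i : Fin n) (c : ℝ) : pd i (fun _ => c) p = 0 := by
  simp [pd]

theorem pd_add (i : Fin n) (hf : DifferentiableAt ℝ f p) (hg : DifferentiableAt ℝ g p) :
    pd i (fun z => f z + g z) p = pd i f p + pd i g p := by
  simp only [pd, fderiv_fun_add hf hg, add_apply]

theorem pd_sub (i : Fin n) (hf : DifferentiableAt ℝ f p) (hg : DifferentiableAt ℝ g p) :
    pd i (fun z => f z - g z) p = pd i f p - pd i g p := by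
  simp only [pd, fderiv_fun_sub hf hg, sub_apply]

theorem pd_neg (i : Fin n) : pd i (fun z => -f z) p = -pd i f p := by
  simp only [pd, fderiv_fun_neg, neg_apply]

theorem pd_mul (i : Fin n) (hf : DifferentiableAt ℝ f p) (hg : DifferentiableAt ℝ g p) :
    pd i (fun z => f z * g z) p = pd i f p * g p + f p * pd i g p := by
  simp only [pd, fderiv_fun_mul hf hg, add_apply,
    smul_apply, smul_eq_mul]
  ring

theorem pd_const_mul (i : Fin n) (c : ℝ) (hf : DifferentiableAt ℝ f p) :
    pd i (fun z => c * f z) p = c * pd i f p := by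
  rw [pd_mul i (differentiableAt_const c) hf]; simp

theorem pd_pow (i : Fin n) (k : ℕ) (hf : DifferentiableAt ℝ f p) :
    pd i (fun z => f z ^ k) p = k * f p ^ (k - 1) * pd i f p := by
  simp only [pd, fderiv_fun_pow k hf, smul_apply, smul_eq_mul, nsmul_eq_mul]

theorem pd_inv (i : Fin n) (hf : DifferentiableAt ℝ f p) (h0 : f p ≠ 0) :
    pd i (fun z => (f z)⁻¹) p = -pd i f p / f p ^ 2 := by
  have h : HasFDerivAt (fun z => (f z)⁻¹) (-(f p ^ 2)⁻¹ • fderiv ℝ f p) p :=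
    (hasDerivAt_inv h0).comp_hasFDerivAt p hf.hasFDerivAt
  simp only [pd, h.fderiv, smul_apply, smul_eq_mul]
  ring

/-- Composition with a function of one real variable. -/
theorem pd_comp_real (i : Fin n) {F : ℝ → ℝ} {F' : ℝ} (hF : HasDerivAt F F' (f p))
    (hf : DifferentiableAt ℝ f p) : pd i (fun z => F (f z)) p = F' * pd i f p := by
  have h : HasFDerivAt (fun z => F (f z)) (F' • fderiv ℝ f p) p :=
    hF.comp_hasFDerivAt p hf.hasFDerivAt
  simp only [pd, h.fderiv, smul_apply, smul_eq_mul]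

@[simp] theorem pd_coord (i j : Fin n) :
    pd i (fun z : Fin n → ℝ => z j) p = if j = i then 1 else 0 := by
  have h : HasFDerivAt (fun z : Fin n → ℝ => z j) (ContinuousLinearMap.proj (R := ℝ) j) p :=
    (ContinuousLinearMap.proj (R := ℝ) (φ := fun _ : Fin n => ℝ) j).hasFDerivAt
  simp [pd, h.fderiv, Pi.single_apply]

theorem fderiv_apply_eq_sum_pd (v : Fin n → ℝ) :
    fderiv ℝ f p v = ∑ i, v i * pd i f p := by
  conv_lhs => rw [pi_eq_sum_univ' v]
  rw [map_sum]
  refine Finset.sum_congr rfl fun i _ => ?_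
  rw [map_smul, smul_eq_mul, pd]

theorem differentiableAt_of_contDiffOn {F : Type*} [NormedAddCommGroup F]
    [NormedSpace ℝ F] {f : (Fin n → ℝ) → F} (hf : ContDiffOn ℝ ∞ f U) (hU : IsOpen U)
    (hp : p ∈ U) : DifferentiableAt ℝ f p :=
  (hf.contDiffAt (hU.mem_nhds hp)).differentiableAt (by simp)

theorem contDiffOn_pd (hf : ContDiffOn ℝ ∞ f U) (hU : IsOpen U) (i : Fin n) :
    ContDiffOn ℝ ∞ (pd i f) U :=
  (hf.fderiv_of_isOpen hU (m := ∞) (by simp)).clm_apply contDiffOn_const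

theorem pd_comm (hf : ContDiffOn ℝ ∞ f U) (hU : IsOpen U) (hp : p ∈ U) (i j : Fin n) :
    pd i (pd j f) p = pd j (pd i f) p := by
  have hc : ContDiffAt ℝ ∞ f p := hf.contDiffAt (hU.mem_nhds hp)
  have hs : IsSymmSndFDerivAt ℝ f p :=
    hc.isSymmSndFDerivAt (by simp; exact WithTop.coe_le_coe.2 le_top)
  have hd : DifferentiableAt ℝ (fderiv ℝ f) p :=
    (hc.fderiv_right (m := 1) (by norm_cast)).differentiableAt (by simp)
  have key : ∀ a b : Fin n, pd a (pd b f) p =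
      fderiv ℝ (fderiv ℝ f) p (Pi.single a 1) (Pi.single b 1) := by
    intro a b
    have h := hd.hasFDerivAt.clm_apply (hasFDerivAt_const (Pi.single b (1 : ℝ)) p)
    have e : pd b f = fun y => fderiv ℝ f y (Pi.single b 1) := rfl
    rw [e, pd, h.fderiv]
    simp
  rw [key, key]
  exact hs _ _

end PartialDerivatives

/-! ### The Poincaré lemma on a domain diffeomorphic to a half plane -/

theorem isOpen_halfPlane : IsOpen halfPlane :=
  isOpen_lt continuous_const (continuous_apply 0)

theorem convex_halfPlane : Convex ℝ halfPlane := by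
  intro x hx y hy a b ha hb hab
  simp only [halfPlane, Set.mem_ofPred_eq, Pi.add_apply, Pi.smul_apply, smul_eq_mul] at *
  rcases ha.eq_or_lt with rfl | ha
  · have : b = 1 := by linarith
    subst this; simpa using hy
  · have := mul_pos ha hx
    have := mul_nonneg hb hy.le
    linarith

theorem DiffeoHalfPlane.isPreconnected {U : Set (Fin 2 → ℝ)} (h : DiffeoHalfPlane U) :
    IsPreconnected U := by
  obtain ⟨F, G, hF, -, hFU, hGU, -, hGF⟩ := h
  have : F '' halfPlane = U := by
    refine Set.Subset.antisymm hFU.image_subset fun u hu => ⟨G u, hGU hu, hGF hu⟩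
  rw [← this]
  exact convex_halfPlane.isPreconnected.image F hF.continuousOn

/-- A closed one-form on a domain diffeomorphic to a half plane is exact: its pullback to the
half plane, which is convex, has a primitive, and this primitive is transported back. -/
theorem exists_primitive_of_closed {U : Set (Fin 2 → ℝ)} (hU : IsOpen U)
    (hd : DiffeoHalfPlane U) {α : CovectorField 2} (hα : ∀ a, ContDiffOn ℝ ∞ (fun u => α u a) U)
    (hc : ∀ u ∈ U, pd 0 (fun z => α z 1) u = pd 1 (fun z => α z 0) u) :
    ∃ Ψ : (Fin 2 → ℝ) → ℝ, ContDiffOn ℝ ∞ Ψ U ∧ ∀ u ∈ U, ∀ a, pd a Ψ u = α u a := by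
  obtain ⟨F, G, hF, hG, hFU, hGU, -, hGF⟩ := hd
  let π : Fin 2 → (Fin 2 → ℝ) →L[ℝ] ℝ := fun a => ContinuousLinearMap.proj a
  let θ : (Fin 2 → ℝ) → (Fin 2 → ℝ) →L[ℝ] ℝ := fun u => α u 0 • π 0 + α u 1 • π 1
  have hθ : ContDiffOn ℝ ∞ θ U :=
    ((hα 0).smul contDiffOn_const).add ((hα 1).smul contDiffOn_const)
  have hθd : ∀ u ∈ U, ∀ v w, fderiv ℝ θ u v w = fderiv ℝ θ u w v := by
    intro u hu v w
    have h0 := (differentiableAt_of_contDiffOn (hα 0) hU hu)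
    have h1 := (differentiableAt_of_contDiffOn (hα 1) hU hu)
    have h : HasFDerivAt θ _ u :=
      (h0.hasFDerivAt.smul_const (π 0)).add (h1.hasFDerivAt.smul_const (π 1))
    have e0 := fun v : Fin 2 → ℝ => fderiv_apply_eq_sum_pd (f := fun u => α u 0) (p := u) v
    have e1 := fun v : Fin 2 → ℝ => fderiv_apply_eq_sum_pd (f := fun u => α u 1) (p := u) v
    have hcu := hc u hu
    simp only [h.fderiv, add_apply, ContinuousLinearMap.smulRight_apply,
      smul_apply, smul_eq_mul, π, ContinuousLinearMap.proj_apply, e0, e1,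
      Fin.sum_univ_two]
    rw [hcu]; ring
  let η : (Fin 2 → ℝ) → (Fin 2 → ℝ) →L[ℝ] ℝ := fun x => (θ (F x)).comp (fderiv ℝ F x)
  have hη : ∀ x ∈ halfPlane, HasFDerivAt η _ x := fun x hx => by
    have hFx : ContDiffAt ℝ ∞ F x := hF.contDiffAt (isOpen_halfPlane.mem_nhds hx)
    have h1 : HasFDerivAt (fun y => θ (F y)) _ x :=
      (differentiableAt_of_contDiffOn hθ hU (hFU hx)).hasFDerivAt.comp x
        (hFx.differentiableAt (by simp)).hasFDerivAt
    have h2 : HasFDerivAt (fderiv ℝ F) _ x :=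
      ((hFx.fderiv_right (m := 1) (by norm_cast)).differentiableAt (by simp)).hasFDerivAt
    exact h1.clm_comp h2
  obtain ⟨f, hf⟩ := convex_halfPlane.exists_forall_hasFDerivAt_of_fderiv_symmetric 
    isOpen_halfPlane (fun x hx => (hη x hx).differentiableAt.differentiableWithinAt)
    (fun x hx v w => by
      have hFx : ContDiffAt ℝ ∞ F x := hF.contDiffAt (isOpen_halfPlane.mem_nhds hx)
      have hs : IsSymmSndFDerivAt ℝ F x :=
        hFx.isSymmSndFDerivAt (by simp; exact WithTop.coe_le_coe.2 le_top)
      rw [(hη x hx).fderiv]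
      simp only [add_apply, ContinuousLinearMap.comp_apply,
        ContinuousLinearMap.compL_apply, ContinuousLinearMap.flip_apply]
      rw [hs v w, hθd _ (hFU hx)])
  have hΨ : ∀ u ∈ U, HasFDerivAt (fun u => f (G u)) (θ u) u := by
    intro u hu
    have hGd := differentiableAt_of_contDiffOn hG hU hu
    have hFd := differentiableAt_of_contDiffOn hF isOpen_halfPlane (hGU hu)
    have h1 : HasFDerivAt (fun u => f (G u)) _ u := (hf _ (hGU hu)).comp u hGd.hasFDerivAt
    have h2 : HasFDerivAt (fun u => F (G u)) _ u := hFd.hasFDerivAt.comp u hGd.hasFDerivAt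
    have h3 : HasFDerivAt (fun u => F (G u)) (ContinuousLinearMap.id ℝ (Fin 2 → ℝ)) u :=
      (hasFDerivAt_id u).congr_of_eventuallyEq
        (hGF.eqOn.eventuallyEq_of_mem (hU.mem_nhds hu))
    have h4 := h2.unique h3
    have h5 : (η (G u)).comp (fderiv ℝ G u) = θ u := by
      simp only [η]
      rw [ContinuousLinearMap.comp_assoc, h4, hGF hu, ContinuousLinearMap.comp_id]
    rwa [h5] at h1
  refine ⟨fun u => f (G u), ?_, fun u hu a => ?_⟩
  · rw [contDiffOn_infty_iff_fderiv_of_isOpen hU]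
    exact ⟨fun u hu => (hΨ u hu).differentiableAt.differentiableWithinAt,
      hθ.congr fun u hu => (hΨ u hu).fderiv⟩
  · rw [pd, (hΨ u hu).fderiv]
    fin_cases a <;> simp [θ, π]

/-! ### The initial slice in adapted coordinates -/

/-- The projection of the slice along the orbits of the axial symmetry. -/
def orbitProj (q : Fin 3 → ℝ) : Fin 2 → ℝ := ![q 0, q 1]

/-- The copy of the orbit plane in the initial slice at the angle `φ`. -/
def meridian (φ : ℝ) (u : Fin 2 → ℝ) : Fin 4 → ℝ := spacetimePoint 0 ![u 0, u 1, φ]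

theorem spacetimePoint_eq_meridian (q : Fin 3 → ℝ) :
    spacetimePoint 0 q = meridian (q 2) (orbitProj q) := by
  simp only [meridian, orbitProj]
  congr 1
  ext i; fin_cases i <;> rfl

theorem meridian_zero (u : Fin 2 → ℝ) : meridian 0 u = spacetimePoint 0 (planePoint u) := rfl

@[simp] theorem orbitProj_planePoint (u : Fin 2 → ℝ) : orbitProj (planePoint u) = u := by
  ext i; fin_cases i <;> rfl

theorem meridian_add (φ s : ℝ) (u : Fin 2 → ℝ) :
    meridian φ u + Pi.single 3 s = meridian (φ + s) u := by
  ext i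
  fin_cases i <;> simp [meridian, spacetimePoint, Fin.cons, Fin.cases, Fin.induction,
    Fin.induction.go]

theorem hasFDerivAt_meridian (φ : ℝ) (u : Fin 2 → ℝ) :
    HasFDerivAt (meridian φ) (ContinuousLinearMap.pi
      ![0, ContinuousLinearMap.proj 0, ContinuousLinearMap.proj 1, 0] :
        (Fin 2 → ℝ) →L[ℝ] (Fin 4 → ℝ)) u := by
  rw [hasFDerivAt_pi']
  intro i
  fin_cases i
  · exact hasFDerivAt_const (0 : ℝ) u
  · exact (ContinuousLinearMap.proj (R := ℝ) (φ := fun _ : Fin 2 => ℝ) 0).hasFDerivAt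
  · exact (ContinuousLinearMap.proj (R := ℝ) (φ := fun _ : Fin 2 => ℝ) 1).hasFDerivAt
  · exact hasFDerivAt_const φ u

theorem contDiff_meridian (φ : ℝ) : ContDiff ℝ ∞ (meridian φ) := by
  rw [contDiff_pi]
  intro i
  fin_cases i
  · exact contDiff_const (c := (0 : ℝ))
  · exact contDiff_apply ℝ ℝ (0 : Fin 2)
  · exact contDiff_apply ℝ ℝ (1 : Fin 2)
  · exact contDiff_const (c := φ)

theorem pd_comp_meridian {f : (Fin 4 → ℝ) → ℝ} {φ : ℝ} {u : Fin 2 → ℝ}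
    (hf : DifferentiableAt ℝ f (meridian φ u)) (a : Fin 2) :
    pd a (fun z => f (meridian φ z)) u = pd a.castSucc.succ f (meridian φ u) := by
  have h : HasFDerivAt (fun z => f (meridian φ z)) _ u :=
    hf.hasFDerivAt.comp u (hasFDerivAt_meridian φ u)
  rw [pd, h.fderiv, pd, ContinuousLinearMap.comp_apply]
  congr 1
  ext i
  fin_cases a <;> fin_cases i <;> simp

theorem isOpen_slab {U : Set (Fin 2 → ℝ)} (hU : IsOpen U) (δ : ℝ) : IsOpen (slab U δ) := by
  refine IsOpen.inter ?_ ?_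
  · exact isOpen_lt (continuous_abs.comp (continuous_apply 0)) continuous_const
  · refine hU.preimage ?_
    refine continuous_pi fun i => ?_
    fin_cases i
    · exact continuous_apply (1 : Fin 4)
    · exact continuous_apply (2 : Fin 4)

section

variable {g : TensorField 4} {U : Set (Fin 2 → ℝ)} {δ : ℝ} {u : Fin 2 → ℝ} {φ : ℝ}
  {p : Fin 4 → ℝ}

theorem IsQuasiStationary.meridian_mem (hg : IsQuasiStationary g U δ) (hu : u ∈ U) :
    meridian φ u ∈ slab U δ := by
  refine ⟨?_, ?_⟩
  · simpa [meridian, spacetimePoint] using hg.time_pos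
  · have : ![meridian φ u 1, meridian φ u 2] = u := by
      ext i; fin_cases i <;> rfl
    rwa [this]

theorem IsQuasiStationary.apply_meridian (hg : IsQuasiStationary g U δ) (hu : u ∈ U) :
    g (meridian φ u) = g (meridian 0 u) := by
  have := hg.killing _ (hg.meridian_mem (φ := 0) hu) φ
  rwa [meridian_add, zero_add] at this

/-- The metric is nondegenerate: otherwise the matrix inverse has the junk value `0`, and `dt` is
not timelike. -/
theorem IsQuasiStationary.isUnit_det (hg : IsQuasiStationary g U δ) (hp : p ∈ slab U δ) :
    IsUnit (g p).det := by
  by_contra h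
  have := hg.timelike p hp
  rw [Matrix.nonsing_inv_apply_not_isUnit _ h] at this
  simp at this

theorem spacetimePoint_mem_slab (hp : p ∈ slab U δ) :
    spacetimePoint (p 0) ![p 1, p 2, p 3] ∈ slab U δ ∧
      spacetimePoint (p 0) ![p 1, p 2, p 3] = p := by
  have : spacetimePoint (p 0) ![p 1, p 2, p 3] = p := by
    ext i; fin_cases i <;> rfl
  exact ⟨by rwa [this], this⟩

/-- The components of the spacetime metric along `∂/∂φ`: symmetry of the metric and orthogonality
of `∂/∂φ` to the orbit planes of every slice. -/
theorem IsQuasiStationary.apply_axial (hg : IsQuasiStationary g U δ) (hp : p ∈ slab U δ) :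
    g p 1 3 = 0 ∧ g p 2 3 = 0 ∧ g p 3 1 = 0 ∧ g p 3 2 = 0 ∧ g p 3 0 = g p 0 3 := by
  obtain ⟨h1, h2⟩ := spacetimePoint_mem_slab hp
  have h := hg.orthogonal _ _ h1
  simp only [sliceMetric, Matrix.of_apply, h2, neg_eq_zero] at h
  have hs := fun i j => (hg.symm p hp).apply i j
  have e1 : g p 1 3 = 0 := h.1
  have e2 : g p 2 3 = 0 := h.2
  exact ⟨e1, e2, by rw [hs, e1], by rw [hs, e2], hs _ _⟩

theorem IsQuasiStationary.apply_axial_axial_neg (hg : IsQuasiStationary g U δ)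
    (hp : p ∈ slab U δ) : g p 3 3 < 0 := by
  obtain ⟨h1, h2⟩ := spacetimePoint_mem_slab hp
  have h := (hg.spacelike _ _ h1).diag_pos (i := 2)
  simp only [sliceMetric, Matrix.of_apply, h2] at h
  have : 0 < -g p 3 3 := h
  linarith

theorem IsQuasiStationary.differentiableAt (hg : IsQuasiStationary g U δ) (hp : p ∈ slab U δ)
    (i j : Fin 4) : DifferentiableAt ℝ (fun z => g z i j) p :=
  differentiableAt_of_contDiffOn (hg.smooth i j) (isOpen_slab hg.isOpen δ) hp

/-- The metric components do not depend on `φ`, as `∂/∂φ` is Killing. -/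
theorem IsQuasiStationary.pd_three (hg : IsQuasiStationary g U δ) (hp : p ∈ slab U δ)
    (i j : Fin 4) : pd 3 (fun z => g z i j) p = 0 := by
  have h := (hg.differentiableAt hp i j).hasFDerivAt.comp_hasDerivAt_of_eq (x := (0 : ℝ))
    (f := fun s : ℝ => p + s • Pi.single 3 (1 : ℝ))
    (((hasDerivAt_id (0 : ℝ)).smul_const (Pi.single 3 (1 : ℝ))).const_add p) (by simp)
  have h2 : (fun z => g z i j) ∘ (fun s : ℝ => p + s • Pi.single 3 (1 : ℝ)) =
      fun _ => g p i j := by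
    ext s
    have := hg.killing p hp s
    simp only [Function.comp]
    rw [← this]
    congr 2
    ext i; simp [Pi.single_apply]
  rw [h2] at h
  have := h.unique (hasDerivAt_const _ _)
  simpa [pd] using this

theorem IsQuasiStationary.lapse4_pos (hg : IsQuasiStationary g U δ) (hp : p ∈ slab U δ) :
    0 < lapse4 g p :=
  one_div_pos.2 (Real.sqrt_pos.2 (hg.timelike p hp))

/-- The ratio of the `φ`-component of the shift to `-X`. On the initial slice it is an angular
velocity potential. -/
noncomputable def shiftRatio (g : TensorField 4) (p : Fin 4 → ℝ) : ℝ := g p 0 3 * (g p 3 3)⁻¹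

theorem IsQuasiStationary.contDiffOn_shiftRatio (hg : IsQuasiStationary g U δ) :
    ContDiffOn ℝ ∞ (shiftRatio g) (slab U δ) :=
  (hg.smooth 0 3).mul ((hg.smooth 3 3).inv fun _ hp => (hg.apply_axial_axial_neg hp).ne)

/-- `Kᵢⱼ = -Γ⁰ᵢⱼ N`, because the spatial components of the unit normal covector vanish. -/
theorem secondForm_apply (q : Fin 3 → ℝ) (i j : Fin 3) :
    secondForm g q i j = -(christoffel g (spacetimePoint 0 q) 0 i.succ j.succ *
      lapse4 g (spacetimePoint 0 q)) := by
  have h : (fun z => unitNormal g z j.succ) = fun _ => 0 := by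
    ext z; simp [unitNormal]
  simp only [secondForm, covDeriv, Matrix.of_apply, h, pd_const, zero_sub, neg_inj]
  rw [Finset.sum_eq_single 0]
  · simp [unitNormal]
  · intro b _ hb; simp [unitNormal, hb]
  · simp

/-- The mixed components of the second fundamental form are the derivatives of `shiftRatio`:
in the Christoffel symbol `Γ⁰ₐᵩ` only the derivatives of `g₀ᵩ` and of `gᵩᵩ` survive, and the
relation `g⁰⁰ g₀ᵩ + g⁰ᵠ gᵩᵩ = 0` combines them to the derivative of a quotient. -/
theorem IsQuasiStationary.secondForm_mixed_spacetime (hg : IsQuasiStationary g U δ)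
    {q : Fin 3 → ℝ} (hq : orbitProj q ∈ U) (a : Fin 2) :
    secondForm g q a.castSucc 2 =
      -(1 / 2) * (lapse4 g (spacetimePoint 0 q))⁻¹ * g (spacetimePoint 0 q) 3 3 *
        pd a.castSucc.succ (shiftRatio g) (spacetimePoint 0 q) := by
  have hp : spacetimePoint 0 q ∈ slab U δ := by
    rw [spacetimePoint_eq_meridian]; exact hg.meridian_mem hq
  set p := spacetimePoint 0 q with hpdef
  have hopen := isOpen_slab hg.isOpen δ
  have hz : ∀ (l i j : Fin 4), (∀ z ∈ slab U δ, g z i j = 0) →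
      pd l (fun z => g z i j) p = 0 := by
    intro l i j h
    rw [pd_congr_of_eqOn l hopen hp (g := fun _ => 0) h, pd_const]
  have h13 := fun l => hz l 1 3 fun z hz => (hg.apply_axial hz).1
  have h23 := fun l => hz l 2 3 fun z hz => (hg.apply_axial hz).2.1
  have h31 := fun l => hz l 3 1 fun z hz => (hg.apply_axial hz).2.2.1
  have h32 := fun l => hz l 3 2 fun z hz => (hg.apply_axial hz).2.2.2.1
  have h30 : ∀ l, pd l (fun z => g z 3 0) p = pd l (fun z => g z 0 3) p := fun l =>
    pd_congr_of_eqOn l hopen hp fun z hz => (hg.apply_axial hz).2.2.2.2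
  have h3 := hg.pd_three hp
  have hinv : (g p)⁻¹ * g p = 1 := Matrix.nonsing_inv_mul _ (hg.isUnit_det hp)
  have h03 : (g p)⁻¹ 0 0 * g p 0 3 + (g p)⁻¹ 0 3 * g p 3 3 = 0 := by
    have := congrFun (congrFun hinv 0) 3
    rw [Matrix.mul_apply, Fin.sum_univ_four] at this
    simpa [(hg.apply_axial hp).1, (hg.apply_axial hp).2.1] using this
  have hX := (hg.apply_axial_axial_neg hp).ne
  have hN : lapse4 g p ^ 2 * (g p)⁻¹ 0 0 = 1 := by
    have := hg.timelike p hp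
    rw [lapse4, div_pow, Real.sq_sqrt this.le]; field_simp
  have hN0 := (hg.lapse4_pos hp).ne'
  have hd : ∀ l, pd l (shiftRatio g) p = pd l (fun z => g z 0 3) p * (g p 3 3)⁻¹ +
      g p 0 3 * (-pd l (fun z => g z 3 3) p / g p 3 3 ^ 2) := by
    intro l
    have := hg.differentiableAt hp
    have h := pd_mul l (this 0 3) (g := fun z => (g z 3 3)⁻¹) ((this 3 3).inv hX)
    rwa [pd_inv l (this 3 3) hX] at h
  have hΓ : ∀ i : Fin 4, i = 1 ∨ i = 2 → christoffel g p 0 i 3 = 1 / 2 *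
      ((g p)⁻¹ 0 0 * pd i (fun z => g z 0 3) p + (g p)⁻¹ 0 3 * pd i (fun z => g z 3 3) p) := by
    rintro i (rfl | rfl) <;>
      simp [christoffel, Fin.sum_univ_four, h13, h23, h31, h32, h30, h3]
  rw [secondForm_apply, ← hpdef, hd]
  have e : (2 : Fin 3).succ = (3 : Fin 4) := rfl
  rw [e, hΓ _ (by fin_cases a <;> simp)]
  generalize pd a.castSucc.succ (fun z => g z 0 3) p = A
  generalize pd a.castSucc.succ (fun z => g z 3 3) p = B
  have h03' : (g p)⁻¹ 0 3 = -((g p)⁻¹ 0 0 * g p 0 3 / g p 3 3) := by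
    field_simp; linarith
  have hN' : (g p)⁻¹ 0 0 = 1 / lapse4 g p ^ 2 := by field_simp; linarith
  rw [h03', hN']
  field_simp

theorem IsQuasiStationary.secondForm_symm (hg : IsQuasiStationary g U δ)
    {q : Fin 3 → ℝ} (hq : orbitProj q ∈ U) (i j : Fin 3) :
    secondForm g q i j = secondForm g q j i := by
  have hp : spacetimePoint 0 q ∈ slab U δ := by
    rw [spacetimePoint_eq_meridian]; exact hg.meridian_mem hq
  rw [secondForm_apply, secondForm_apply]
  congr 2
  unfold christoffel
  congr 1
  refine Finset.sum_congr rfl fun l _ => ?_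
  rw [pd_congr_of_eqOn l (isOpen_slab hg.isOpen δ) hp (f := fun q => g q i.succ j.succ)
    (g := fun q => g q j.succ i.succ) fun z hz => (hg.symm z hz).apply _ _]
  ring

/-! ### Fields on the orbit plane -/

/-- The angular velocity potential given by the shift of the foliation. -/
noncomputable def shiftPotential (g : TensorField 4) (u : Fin 2 → ℝ) : ℝ :=
  shiftRatio g (meridian 0 u)

theorem IsQuasiStationary.contDiffOn_comp_meridian (hg : IsQuasiStationary g U δ)
    {f : (Fin 4 → ℝ) → ℝ} (hf : ContDiffOn ℝ ∞ f (slab U δ)) :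
    ContDiffOn ℝ ∞ (fun u => f (meridian φ u)) U :=
  hf.comp (contDiff_meridian φ).contDiffOn fun _ hu => hg.meridian_mem hu

theorem IsQuasiStationary.metric_eq (hg : IsQuasiStationary g U δ) {q : Fin 3 → ℝ}
    (hq : orbitProj q ∈ U) : metric g q = metric g (planePoint (orbitProj q)) := by
  have : g (spacetimePoint 0 q) = g (spacetimePoint 0 (planePoint (orbitProj q))) := by
    rw [spacetimePoint_eq_meridian, ← meridian_zero, hg.apply_meridian hq]
  ext i j
  simp [metric, sliceMetric, this]

theorem IsQuasiStationary.lapse_eq (hg : IsQuasiStationary g U δ) {q : Fin 3 → ℝ}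
    (hq : orbitProj q ∈ U) : lapse g q = planeLapse g (orbitProj q) := by
  have : g (spacetimePoint 0 q) = g (spacetimePoint 0 (planePoint (orbitProj q))) := by
    rw [spacetimePoint_eq_meridian, ← meridian_zero, hg.apply_meridian hq]
  simp [planeLapse, lapse, lapse4, this]

theorem IsQuasiStationary.planeLapse_pos (hg : IsQuasiStationary g U δ) (hu : u ∈ U) :
    0 < planeLapse g u :=
  hg.lapse4_pos (hg.meridian_mem (φ := 0) hu)

theorem IsQuasiStationary.posDef_metric (hg : IsQuasiStationary g U δ) (hu : u ∈ U) :
    (metric g (planePoint u)).PosDef :=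
  hg.spacelike 0 (planePoint u) (hg.meridian_mem (φ := 0) hu)

theorem IsQuasiStationary.normSq_pos (hg : IsQuasiStationary g U δ) (hu : u ∈ U) :
    0 < normSq g u :=
  (hg.posDef_metric hu).diag_pos

theorem IsQuasiStationary.metric_symm (hg : IsQuasiStationary g U δ) (hu : u ∈ U) (i j : Fin 3) :
    metric g (planePoint u) i j = metric g (planePoint u) j i := by
  have := (hg.posDef_metric hu).isHermitian.apply i j
  simpa using this.symm

theorem IsQuasiStationary.planeMetric_symm (hg : IsQuasiStationary g U δ) (hu : u ∈ U) :
    planeMetric g u 1 0 = planeMetric g u 0 1 :=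
  hg.metric_symm hu 1 0

theorem IsQuasiStationary.posDef_planeMetric (hg : IsQuasiStationary g U δ) (hu : u ∈ U) :
    (planeMetric g u).PosDef :=
  (hg.posDef_metric hu).submatrix (Fin.castSucc_injective 2)

theorem IsQuasiStationary.planeMetric_pos (hg : IsQuasiStationary g U δ) (hu : u ∈ U) (a : Fin 2) :
    0 < planeMetric g u a a := (hg.posDef_planeMetric hu).diag_pos

theorem IsQuasiStationary.planeMetric_det_pos (hg : IsQuasiStationary g U δ) (hu : u ∈ U) :
    0 < planeMetric g u 0 0 * planeMetric g u 1 1 - planeMetric g u 0 1 ^ 2 := by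
  have := (hg.posDef_planeMetric hu).det_pos
  rw [Matrix.det_fin_two, hg.planeMetric_symm hu] at this
  linarith

theorem IsQuasiStationary.contDiffOn_metric (hg : IsQuasiStationary g U δ) (i j : Fin 3) :
    ContDiffOn ℝ ∞ (fun u => metric g (planePoint u) i j) U :=
  (hg.contDiffOn_comp_meridian (φ := 0) (hg.smooth i.succ j.succ)).neg

theorem IsQuasiStationary.contDiffOn_planeMetric (hg : IsQuasiStationary g U δ) (a b : Fin 2) :
    ContDiffOn ℝ ∞ (fun u => planeMetric g u a b) U :=
  hg.contDiffOn_metric _ _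

theorem IsQuasiStationary.contDiffOn_normSq (hg : IsQuasiStationary g U δ) :
    ContDiffOn ℝ ∞ (normSq g) U :=
  hg.contDiffOn_metric 2 2

theorem IsQuasiStationary.contDiffOn_sqrt_normSq (hg : IsQuasiStationary g U δ) :
    ContDiffOn ℝ ∞ (fun u => √(normSq g u)) U :=
  hg.contDiffOn_normSq.sqrt fun _ hu => (hg.normSq_pos hu).ne'

theorem IsQuasiStationary.contDiffOn_planeLapse (hg : IsQuasiStationary g U δ) :
    ContDiffOn ℝ ∞ (planeLapse g) U := by
  have hdet : ContDiffOn ℝ ∞ (fun p => (g p).det) (slab U δ) := by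
    simp only [Matrix.det_apply]
    exact ContDiffOn.sum fun σ _ => (contDiffOn_prod fun i _ => hg.smooth _ _).const_smul _
  have hadj : ContDiffOn ℝ ∞ (fun p => (g p).adjugate 0 0) (slab U δ) := by
    simp only [Matrix.adjugate_fin_succ_eq_det_submatrix, Matrix.det_apply]
    refine contDiffOn_const.mul (ContDiffOn.sum fun σ _ => ?_)
    exact (contDiffOn_prod fun i _ => hg.smooth _ _).const_smul _
  have hinv : ContDiffOn ℝ ∞ (fun p => (g p)⁻¹ 0 0) (slab U δ) := by
    refine (((hdet.inv fun p hp => (hg.isUnit_det hp).ne_zero)).mul hadj).congr fun p hp => ?_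
    rw [Matrix.inv_def, Ring.inverse_eq_inv']; simp
  have h4 : ContDiffOn ℝ ∞ (lapse4 g) (slab U δ) := by
    refine contDiffOn_const.div (hinv.sqrt fun p hp => (hg.timelike p hp).ne') fun p hp => ?_
    exact (Real.sqrt_pos.2 (hg.timelike p hp)).ne'
  exact hg.contDiffOn_comp_meridian (φ := 0) h4

theorem IsQuasiStationary.contDiffOn_density (hg : IsQuasiStationary g U δ) :
    ContDiffOn ℝ ∞ (density g) U :=
  (contDiffOn_const.mul (hg.contDiffOn_planeLapse.inv fun _ hu => (hg.planeLapse_pos hu).ne')).mul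
    (hg.contDiffOn_sqrt_normSq.pow 3)

theorem IsQuasiStationary.sqrt_normSq_pos (hg : IsQuasiStationary g U δ) (hu : u ∈ U) :
    0 < √(normSq g u) := Real.sqrt_pos.2 (hg.normSq_pos hu)

theorem IsQuasiStationary.density_pos (hg : IsQuasiStationary g U δ) (hu : u ∈ U) :
    0 < density g u := by
  have h1 := hg.planeLapse_pos hu
  have h2 := hg.sqrt_normSq_pos hu
  unfold density; positivity

theorem IsQuasiStationary.contDiffOn_shiftPotential (hg : IsQuasiStationary g U δ) :
    ContDiffOn ℝ ∞ (shiftPotential g) U :=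
  hg.contDiffOn_comp_meridian hg.contDiffOn_shiftRatio

theorem IsQuasiStationary.secondForm_mixed (hg : IsQuasiStationary g U δ)
    {q : Fin 3 → ℝ} (hq : orbitProj q ∈ U) (a : Fin 2) :
    secondForm g q a.castSucc 2 = (1 / 2) * (planeLapse g (orbitProj q))⁻¹ *
      normSq g (orbitProj q) * pd a (shiftPotential g) (orbitProj q) := by
  have hX : normSq g (orbitProj q) = -g (spacetimePoint 0 q) 3 3 := by
    rw [normSq, ← hg.metric_eq hq]; rfl
  have hN : planeLapse g (orbitProj q) = lapse4 g (spacetimePoint 0 q) := by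
    rw [← hg.lapse_eq hq]; rfl
  have hΩ : pd a (shiftPotential g) (orbitProj q) =
      pd a.castSucc.succ (shiftRatio g) (spacetimePoint 0 q) := by
    rw [spacetimePoint_eq_meridian, ← pd_comp_meridian]
    · refine pd_congr_of_eqOn a hg.isOpen hq fun u hu => ?_
      simp only [shiftPotential, shiftRatio, hg.apply_meridian (φ := q 2) hu]
    · exact differentiableAt_of_contDiffOn hg.contDiffOn_shiftRatio (isOpen_slab hg.isOpen δ)
        (hg.meridian_mem hq)
  rw [hg.secondForm_mixed_spacetime hq, hX, hN, hΩ]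
  ring

theorem IsQuasiStationary.velocity_eq (hg : IsQuasiStationary g U δ) (hu : u ∈ U) (a : Fin 2) :
    velocity g u a = (1 / 2) * (planeLapse g u)⁻¹ * √(normSq g u) *
      pd a (shiftPotential g) u := by
  have h := hg.secondForm_mixed (q := planePoint u) (by simpa using hu) a
  rw [orbitProj_planePoint] at h
  have hX : normSq g u = √(normSq g u) ^ 2 := (Real.sq_sqrt (hg.normSq_pos hu).le).symm
  have h0 := (hg.sqrt_normSq_pos hu).ne'
  have : velocity g u a = secondForm g (planePoint u) a.castSucc 2 * (1 / √(normSq g u)) := by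
    simp [velocity, unitAxial, Fin.sum_univ_three]
  rw [this, h]
  nth_rewrite 1 [hX]
  field_simp

theorem IsQuasiStationary.isAngularVelocity_shiftPotential (hg : IsQuasiStationary g U δ) :
    IsAngularVelocity g U (shiftPotential g) :=
  ⟨hg.contDiffOn_shiftPotential, fun _ hu a => hg.velocity_eq hu a⟩

theorem IsQuasiStationary.pd_eq_of_isAngularVelocity (hg : IsQuasiStationary g U δ)
    {Ω₁ Ω₂ : (Fin 2 → ℝ) → ℝ} (h₁ : IsAngularVelocity g U Ω₁) (h₂ : IsAngularVelocity g U Ω₂)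
    (hu : u ∈ U) (a : Fin 2) : pd a Ω₁ u = pd a Ω₂ u := by
  have h := (h₁.2 u hu a).symm.trans (h₂.2 u hu a)
  have h1 := hg.planeLapse_pos hu
  have h2 := hg.sqrt_normSq_pos hu
  exact mul_left_cancel₀ (by positivity) h

theorem IsQuasiStationary.angularVelocity_unique (hg : IsQuasiStationary g U δ)
    {Ω₁ Ω₂ : (Fin 2 → ℝ) → ℝ} (h₁ : IsAngularVelocity g U Ω₁) (h₂ : IsAngularVelocity g U Ω₂) :
    ∃ c : ℝ, ∀ u ∈ U, Ω₁ u = Ω₂ u + c := by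
  refine hg.isOpen.exists_eq_add_of_fderiv_eq hg.diffeo.isPreconnected
    (h₁.1.differentiableOn (by simp)) (h₂.1.differentiableOn (by simp)) fun u hu => ?_
  ext v
  rw [fderiv_apply_eq_sum_pd, fderiv_apply_eq_sum_pd]
  exact Finset.sum_congr rfl fun a _ => by rw [hg.pd_eq_of_isAngularVelocity h₁ h₂ hu]

end

/-! ### Divergence on a surface -/

section Surface

variable {P : TensorField 2} {α : CovectorField 2} {u : Fin 2 → ℝ} {U : Set (Fin 2 → ℝ)}

theorem inv_apply_of_symm (hs : P u 1 0 = P u 0 1) :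
    (P u)⁻¹ 0 0 = P u 1 1 / (P u 0 0 * P u 1 1 - P u 0 1 ^ 2) ∧
    (P u)⁻¹ 0 1 = -P u 0 1 / (P u 0 0 * P u 1 1 - P u 0 1 ^ 2) ∧
    (P u)⁻¹ 1 0 = -P u 0 1 / (P u 0 0 * P u 1 1 - P u 0 1 ^ 2) ∧
    (P u)⁻¹ 1 1 = P u 0 0 / (P u 0 0 * P u 1 1 - P u 0 1 ^ 2) := by
  have hdet : (P u).det = P u 0 0 * P u 1 1 - P u 0 1 ^ 2 := by
    rw [Matrix.det_fin_two, hs]; ring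
  have h : (P u)⁻¹ = (P u).det⁻¹ • !![P u 1 1, -P u 0 1; -P u 1 0, P u 0 0] := by
    rw [Matrix.inv_def, Ring.inverse_eq_inv', Matrix.adjugate_fin_two]
  rw [h, hdet, hs]
  refine ⟨?_, ?_, ?_, ?_⟩ <;> simp <;> ring

/-- The divergence of a covector field in terms of the metric components, with the contracted
Christoffel symbols `Pᵃᵇ Γᶜₐᵦ` written out. -/
theorem divCovector_eq (hU : IsOpen U) (hu : u ∈ U) (hs : ∀ z ∈ U, P z 1 0 = P z 0 1)
    (hD : P u 0 0 * P u 1 1 - P u 0 1 ^ 2 ≠ 0) :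
    divCovector P α u =
      (P u 1 1 * pd 0 (fun z => α z 0) u
        - P u 0 1 * (pd 0 (fun z => α z 1) u + pd 1 (fun z => α z 0) u)
        + P u 0 0 * pd 1 (fun z => α z 1) u) / (P u 0 0 * P u 1 1 - P u 0 1 ^ 2)
      - ((P u 1 1 * α u 0 - P u 0 1 * α u 1) *
          (P u 1 1 * pd 0 (fun z => P z 0 0) u / 2 - P u 0 1 * pd 1 (fun z => P z 0 0) u
            + P u 0 0 * (pd 1 (fun z => P z 0 1) u - pd 0 (fun z => P z 1 1) u / 2))
        + (P u 0 0 * α u 1 - P u 0 1 * α u 0) *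
          (P u 0 0 * pd 1 (fun z => P z 1 1) u / 2 - P u 0 1 * pd 0 (fun z => P z 1 1) u
            + P u 1 1 * (pd 0 (fun z => P z 0 1) u - pd 1 (fun z => P z 0 0) u / 2))) /
        (P u 0 0 * P u 1 1 - P u 0 1 ^ 2) ^ 2 := by
  obtain ⟨i00, i01, i10, i11⟩ := inv_apply_of_symm (hs u hu)
  have hp : ∀ i, pd i (fun z => P z 1 0) u = pd i (fun z => P z 0 1) u := fun i =>
    pd_congr_of_eqOn i hU hu hs
  simp only [divCovector, covDeriv, christoffel, Fin.sum_univ_two, i00, i01, i10, i11, hp]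
  generalize P u 0 0 * P u 1 1 - P u 0 1 ^ 2 = D at hD ⊢
  field_simp
  ring

/-- The Hodge star without the inverse metric: `√(det P) / det P = 1 / √(det P)`. -/
theorem hodgeStar_eq (hs : P u 1 0 = P u 0 1)
    (hD : 0 < P u 0 0 * P u 1 1 - P u 0 1 ^ 2) :
    hodgeStar P α u 0 = -((P u 0 0 * α u 1 - P u 0 1 * α u 0) *
      (√(P u 0 0 * P u 1 1 - P u 0 1 ^ 2))⁻¹) ∧
    hodgeStar P α u 1 = (P u 1 1 * α u 0 - P u 0 1 * α u 1) *
      (√(P u 0 0 * P u 1 1 - P u 0 1 ^ 2))⁻¹ := by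
  obtain ⟨i00, i01, i10, i11⟩ := inv_apply_of_symm hs
  have hdet : (P u).det = P u 0 0 * P u 1 1 - P u 0 1 ^ 2 := by
    rw [Matrix.det_fin_two, hs]; ring
  have hsq := Real.sq_sqrt hD.le
  have h0 := (Real.sqrt_pos.2 hD).ne'
  simp only [hodgeStar, Fin.sum_univ_two, i00, i01, i10, i11, hdet, Matrix.cons_val_zero,
    Matrix.cons_val_one]
  generalize √(P u 0 0 * P u 1 1 - P u 0 1 ^ 2) = S at *
  rw [← hsq]
  constructor <;> field_simp <;> ring

/-- `d ⋆ α = (∇ᵃ αₐ) dA`. -/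
theorem pd_hodgeStar (hU : IsOpen U) (hu : u ∈ U)
    (hP : ∀ a b, ContDiffOn ℝ ∞ (fun z => P z a b) U) (hα : ∀ a, ContDiffOn ℝ ∞ (fun z => α z a) U)
    (hs : ∀ z ∈ U, P z 1 0 = P z 0 1) (hD : ∀ z ∈ U, 0 < P z 0 0 * P z 1 1 - P z 0 1 ^ 2) :
    pd 0 (fun z => hodgeStar P α z 1) u - pd 1 (fun z => hodgeStar P α z 0) u =
      √(P u 0 0 * P u 1 1 - P u 0 1 ^ 2) * divCovector P α u := by
  have dP := fun a b => differentiableAt_of_contDiffOn (hP a b) hU hu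
  have dα := fun a => differentiableAt_of_contDiffOn (hα a) hU hu
  set S : (Fin 2 → ℝ) → ℝ := fun z => √(P z 0 0 * P z 1 1 - P z 0 1 ^ 2) with hS
  have hSpos : 0 < S u := Real.sqrt_pos.2 (hD u hu)
  have hSsq : ∀ z ∈ U, S z * S z = P z 0 0 * P z 1 1 - P z 0 1 * P z 0 1 := fun z hz => by
    rw [← pow_two, hS, Real.sq_sqrt (hD z hz).le]; ring
  have dS : DifferentiableAt ℝ S u := by
    refine DifferentiableAt.sqrt ?_ (hD u hu).ne'
    exact ((dP 0 0).fun_mul (dP 1 1)).fun_sub ((dP 0 1).pow 2)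
  have hSpd : ∀ i, pd i S u * S u + S u * pd i S u =
      pd i (fun z => P z 0 0) u * P u 1 1 + P u 0 0 * pd i (fun z => P z 1 1) u
        - (pd i (fun z => P z 0 1) u * P u 0 1 + P u 0 1 * pd i (fun z => P z 0 1) u) := by
    intro i
    rw [← pd_mul i dS dS, pd_congr_of_eqOn i hU hu hSsq,
      pd_sub i ((dP 0 0).fun_mul (dP 1 1)) ((dP 0 1).fun_mul (dP 0 1)), pd_mul i (dP 0 0) (dP 1 1),
      pd_mul i (dP 0 1) (dP 0 1)]
  have e1 : pd 0 (fun z => hodgeStar P α z 1) u =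
      pd 0 (fun z => (P z 1 1 * α z 0 - P z 0 1 * α z 1) * (S z)⁻¹) u :=
    pd_congr_of_eqOn 0 hU hu fun z hz => (hodgeStar_eq (hs z hz) (hD z hz)).2
  have e0 : pd 1 (fun z => hodgeStar P α z 0) u =
      pd 1 (fun z => -((P z 0 0 * α z 1 - P z 0 1 * α z 0) * (S z)⁻¹)) u :=
    pd_congr_of_eqOn 1 hU hu fun z hz => (hodgeStar_eq (hs z hz) (hD z hz)).1
  have dSi : DifferentiableAt ℝ (fun z => (S z)⁻¹) u := dS.inv hSpos.ne'
  have hD2 : P u 0 0 * P u 1 1 - P u 0 1 ^ 2 = S u ^ 2 := by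
    rw [pow_two (S u), hSsq u hu]; ring
  rw [e1, e0, pd_neg,
    pd_mul 0 (((dP 1 1).fun_mul (dα 0)).fun_sub ((dP 0 1).fun_mul (dα 1))) dSi,
    pd_sub 0 ((dP 1 1).fun_mul (dα 0)) ((dP 0 1).fun_mul (dα 1)),
    pd_mul 0 (dP 1 1) (dα 0), pd_mul 0 (dP 0 1) (dα 1),
    pd_mul 1 (((dP 0 0).fun_mul (dα 1)).fun_sub ((dP 0 1).fun_mul (dα 0))) dSi,
    pd_sub 1 ((dP 0 0).fun_mul (dα 1)) ((dP 0 1).fun_mul (dα 0)),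
    pd_mul 1 (dP 0 0) (dα 1), pd_mul 1 (dP 0 1) (dα 0), pd_inv _ dS hSpos.ne',
    pd_inv _ dS hSpos.ne', divCovector_eq hU hu hs (hD u hu).ne', hD2]
  have hp0 : pd 0 S u = (pd 0 (fun z => P z 0 0) u * P u 1 1 + P u 0 0 * pd 0 (fun z => P z 1 1) u
        - (pd 0 (fun z => P z 0 1) u * P u 0 1 + P u 0 1 * pd 0 (fun z => P z 0 1) u))
        / (2 * S u) := by
    rw [← hSpd]; field_simp; ring
  have hp1 : pd 1 S u = (pd 1 (fun z => P z 0 0) u * P u 1 1 + P u 0 0 * pd 1 (fun z => P z 1 1) u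
        - (pd 1 (fun z => P z 0 1) u * P u 0 1 + P u 0 1 * pd 1 (fun z => P z 0 1) u))
        / (2 * S u) := by
    rw [← hSpd]; field_simp; ring
  rw [hp0, hp1]
  have hSu : P u 0 1 ^ 2 = P u 0 0 * P u 1 1 - S u ^ 2 := by linarith
  generalize S u = σ at *
  generalize pd 0 (fun z => P z 0 0) u = p0
  generalize pd 1 (fun z => P z 0 0) u = p1
  generalize pd 0 (fun z => P z 0 1) u = r0
  generalize pd 1 (fun z => P z 0 1) u = r1
  generalize pd 0 (fun z => P z 1 1) u = s0
  generalize pd 1 (fun z => P z 1 1) u = s1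
  generalize pd 0 (fun z => α z 0) u = a00
  generalize pd 1 (fun z => α z 0) u = a01
  generalize pd 0 (fun z => α z 1) u = a10
  generalize pd 1 (fun z => α z 1) u = a11
  generalize P u 0 0 = p at *
  generalize P u 0 1 = r at *
  generalize P u 1 1 = s at *
  generalize α u 0 = a0
  generalize α u 1 = a1
  have hσ := hSpos.ne'
  rw [Real.sqrt_sq hSpos.le]
  field_simp
  linear_combination (2 * s0 * a0 + 2 * a1 * p1 - 2 * a0 * r1 - 2 * a1 * r0) * hSu

end Surface

/-! ### The momentum constraint -/

section Slice

variable {g : TensorField 4} {U : Set (Fin 2 → ℝ)} {δ : ℝ} {u : Fin 2 → ℝ} {q : Fin 3 → ℝ}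

theorem hasFDerivAt_orbitProj (q : Fin 3 → ℝ) :
    HasFDerivAt orbitProj (ContinuousLinearMap.pi
      ![ContinuousLinearMap.proj 0, ContinuousLinearMap.proj 1] :
        (Fin 3 → ℝ) →L[ℝ] (Fin 2 → ℝ)) q := by
  rw [hasFDerivAt_pi']
  intro i
  fin_cases i
  · exact (ContinuousLinearMap.proj (R := ℝ) (φ := fun _ : Fin 3 => ℝ) 0).hasFDerivAt
  · exact (ContinuousLinearMap.proj (R := ℝ) (φ := fun _ : Fin 3 => ℝ) 1).hasFDerivAt

theorem isOpen_preimage_orbitProj (hU : IsOpen U) : IsOpen (orbitProj ⁻¹' U) :=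
  hU.preimage (continuous_iff_continuousAt.2 fun q => (hasFDerivAt_orbitProj q).continuousAt)

/-- The partial derivatives of an axially symmetric function on the slice. -/
theorem pd_comp_orbitProj {f : (Fin 2 → ℝ) → ℝ} (hf : DifferentiableAt ℝ f (orbitProj q)) :
    pd 0 (fun z => f (orbitProj z)) q = pd 0 f (orbitProj q) ∧
    pd 1 (fun z => f (orbitProj z)) q = pd 1 f (orbitProj q) ∧
    pd 2 (fun z => f (orbitProj z)) q = 0 := by
  have h : HasFDerivAt (fun z => f (orbitProj z)) _ q :=
    hf.hasFDerivAt.comp q (hasFDerivAt_orbitProj q)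
  have e : ∀ v : Fin 3 → ℝ, fderiv ℝ (fun z => f (orbitProj z)) q v =
      fderiv ℝ f (orbitProj q) ![v 0, v 1] := by
    intro v
    rw [h.fderiv, ContinuousLinearMap.comp_apply]
    congr 1
    ext i; fin_cases i <;> simp
  refine ⟨?_, ?_, ?_⟩
  · rw [pd, e, pd]; congr 1; ext i; fin_cases i <;> simp
  · rw [pd, e, pd]; congr 1; ext i; fin_cases i <;> simp
  · rw [pd, e]
    have : ![(Pi.single 2 1 : Fin 3 → ℝ) 0, (Pi.single 2 1 : Fin 3 → ℝ) 1] = 0 := by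
      ext i; fin_cases i <;> simp
    rw [this, map_zero]

/-- The components `Kᵃᵠ` of the second fundamental form with raised indices, as functions on the
orbit plane. -/
noncomputable def raisedMixed (g : TensorField 4) (a : Fin 2) (u : Fin 2 → ℝ) : ℝ :=
  ∑ b, (planeMetric g u)⁻¹ a b * flow g u b * (√(normSq g u) ^ 3)⁻¹

theorem IsQuasiStationary.metric_apply (hg : IsQuasiStationary g U δ) (hq : orbitProj q ∈ U) :
    metric g q = !![planeMetric g (orbitProj q) 0 0, planeMetric g (orbitProj q) 0 1, 0;
      planeMetric g (orbitProj q) 0 1, planeMetric g (orbitProj q) 1 1, 0;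
      0, 0, normSq g (orbitProj q)] := by
  have hm := hg.meridian_mem (φ := 0) hq
  have ho : metric g (planePoint (orbitProj q)) 0 2 = 0 ∧
      metric g (planePoint (orbitProj q)) 1 2 = 0 := hg.orthogonal _ _ hm
  have hs := hg.metric_symm hq
  rw [hg.metric_eq hq]
  ext i j
  fin_cases i <;> fin_cases j
  · rfl
  · rfl
  · exact ho.1
  · exact hs 1 0
  · rfl
  · exact ho.2
  · exact (hs 2 0).trans ho.1
  · exact (hs 2 1).trans ho.2
  · rfl

theorem IsQuasiStationary.metric_inv_apply (hg : IsQuasiStationary g U δ) (hq : orbitProj q ∈ U) :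
    (metric g q)⁻¹ = !![(planeMetric g (orbitProj q))⁻¹ 0 0, (planeMetric g (orbitProj q))⁻¹ 0 1, 0;
      (planeMetric g (orbitProj q))⁻¹ 0 1, (planeMetric g (orbitProj q))⁻¹ 1 1, 0;
      0, 0, (normSq g (orbitProj q))⁻¹] := by
  obtain ⟨i00, i01, -, i11⟩ := inv_apply_of_symm (hg.planeMetric_symm hq)
  have hD := (hg.planeMetric_det_pos hq).ne'
  have hX := (hg.normSq_pos hq).ne'
  refine Matrix.inv_eq_right_inv ?_
  rw [hg.metric_apply hq, i00, i01, i11]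
  ext i j
  fin_cases i <;> fin_cases j <;> simp [Matrix.mul_apply, Fin.sum_univ_three] <;> field_simp <;>
    ring

theorem IsQuasiStationary.secondForm_apply (hg : IsQuasiStationary g U δ)
    (hq : orbitProj q ∈ U) :
    secondForm g q = !![0, 0, flow g (orbitProj q) 0 * (√(normSq g (orbitProj q)))⁻¹;
      0, 0, flow g (orbitProj q) 1 * (√(normSq g (orbitProj q)))⁻¹;
      flow g (orbitProj q) 0 * (√(normSq g (orbitProj q)))⁻¹,
        flow g (orbitProj q) 1 * (√(normSq g (orbitProj q)))⁻¹, 0] := by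
  have h0 := (hg.sqrt_normSq_pos hq).ne'
  have hm : ∀ a : Fin 2, secondForm g q a.castSucc 2 =
      flow g (orbitProj q) a * (√(normSq g (orbitProj q)))⁻¹ := by
    intro a
    rw [hg.secondForm_mixed hq, flow, hg.velocity_eq hq]
    field_simp
  have ht := hg.secondForm_tangent q hq
  have hs := hg.secondForm_symm hq
  ext i j
  fin_cases i <;> fin_cases j
  · exact ht 0 0
  · exact ht 0 1
  · exact hm 0
  · exact ht 1 0
  · exact ht 1 1
  · exact hm 1
  · exact (hs 2 0).trans (hm 0)
  · exact (hs 2 1).trans (hm 1)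
  · exact hg.secondForm_axial q hq

theorem IsQuasiStationary.raise_apply (hg : IsQuasiStationary g U δ) (hq : orbitProj q ∈ U) :
    raise (metric g) (secondForm g) q = !![0, 0, raisedMixed g 0 (orbitProj q);
      0, 0, raisedMixed g 1 (orbitProj q);
      raisedMixed g 0 (orbitProj q), raisedMixed g 1 (orbitProj q), 0] := by
  obtain ⟨i00, i01, i10, i11⟩ := inv_apply_of_symm (hg.planeMetric_symm hq)
  have hX : normSq g (orbitProj q) = √(normSq g (orbitProj q)) ^ 2 :=
    (Real.sq_sqrt (hg.normSq_pos hq).le).symm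
  have h0 := (hg.sqrt_normSq_pos hq).ne'
  have hi : (normSq g (orbitProj q))⁻¹ = (√(normSq g (orbitProj q)))⁻¹ ^ 2 := by
    nth_rewrite 1 [hX]; rw [inv_pow]
  rw [raise, hg.metric_inv_apply hq, hg.secondForm_apply hq, hi]
  simp only [raisedMixed, Fin.sum_univ_two]
  rw [i10, ← i01]
  ext i j
  fin_cases i <;> fin_cases j <;> simp [Matrix.mul_apply, Fin.sum_univ_three] <;> ring

theorem IsQuasiStationary.flow_eq (hg : IsQuasiStationary g U δ) (hu : u ∈ U) (a : Fin 2) :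
    flow g u a = density g u * pd a (shiftPotential g) u := by
  have hX : normSq g u = √(normSq g u) ^ 2 := (Real.sq_sqrt (hg.normSq_pos hu).le).symm
  rw [flow, hg.velocity_eq hu, density]
  nth_rewrite 1 [hX]
  ring

theorem IsQuasiStationary.contDiffOn_flow (hg : IsQuasiStationary g U δ) (a : Fin 2) :
    ContDiffOn ℝ ∞ (fun u => flow g u a) U :=
  (hg.contDiffOn_density.mul (contDiffOn_pd hg.contDiffOn_shiftPotential hg.isOpen a)).congr
    fun _ hu => hg.flow_eq hu a

theorem IsQuasiStationary.contDiffOn_planeMetric_inv (hg : IsQuasiStationary g U δ)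
    (a b : Fin 2) : ContDiffOn ℝ ∞ (fun u => (planeMetric g u)⁻¹ a b) U := by
  have hD : ContDiffOn ℝ ∞ (fun u => planeMetric g u 0 0 * planeMetric g u 1 1 -
      planeMetric g u 0 1 ^ 2) U :=
    ((hg.contDiffOn_planeMetric 0 0).mul (hg.contDiffOn_planeMetric 1 1)).sub
      ((hg.contDiffOn_planeMetric 0 1).pow 2)
  have hD0 := fun u (hu : u ∈ U) => (hg.planeMetric_det_pos hu).ne'
  have hi := fun u (hu : u ∈ U) => inv_apply_of_symm (hg.planeMetric_symm hu)
  fin_cases a <;> fin_cases b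
  · exact ((hg.contDiffOn_planeMetric 1 1).div hD hD0).congr fun u hu => (hi u hu).1
  · exact ((hg.contDiffOn_planeMetric 0 1).neg.div hD hD0).congr fun u hu => (hi u hu).2.1
  · exact ((hg.contDiffOn_planeMetric 0 1).neg.div hD hD0).congr fun u hu => (hi u hu).2.2.1
  · exact ((hg.contDiffOn_planeMetric 0 0).div hD hD0).congr fun u hu => (hi u hu).2.2.2

theorem IsQuasiStationary.contDiffOn_raisedMixed (hg : IsQuasiStationary g U δ) (a : Fin 2) :
    ContDiffOn ℝ ∞ (raisedMixed g a) U := by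
  refine ContDiffOn.sum fun b _ => ?_
  refine ((hg.contDiffOn_planeMetric_inv a b).mul (hg.contDiffOn_flow b)).mul ?_
  exact (hg.contDiffOn_sqrt_normSq.pow 3).inv fun u hu => (pow_pos (hg.sqrt_normSq_pos hu) 3).ne'

theorem IsQuasiStationary.flow_eq_raisedMixed (hg : IsQuasiStationary g U δ) (hu : u ∈ U) :
    flow g u 0 = √(normSq g u) ^ 3 *
      (planeMetric g u 0 0 * raisedMixed g 0 u + planeMetric g u 0 1 * raisedMixed g 1 u) ∧
    flow g u 1 = √(normSq g u) ^ 3 *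
      (planeMetric g u 0 1 * raisedMixed g 0 u + planeMetric g u 1 1 * raisedMixed g 1 u) := by
  obtain ⟨i00, i01, i10, i11⟩ := inv_apply_of_symm (hg.planeMetric_symm hu)
  have hD := (hg.planeMetric_det_pos hu).ne'
  have h0 := (hg.sqrt_normSq_pos hu).ne'
  simp only [raisedMixed, Fin.sum_univ_two, i00, i01, i10, i11]
  have hp : planeMetric g u 0 0 ≠ 0 := (hg.planeMetric_pos hu 0).ne'
  generalize hDeq : planeMetric g u 0 0 * planeMetric g u 1 1 - planeMetric g u 0 1 ^ 2 = D at hD ⊢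
  constructor <;> field_simp
  · linear_combination -flow g u 0 * hDeq
  · linear_combination -flow g u 1 * hDeq

set_option linter.unusedSimpArgs false in
/-- The divergence of the second fundamental form: its components along the orbit plane vanish
identically, its axial component is the divergence of the mass flow up to the factor `X^(3/2)`. -/
theorem IsQuasiStationary.divTensor_eq (hg : IsQuasiStationary g U δ) (hq : orbitProj q ∈ U) :
    divTensor (metric g) (secondForm g) q 0 = 0 ∧ divTensor (metric g) (secondForm g) q 1 = 0 ∧
    divTensor (metric g) (secondForm g) q 2 * √(normSq g (orbitProj q)) ^ 3 =
      divCovector (planeMetric g) (flow g) (orbitProj q) := by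
  have hV := isOpen_preimage_orbitProj hg.isOpen
  have hqV : q ∈ orbitProj ⁻¹' U := hq
  have dP := fun a b => differentiableAt_of_contDiffOn (hg.contDiffOn_planeMetric a b) hg.isOpen hq
  have dX := differentiableAt_of_contDiffOn hg.contDiffOn_normSq hg.isOpen hq
  have dY := differentiableAt_of_contDiffOn hg.contDiffOn_sqrt_normSq hg.isOpen hq
  have dA := fun a => differentiableAt_of_contDiffOn (hg.contDiffOn_raisedMixed a) hg.isOpen hq
  have hm : ∀ (l i j : Fin 3) (f : (Fin 2 → ℝ) → ℝ), (∀ z, orbitProj z ∈ U →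
      metric g z i j = f (orbitProj z)) →
      pd l (fun z => metric g z i j) q = pd l (fun z => f (orbitProj z)) q :=
    fun l i j f h => pd_congr_of_eqOn l hV hqV h
  have hr : ∀ (l i j : Fin 3) (f : (Fin 2 → ℝ) → ℝ), (∀ z, orbitProj z ∈ U →
      raise (metric g) (secondForm g) z i j = f (orbitProj z)) →
      pd l (fun z => raise (metric g) (secondForm g) z i j) q =
        pd l (fun z => f (orbitProj z)) q :=
    fun l i j f h => pd_congr_of_eqOn l hV hqV h
  -- all components are pulled back from the orbit plane
  have m00 := fun l => hm l 0 0 (fun u => planeMetric g u 0 0)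
    fun z hz => by rw [hg.metric_apply hz]; rfl
  have m01 := fun l => hm l 0 1 (fun u => planeMetric g u 0 1)
    fun z hz => by rw [hg.metric_apply hz]; rfl
  have m02 := fun l => hm l 0 2 (fun _ => 0) fun z hz => by rw [hg.metric_apply hz]; rfl
  have m10 := fun l => hm l 1 0 (fun u => planeMetric g u 0 1)
    fun z hz => by rw [hg.metric_apply hz]; rfl
  have m11 := fun l => hm l 1 1 (fun u => planeMetric g u 1 1)
    fun z hz => by rw [hg.metric_apply hz]; rfl
  have m12 := fun l => hm l 1 2 (fun _ => 0) fun z hz => by rw [hg.metric_apply hz]; rfl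
  have m20 := fun l => hm l 2 0 (fun _ => 0) fun z hz => by rw [hg.metric_apply hz]; rfl
  have m21 := fun l => hm l 2 1 (fun _ => 0) fun z hz => by rw [hg.metric_apply hz]; rfl
  have m22 := fun l => hm l 2 2 (normSq g) fun z hz => by rw [hg.metric_apply hz]; rfl
  have r00 := fun l => hr l 0 0 (fun _ => 0) fun z hz => by rw [hg.raise_apply hz]; rfl
  have r01 := fun l => hr l 0 1 (fun _ => 0) fun z hz => by rw [hg.raise_apply hz]; rfl
  have r10 := fun l => hr l 1 0 (fun _ => 0) fun z hz => by rw [hg.raise_apply hz]; rfl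
  have r11 := fun l => hr l 1 1 (fun _ => 0) fun z hz => by rw [hg.raise_apply hz]; rfl
  have r22 := fun l => hr l 2 2 (fun _ => 0) fun z hz => by rw [hg.raise_apply hz]; rfl
  have r02 := fun l => hr l 0 2 (raisedMixed g 0) fun z hz => by rw [hg.raise_apply hz]; rfl
  have r20 := fun l => hr l 2 0 (raisedMixed g 0) fun z hz => by rw [hg.raise_apply hz]; rfl
  have r12 := fun l => hr l 1 2 (raisedMixed g 1) fun z hz => by rw [hg.raise_apply hz]; rfl
  have r21 := fun l => hr l 2 1 (raisedMixed g 1) fun z hz => by rw [hg.raise_apply hz]; rfl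
  obtain ⟨p0, p1, p2⟩ := pd_comp_orbitProj (dP 0 0)
  obtain ⟨s0, s1, s2⟩ := pd_comp_orbitProj (dP 1 1)
  obtain ⟨t0, t1, t2⟩ := pd_comp_orbitProj (dP 0 1)
  obtain ⟨x0, x1, x2⟩ := pd_comp_orbitProj dX
  obtain ⟨a0, a1, a2⟩ := pd_comp_orbitProj (dA 0)
  obtain ⟨b0, b1, b2⟩ := pd_comp_orbitProj (dA 1)
  have hs : ∀ z ∈ U, planeMetric g z 1 0 = planeMetric g z 0 1 := fun z hz => hg.planeMetric_symm hz
  have hD := (hg.planeMetric_det_pos hq).ne'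
  obtain ⟨i00, i01, i10, i11⟩ := inv_apply_of_symm (hs _ hq)
  have hXsq : (normSq g (orbitProj q))⁻¹ = (√(normSq g (orbitProj q)) ^ 2)⁻¹ := by
    rw [Real.sq_sqrt (hg.normSq_pos hq).le]
  have hXpd : ∀ i, pd i (normSq g) (orbitProj q) = 2 * √(normSq g (orbitProj q)) *
      pd i (fun u => √(normSq g u)) (orbitProj q) := by
    intro i
    rw [pd_congr_of_eqOn (g := fun u => √(normSq g u) ^ 2) i hg.isOpen hq
      fun u hu => (Real.sq_sqrt (hg.normSq_pos hu).le).symm, pd_pow i 2 dY]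
    norm_num
  -- the flow in terms of `Kᵃᵠ`, which makes the two divergences polynomial in the same quantities
  have f0 : ∀ i, pd i (fun u => flow g u 0) (orbitProj q) =
      pd i (fun u => √(normSq g u) ^ 3 * (planeMetric g u 0 0 * raisedMixed g 0 u +
        planeMetric g u 0 1 * raisedMixed g 1 u)) (orbitProj q) := fun i =>
    pd_congr_of_eqOn i hg.isOpen hq fun u hu => (hg.flow_eq_raisedMixed hu).1
  have f1 : ∀ i, pd i (fun u => flow g u 1) (orbitProj q) =
      pd i (fun u => √(normSq g u) ^ 3 * (planeMetric g u 0 1 * raisedMixed g 0 u +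
        planeMetric g u 1 1 * raisedMixed g 1 u)) (orbitProj q) := fun i =>
    pd_congr_of_eqOn i hg.isOpen hq fun u hu => (hg.flow_eq_raisedMixed hu).2
  have d0 : ∀ i, _ := fun i => pd_mul i (dY.fun_pow 3)
    (((dP 0 0).fun_mul (dA 0)).fun_add ((dP 0 1).fun_mul (dA 1)))
  have d1 : ∀ i, _ := fun i => pd_mul i (dY.fun_pow 3)
    (((dP 0 1).fun_mul (dA 0)).fun_add ((dP 1 1).fun_mul (dA 1)))
  have d2 : ∀ i, _ := fun i => pd_add i ((dP 0 0).fun_mul (dA 0)) ((dP 0 1).fun_mul (dA 1))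
  have d3 : ∀ i, _ := fun i => pd_add i ((dP 0 1).fun_mul (dA 0)) ((dP 1 1).fun_mul (dA 1))
  have d4 : ∀ i a b c, _ := fun i a b c => pd_mul i (dP a b) (dA c)
  have hY := (hg.sqrt_normSq_pos hq).ne'
  have d5 : ∀ i, _ := fun i => pd_pow i 3 dY
  refine ⟨?_, ?_, ?_⟩
  · simp [divTensor, christoffel, Fin.sum_univ_three, hg.metric_inv_apply hq, hg.raise_apply hq,
      m00, m01, m02, m10, m11, m12, m20, m21, m22, r00, r01, r02, r10, r11, r12, r20, r21, r22,
      p0, p1, p2, s0, s1, s2, t0, t1, t2, x0, x1, x2, a0, a1, a2, b0, b1, b2]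
  · simp [divTensor, christoffel, Fin.sum_univ_three, hg.metric_inv_apply hq, hg.raise_apply hq,
      m00, m01, m02, m10, m11, m12, m20, m21, m22, r00, r01, r02, r10, r11, r12, r20, r21, r22,
      p0, p1, p2, s0, s1, s2, t0, t1, t2, x0, x1, x2, a0, a1, a2, b0, b1, b2]
  · rw [divCovector_eq hg.isOpen hq hs hD, (hg.flow_eq_raisedMixed hq).1,
      (hg.flow_eq_raisedMixed hq).2, f0, f1, f0, f1, d0, d1, d0, d1, d2, d3, d2, d3]
    simp only [d4, d5]
    simp [divTensor, christoffel, Fin.sum_univ_three, hg.metric_inv_apply hq, hg.raise_apply hq,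
      m00, m01, m02, m10, m11, m12, m20, m21, m22, r00, r01, r02, r10, r11, r12, r20, r21, r22,
      p0, p1, p2, s0, s1, s2, t0, t1, t2, x0, x1, x2, a0, a1, a2, b0, b1, b2]
    rw [hXpd, hXpd, i00, i01, i11, hXsq]
    generalize √(normSq g (orbitProj q)) = Y at *
    generalize pd 0 (fun z => planeMetric g z 0 0) (orbitProj q) = p0
    generalize pd 1 (fun z => planeMetric g z 0 0) (orbitProj q) = p1
    generalize pd 0 (fun z => planeMetric g z 0 1) (orbitProj q) = r0
    generalize pd 1 (fun z => planeMetric g z 0 1) (orbitProj q) = r1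
    generalize pd 0 (fun z => planeMetric g z 1 1) (orbitProj q) = s0
    generalize pd 1 (fun z => planeMetric g z 1 1) (orbitProj q) = s1
    generalize pd 0 (raisedMixed g 0) (orbitProj q) = A00
    generalize pd 1 (raisedMixed g 0) (orbitProj q) = A01
    generalize pd 0 (raisedMixed g 1) (orbitProj q) = A10
    generalize pd 1 (raisedMixed g 1) (orbitProj q) = A11
    generalize pd 0 (fun u => √(normSq g u)) (orbitProj q) = Y0
    generalize pd 1 (fun u => √(normSq g u)) (orbitProj q) = Y1
    generalize raisedMixed g 0 (orbitProj q) = A0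
    generalize raisedMixed g 1 (orbitProj q) = A1
    generalize planeMetric g (orbitProj q) 0 0 = p at *
    generalize planeMetric g (orbitProj q) 0 1 = r at *
    generalize planeMetric g (orbitProj q) 1 1 = s at *
    clear * - hD hY
    generalize hDeq : p * s - r ^ 2 = D at hD ⊢
    field_simp
    subst hDeq
    ring

end Slice

section

variable {g : TensorField 4} {U : Set (Fin 2 → ℝ)} {δ : ℝ} {u : Fin 2 → ℝ}
  {Ω Ψ : (Fin 2 → ℝ) → ℝ}

theorem IsQuasiStationary.momentumConstraint_iff (hg : IsQuasiStationary g U δ) :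
    MomentumConstraint g U ↔ ∀ u ∈ U, divCovector (planeMetric g) (flow g) u = 0 := by
  constructor
  · intro h u hu
    have hq : orbitProj (planePoint u) ∈ U := by simpa using hu
    have h2 := (hg.divTensor_eq hq).2.2
    rw [h _ hq 2, zero_mul, orbitProj_planePoint] at h2
    exact h2.symm
  · intro h q hq b
    obtain ⟨h0, h1, h2⟩ := hg.divTensor_eq (q := q) hq
    have hq : orbitProj q ∈ U := hq
    rw [h _ hq, mul_eq_zero_iff_right (pow_pos (hg.sqrt_normSq_pos hq) 3).ne'] at h2
    fin_cases b
    · exact h0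
    · exact h1
    · exact h2

/-! ### The angular velocity potential -/

theorem covDeriv_comm {P : TensorField 2} {α : CovectorField 2} (hU : IsOpen U) (hu : u ∈ U)
    (hs : ∀ z ∈ U, P z 1 0 = P z 0 1) (a b : Fin 2)
    (h : pd a (fun z => α z b) u = pd b (fun z => α z a) u) :
    covDeriv P α u a b = covDeriv P α u b a := by
  have hP : ∀ a b, ∀ z ∈ U, P z a b = P z b a := by
    intro a b z hz
    fin_cases a <;> fin_cases b
    · rfl
    · exact (hs z hz).symm
    · exact hs z hz
    · rfl
  have hΓ : ∀ c, christoffel P u c a b = christoffel P u c b a := by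
    intro c
    unfold christoffel
    congr 1
    refine Finset.sum_congr rfl fun l _ => ?_
    rw [pd_congr_of_eqOn l hU hu (hP a b)]
    ring
  simp only [covDeriv, h, hΓ]

theorem IsQuasiStationary.rescaled_eq (hg : IsQuasiStationary g U δ) (hu : u ∈ U) (a : Fin 2) :
    rescaled g u a = 1 / 4 * pd a (shiftPotential g) u := by
  have h1 := (hg.planeLapse_pos hu).ne'
  have h2 := (hg.sqrt_normSq_pos hu).ne'
  rw [rescaled, hg.velocity_eq hu]
  field_simp
  ring

theorem IsQuasiStationary.pd_pd_shiftPotential_comm (hg : IsQuasiStationary g U δ) (hu : u ∈ U)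
    (c : ℝ) (a b : Fin 2) :
    pd a (fun z => c * pd b (shiftPotential g) z) u =
      pd b (fun z => c * pd a (shiftPotential g) z) u := by
  have hΩ := hg.contDiffOn_shiftPotential
  have hd := fun a => differentiableAt_of_contDiffOn (contDiffOn_pd hΩ hg.isOpen a) hg.isOpen hu
  rw [pd_const_mul a c (hd b), pd_const_mul b c (hd a), pd_comm hΩ hg.isOpen hu]

theorem IsQuasiStationary.rescaled_curl_free (hg : IsQuasiStationary g U δ) (hu : u ∈ U)
    (a b : Fin 2) :
    covDeriv (planeMetric g) (rescaled g) u a b = covDeriv (planeMetric g) (rescaled g) u b a := by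
  refine covDeriv_comm hg.isOpen hu (fun z hz => hg.planeMetric_symm hz) a b ?_
  rw [pd_congr_of_eqOn a hg.isOpen hu fun z hz => hg.rescaled_eq hz b,
    pd_congr_of_eqOn b hg.isOpen hu fun z hz => hg.rescaled_eq hz a]
  exact hg.pd_pd_shiftPotential_comm hu _ a b

theorem IsQuasiStationary.flow_eq_of_isAngularVelocity (hg : IsQuasiStationary g U δ)
    (hΩ : IsAngularVelocity g U Ω) (hu : u ∈ U) (a : Fin 2) :
    flow g u a = density g u * pd a Ω u := by
  rw [hg.flow_eq hu, hg.pd_eq_of_isAngularVelocity hΩ hg.isAngularVelocity_shiftPotential hu]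

theorem divCovector_congr {P : TensorField 2} {α β : CovectorField 2} (hU : IsOpen U) (hu : u ∈ U)
    (h : ∀ z ∈ U, ∀ a, α z a = β z a) : divCovector P α u = divCovector P β u := by
  simp only [divCovector, covDeriv]
  refine Finset.sum_congr rfl fun a _ => Finset.sum_congr rfl fun b _ => ?_
  rw [pd_congr_of_eqOn a hU hu fun z hz => h z hz b]
  simp only [h u hu]

theorem IsQuasiStationary.momentumConstraint_iff_potential (hg : IsQuasiStationary g U δ)
    (hΩ : IsAngularVelocity g U Ω) :
    MomentumConstraint g U ↔ ∀ u ∈ U,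
      divCovector (planeMetric g) (fun z a => density g z * pd a Ω z) u = 0 := by
  rw [hg.momentumConstraint_iff]
  refine forall₂_congr fun u hu => ?_
  rw [divCovector_congr hg.isOpen hu fun z hz a => hg.flow_eq_of_isAngularVelocity hΩ hz a]

/-! ### The stream function -/

theorem hodgeStar_mul (P : TensorField 2) (f : (Fin 2 → ℝ) → ℝ) (α : CovectorField 2)
    (a : Fin 2) : hodgeStar P (fun z b => f z * α z b) u a = f u * hodgeStar P α u a := by
  fin_cases a <;> simp [hodgeStar, Fin.sum_univ_two] <;> ring

theorem IsQuasiStationary.hodgeStar_flow (hg : IsQuasiStationary g U δ)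
    (hΩ : IsAngularVelocity g U Ω) (hu : u ∈ U) (a : Fin 2) :
    hodgeStar (planeMetric g) (flow g) u a =
      density g u * hodgeStar (planeMetric g) (fun z b => pd b Ω z) u a := by
  rw [← hodgeStar_mul]
  fin_cases a <;> simp [hodgeStar, hg.flow_eq_of_isAngularVelocity hΩ hu]

theorem IsQuasiStationary.pd_hodgeStar_flow (hg : IsQuasiStationary g U δ) (hu : u ∈ U) :
    pd 0 (fun z => hodgeStar (planeMetric g) (flow g) z 1) u -
      pd 1 (fun z => hodgeStar (planeMetric g) (flow g) z 0) u =
    √(planeMetric g u 0 0 * planeMetric g u 1 1 - planeMetric g u 0 1 ^ 2) *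
      divCovector (planeMetric g) (flow g) u :=
  pd_hodgeStar hg.isOpen hu hg.contDiffOn_planeMetric hg.contDiffOn_flow
    (fun _ hz => hg.planeMetric_symm hz) fun _ hz => hg.planeMetric_det_pos hz

theorem IsQuasiStationary.contDiffOn_hodgeStar_flow (hg : IsQuasiStationary g U δ) (a : Fin 2) :
    ContDiffOn ℝ ∞ (fun u => hodgeStar (planeMetric g) (flow g) u a) U := by
  have hP := hg.contDiffOn_planeMetric
  have hf := hg.contDiffOn_flow
  have hD : ContDiffOn ℝ ∞ (fun u => (√(planeMetric g u 0 0 * planeMetric g u 1 1 -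
      planeMetric g u 0 1 ^ 2))⁻¹) U :=
    ((((hP 0 0).mul (hP 1 1)).sub ((hP 0 1).pow 2)).sqrt
      fun u hu => (hg.planeMetric_det_pos hu).ne').inv
      fun u hu => (Real.sqrt_pos.2 (hg.planeMetric_det_pos hu)).ne'
  have h := fun u (hu : u ∈ U) => hodgeStar_eq (α := flow g) (hg.planeMetric_symm hu)
    (hg.planeMetric_det_pos hu)
  fin_cases a
  · exact ((((hP 0 0).mul (hf 1)).sub ((hP 0 1).mul (hf 0))).mul hD).neg.congr
      fun u hu => (h u hu).1
  · exact ((((hP 1 1).mul (hf 0)).sub ((hP 0 1).mul (hf 1))).mul hD).congr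
      fun u hu => (h u hu).2

/-- The momentum constraint says that `⋆v` is closed; as the orbit plane is diffeomorphic to a
half plane, `⋆v` is then exact. -/
theorem IsQuasiStationary.momentumConstraint_iff_stream (hg : IsQuasiStationary g U δ)
    (hΩ : IsAngularVelocity g U Ω) :
    MomentumConstraint g U ↔ ∃ Ψ, IsStreamFunction g U Ω Ψ := by
  rw [hg.momentumConstraint_iff]
  constructor
  · intro h
    obtain ⟨Ψ, hΨ, hd⟩ := exists_primitive_of_closed hg.isOpen hg.diffeo
      hg.contDiffOn_hodgeStar_flow fun u hu => by
        rw [← sub_eq_zero, hg.pd_hodgeStar_flow hu, h u hu, mul_zero]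
    exact ⟨Ψ, hΨ, fun u hu a => by rw [hd u hu a, hg.hodgeStar_flow hΩ hu]⟩
  · rintro ⟨Ψ, hΨ, hd⟩ u hu
    have e : ∀ z ∈ U, ∀ a, hodgeStar (planeMetric g) (flow g) z a = pd a Ψ z :=
      fun z hz a => by rw [hd z hz a, hg.hodgeStar_flow hΩ hz]
    have h := hg.pd_hodgeStar_flow hu
    rw [pd_congr_of_eqOn 0 hg.isOpen hu fun z hz => e z hz 1,
      pd_congr_of_eqOn 1 hg.isOpen hu fun z hz => e z hz 0] at h
    have h2 : pd 0 (fun z => pd 1 Ψ z) u = pd 1 (fun z => pd 0 Ψ z) u :=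
      pd_comm hΨ hg.isOpen hu 0 1
    rw [h2, sub_self] at h
    exact (mul_eq_zero.1 h.symm).resolve_left
      (Real.sqrt_pos.2 (hg.planeMetric_det_pos hu)).ne'

/-! ### Isothermal coordinates and the Beltrami equation -/

theorem IsQuasiStationary.hodgeStar_isothermal (hg : IsQuasiStationary g U δ)
    (hI : Isothermal g U) (hu : u ∈ U) (α : CovectorField 2) :
    hodgeStar (planeMetric g) α u 0 = -α u 1 ∧ hodgeStar (planeMetric g) α u 1 = α u 0 := by
  obtain ⟨h0, h1⟩ := hodgeStar_eq (α := α) (hg.planeMetric_symm hu) (hg.planeMetric_det_pos hu)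
  obtain ⟨i0, i1⟩ := hI u hu
  have hp := hg.planeMetric_pos hu 1
  have hD : planeMetric g u 1 1 * planeMetric g u 1 1 - 0 ^ 2 = planeMetric g u 1 1 ^ 2 := by ring
  rw [i0, i1, hD, Real.sqrt_sq hp.le] at h0 h1
  rw [h0, h1]
  constructor <;> field_simp <;> ring

theorem IsQuasiStationary.momentumConstraint_iff_continuity (hg : IsQuasiStationary g U δ)
    (hI : Isothermal g U) :
    MomentumConstraint g U ↔
      ∀ u ∈ U, pd 0 (fun z => flow g z 0) u + pd 1 (fun z => flow g z 1) u = 0 := by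
  rw [hg.momentumConstraint_iff]
  refine forall₂_congr fun u hu => ?_
  have h := hg.pd_hodgeStar_flow hu
  rw [pd_congr_of_eqOn 0 hg.isOpen hu fun z hz => (hg.hodgeStar_isothermal hI hz _).2,
    pd_congr_of_eqOn 1 hg.isOpen hu fun z hz => (hg.hodgeStar_isothermal hI hz _).1, pd_neg,
    sub_neg_eq_add] at h
  rw [h, mul_eq_zero_iff_left (Real.sqrt_pos.2 (hg.planeMetric_det_pos hu)).ne']

theorem IsQuasiStationary.lapse_mul_flow (hg : IsQuasiStationary g U δ) (hu : u ∈ U)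
    (a : Fin 2) :
    planeLapse g u * (√(normSq g u) ^ 3)⁻¹ * flow g u a = 1 / 2 * pd a (shiftPotential g) u := by
  have h1 := (hg.planeLapse_pos hu).ne'
  have h2 := (hg.sqrt_normSq_pos hu).ne'
  rw [hg.flow_eq hu, density]
  field_simp

theorem IsQuasiStationary.isStreamFunction_iff (hg : IsQuasiStationary g U δ)
    (hI : Isothermal g U) : IsStreamFunction g U Ω Ψ ↔
      ContDiffOn ℝ ∞ Ψ U ∧ ∀ u ∈ U,
        density g u * pd 0 Ω u = pd 1 Ψ u ∧ density g u * pd 1 Ω u = -pd 0 Ψ u := by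
  refine and_congr_right fun _ => forall₂_congr fun u hu => ?_
  obtain ⟨h0, h1⟩ := hg.hodgeStar_isothermal hI hu fun z b => pd b Ω z
  rw [Fin.forall_fin_two, h0, h1]
  constructor
  · rintro ⟨a, b⟩; exact ⟨b.symm, by rw [a]; ring⟩
  · rintro ⟨a, b⟩; exact ⟨by linarith, a.symm⟩

theorem pd_add_I_mul (hΩ : DifferentiableAt ℝ Ω u) (hΨ : DifferentiableAt ℝ Ψ u) (a : Fin 2) :
    pd a (fun z => (Ω z : ℂ) + Complex.I * (Ψ z : ℂ)) u =
      ((pd a Ω u : ℝ) : ℂ) + Complex.I * ((pd a Ψ u : ℝ) : ℂ) := by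
  have h1 : HasFDerivAt (fun z => (Ω z : ℂ)) (Complex.ofRealCLM.comp (fderiv ℝ Ω u)) u :=
    Complex.ofRealCLM.hasFDerivAt.comp u hΩ.hasFDerivAt
  have h2 : HasFDerivAt (fun z => (Ψ z : ℂ)) (Complex.ofRealCLM.comp (fderiv ℝ Ψ u)) u :=
    Complex.ofRealCLM.hasFDerivAt.comp u hΨ.hasFDerivAt
  have h := h1.fun_add (h2.const_mul Complex.I)
  simp [pd, h.fderiv]

theorem beltrami_of_stream {w : ℝ} (hw : 0 < w) (hΩ : DifferentiableAt ℝ Ω u)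
    (hΨ : DifferentiableAt ℝ Ψ u) (h0 : w * pd 0 Ω u = pd 1 Ψ u)
    (h1 : w * pd 1 Ω u = -pd 0 Ψ u) :
    dzbar (fun z => (Ω z : ℂ) + Complex.I * (Ψ z : ℂ)) u =
      (((1 - w) / (1 + w) : ℝ) : ℂ) *
        (starRingEnd ℂ) (dz (fun z => (Ω z : ℂ) + Complex.I * (Ψ z : ℂ)) u) := by
  have h1' : pd 0 Ψ u = -(w * pd 1 Ω u) := by linarith
  have hw1 : (1 + w) ≠ 0 := by linarith
  simp only [dzbar, dz, pd_add_I_mul hΩ hΨ, ← h0, h1']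
  generalize pd 0 Ω u = A
  generalize pd 1 Ω u = B
  have hμ : (1 - w) / (1 + w) * (1 + w) = 1 - w := by field_simp
  generalize (1 - w) / (1 + w) = μ at hμ ⊢
  apply Complex.ext <;> simp
  · linear_combination -(A / 2) * hμ
  · linear_combination -(B / 2) * hμ

theorem IsQuasiStationary.stream_properties (hg : IsQuasiStationary g U δ)
    (hI : Isothermal g U) (hΩ : IsAngularVelocity g U Ω) (hΨ : IsStreamFunction g U Ω Ψ)
    (hu : u ∈ U) :
    pd 0 (fun z => (density g z)⁻¹ * pd 0 Ψ z) u +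
      pd 1 (fun z => (density g z)⁻¹ * pd 1 Ψ z) u = 0 ∧
    pd 0 Ω u * pd 0 Ψ u + pd 1 Ω u * pd 1 Ψ u = 0 ∧
    |(1 - density g u) / (1 + density g u)| < 1 ∧
    dzbar (fun z => (Ω z : ℂ) + Complex.I * (Ψ z : ℂ)) u =
      (((1 - density g u) / (1 + density g u) : ℝ) : ℂ) *
        (starRingEnd ℂ) (dz (fun z => (Ω z : ℂ) + Complex.I * (Ψ z : ℂ)) u) := by
  obtain ⟨hΨs, h⟩ := (hg.isStreamFunction_iff hI).1 hΨ
  have hw := hg.density_pos hu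
  refine ⟨?_, ?_, ?_, ?_⟩
  · have e0 : ∀ z ∈ U, (density g z)⁻¹ * pd 0 Ψ z = -pd 1 Ω z := fun z hz => by
      have := (hg.density_pos hz).ne'
      have h2 := (h z hz).2
      field_simp; linarith
    have e1 : ∀ z ∈ U, (density g z)⁻¹ * pd 1 Ψ z = pd 0 Ω z := fun z hz => by
      have := (hg.density_pos hz).ne'
      have h1 := (h z hz).1
      field_simp; linarith
    rw [pd_congr_of_eqOn 0 hg.isOpen hu e0, pd_congr_of_eqOn 1 hg.isOpen hu e1, pd_neg]
    have h2 : pd 0 (fun z => pd 1 Ω z) u = pd 1 (fun z => pd 0 Ω z) u :=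
      pd_comm hΩ.1 hg.isOpen hu 0 1
    rw [h2]; ring
  · obtain ⟨h0, h1⟩ := h u hu
    rw [← h0, show pd 0 Ψ u = -(density g u * pd 1 Ω u) by linarith]; ring
  · rw [abs_lt, lt_div_iff₀ (by linarith), div_lt_iff₀ (by linarith)]
    constructor <;> linarith
  · exact beltrami_of_stream hw (differentiableAt_of_contDiffOn hΩ.1 hg.isOpen hu)
      (differentiableAt_of_contDiffOn hΨs hg.isOpen hu) (h u hu).1 (h u hu).2

end

/-! ### Exterior decay for a degenerate elliptic equation -/

section Elliptic

/-- The Hessian at a local maximum is negative semidefinite. Mathlib has the second derivative test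
in one variable; applied to a line with positive second derivative, it makes the maximum a local
minimum too, so that the function is constant there. -/
theorem secondDeriv_nonpos_of_isLocalMax {n : ℕ} {v : (Fin n → ℝ) → ℝ} {V : Set (Fin n → ℝ)}
    {q : Fin n → ℝ} (hv : ContDiffOn ℝ ∞ v V) (hV : IsOpen V) (hq : q ∈ V) (hmax : IsLocalMax v q)
    (ξ : Fin n → ℝ) : ∑ i, ∑ j, ξ i * ξ j * pd i (pd j v) q ≤ 0 := by
  let line : ℝ → (Fin n → ℝ) := fun t => q + t • ξ
  have hline : ∀ t, HasDerivAt line ξ t := fun t => by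
    simpa [line] using ((hasDerivAt_id t).smul_const ξ).const_add q
  have hline0 : line 0 = q := by simp [line]
  have hcont : ContinuousAt line 0 := (hline 0).continuousAt
  have hmem : ∀ᶠ t in 𝓝 (0 : ℝ), line t ∈ V :=
    hcont.eventually (by rw [hline0]; exact hV.mem_nhds hq)
  have hchain : ∀ f : (Fin n → ℝ) → ℝ, ∀ t, DifferentiableAt ℝ f (line t) →
      HasDerivAt (fun t => f (line t)) (∑ i, ξ i * pd i f (line t)) t := by
    intro f t hf
    rw [← fderiv_apply_eq_sum_pd]
    exact hf.hasFDerivAt.comp_hasDerivAt t (hline t)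
  have hd1 : deriv (fun t => v (line t)) =ᶠ[𝓝 0] fun t => ∑ j, ξ j * pd j v (line t) := by
    filter_upwards [hmem] with t ht
    exact (hchain v t (differentiableAt_of_contDiffOn hv hV ht)).deriv
  have hd2 : deriv (deriv fun t => v (line t)) 0 = ∑ i, ∑ j, ξ i * ξ j * pd i (pd j v) q := by
    rw [hd1.deriv_eq]
    have h : HasDerivAt (fun t => ∑ j, ξ j * pd j v (line t))
        (∑ j, ξ j * ∑ i, ξ i * pd i (pd j v) (line 0)) 0 :=
      HasDerivAt.fun_sum fun j _ => ((hchain (pd j v) 0 (differentiableAt_of_contDiffOn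
        (contDiffOn_pd hv hV j) hV (by rwa [hline0]))).const_mul (ξ j))
    rw [h.deriv, hline0, Finset.sum_comm]
    refine Finset.sum_congr rfl fun j _ => ?_
    rw [Finset.mul_sum]
    exact Finset.sum_congr rfl fun i _ => by ring
  have hmax' : IsLocalMax (fun t => v (line t)) 0 := by
    have : IsLocalMax v (line 0) := by rwa [hline0]
    exact this.comp_continuous hcont
  by_contra! hpos
  have hmin : IsLocalMin (fun t => v (line t)) 0 :=
    isLocalMin_of_deriv_deriv_pos (by rwa [hd2]) hmax'.deriv_eq_zero
      (hchain v 0 (differentiableAt_of_contDiffOn hv hV (by rwa [hline0]))).continuousAt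
  have hconst : (fun t => v (line t)) =ᶠ[𝓝 0] fun _ => v (line 0) := by
    filter_upwards [hmax', hmin] with t h1 h2
    exact le_antisymm h1 h2
  have : deriv (deriv fun t => v (line t)) 0 = 0 := by
    rw [(hconst.deriv).deriv_eq]; simp
  rw [← hd2, this] at hpos
  exact lt_irrefl _ hpos

/-- The trace of the product of a negative and a positive semidefinite form is nonpositive. -/
theorem trace_nonpos {a b c H00 H01 H11 : ℝ} (ha : 0 < a) (hab : 0 ≤ a * c - b ^ 2)
    (hH : ∀ x y : ℝ, x ^ 2 * H00 + 2 * (x * y) * H01 + y ^ 2 * H11 ≤ 0) :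
    a * H00 + 2 * b * H01 + c * H11 ≤ 0 := by
  have h1 := hH a b
  have h2 := hH 0 1
  have h3 : a * (a * H00 + 2 * b * H01 + c * H11) ≤ 0 := by
    have : (a * c - b ^ 2) * H11 ≤ 0 := mul_nonpos_of_nonneg_of_nonpos hab (by linarith)
    nlinarith
  by_contra! h
  exact absurd (mul_pos ha h) (not_lt.2 h3)

/-- The inverse of the radius. -/
noncomputable def invRadius (u : Fin 2 → ℝ) : ℝ := (radius u)⁻¹

variable {u : Fin 2 → ℝ}

theorem radius_sq (u : Fin 2 → ℝ) : radius u ^ 2 = u 0 ^ 2 + u 1 ^ 2 :=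
  Real.sq_sqrt (by positivity)

theorem radius_pos (hu : u ∈ halfPlane) : 0 < radius u := by
  have : 0 < u 0 := hu
  exact Real.sqrt_pos.2 (by positivity)

theorem abs_apply_le_radius (u : Fin 2 → ℝ) (i : Fin 2) : |u i| ≤ radius u := by
  refine Real.le_sqrt_of_sq_le ?_
  rw [sq_abs]
  fin_cases i
  · simpa using sq_nonneg (u 1)
  · simpa using sq_nonneg (u 0)

theorem contDiffOn_radius : ContDiffOn ℝ ∞ radius halfPlane := by
  refine ContDiffOn.sqrt ?_ fun u hu => ?_
  · exact (((contDiff_apply ℝ ℝ (0 : Fin 2)).pow 2).add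
      ((contDiff_apply ℝ ℝ (1 : Fin 2)).pow 2)).contDiffOn
  · have : 0 < u 0 := hu
    positivity

theorem continuous_radius : Continuous radius :=
  (((continuous_apply 0).pow 2).add ((continuous_apply 1).pow 2)).sqrt

theorem contDiffOn_invRadius : ContDiffOn ℝ ∞ invRadius halfPlane :=
  contDiffOn_radius.inv fun _ hu => (radius_pos hu).ne'

theorem differentiableAt_coord (p : Fin 2 → ℝ) (i : Fin 2) :
    DifferentiableAt ℝ (fun z : Fin 2 → ℝ => z i) p :=
  differentiableAt_apply i p

theorem pd_radius (hu : u ∈ halfPlane) (i : Fin 2) : pd i radius u = u i * invRadius u := by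
  have hd := differentiableAt_of_contDiffOn contDiffOn_radius isOpen_halfPlane hu
  have h : pd i (fun z => radius z ^ 2) u = 2 * u i := by
    have e : (fun z => radius z ^ 2) = fun z => z 0 ^ 2 + z 1 ^ 2 := funext radius_sq
    rw [e, pd_add i ((differentiableAt_coord u 0).fun_pow 2)
      ((differentiableAt_coord u 1).fun_pow 2), pd_pow i 2 (differentiableAt_coord u 0),
      pd_pow i 2 (differentiableAt_coord u 1)]
    fin_cases i <;> simp
  rw [pd_pow i 2 hd] at h
  have := (radius_pos hu).ne'
  rw [invRadius]
  field_simp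
  norm_num at h
  linarith

theorem pd_invRadius (hu : u ∈ halfPlane) (i : Fin 2) :
    pd i invRadius u = -(u i * invRadius u ^ 3) := by
  have hd := differentiableAt_of_contDiffOn contDiffOn_radius isOpen_halfPlane hu
  have h := pd_inv i hd (radius_pos hu).ne'
  have e : invRadius = fun z => (radius z)⁻¹ := rfl
  rw [e, h, pd_radius hu]
  simp only [invRadius]
  ring

/-- The barrier `r⁻³ - κ r⁻⁴`: the term `r⁻³` solves the flat equation, the second one makes the
sum a strict supersolution of its perturbations. -/
noncomputable def barrier (κ : ℝ) (u : Fin 2 → ℝ) : ℝ := invRadius u ^ 3 - κ * invRadius u ^ 4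

theorem contDiffOn_barrier (κ : ℝ) : ContDiffOn ℝ ∞ (barrier κ) halfPlane :=
  (contDiffOn_invRadius.pow 3).sub (contDiffOn_const.mul (contDiffOn_invRadius.pow 4))

theorem pd_barrier (κ : ℝ) (hu : u ∈ halfPlane) (i : Fin 2) :
    pd i (barrier κ) u = -(u i * (3 * invRadius u ^ 5 - 4 * κ * invRadius u ^ 6)) := by
  have hd := differentiableAt_of_contDiffOn contDiffOn_invRadius isOpen_halfPlane hu
  have e : barrier κ = fun z => invRadius z ^ 3 - κ * invRadius z ^ 4 := rfl
  rw [e, pd_sub i (hd.fun_pow 3) ((hd.fun_pow 4).const_mul κ), pd_const_mul i κ (hd.fun_pow 4),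
    pd_pow i 3 hd, pd_pow i 4 hd, pd_invRadius hu]
  norm_num
  ring

theorem pd_pd_barrier (κ : ℝ) (hu : u ∈ halfPlane) (i j : Fin 2) :
    pd i (pd j (barrier κ)) u =
      u i * u j * (15 * invRadius u ^ 7 - 24 * κ * invRadius u ^ 8) -
        (if j = i then 1 else 0) * (3 * invRadius u ^ 5 - 4 * κ * invRadius u ^ 6) := by
  have hd := differentiableAt_of_contDiffOn contDiffOn_invRadius isOpen_halfPlane hu
  rw [pd_congr_of_eqOn i isOpen_halfPlane hu fun z hz => pd_barrier κ hz j, pd_neg,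
    pd_mul i (differentiableAt_coord u j)
      (((hd.fun_pow 5).const_mul 3).fun_sub ((hd.fun_pow 6).const_mul (4 * κ))),
    pd_sub i ((hd.fun_pow 5).const_mul 3) ((hd.fun_pow 6).const_mul (4 * κ)),
    pd_const_mul i _ (hd.fun_pow 5), pd_const_mul i _ (hd.fun_pow 6), pd_pow i 5 hd,
    pd_pow i 6 hd, pd_invRadius hu, pd_coord]
  norm_num
  ring

theorem contDiffOn_inv_coord : ContDiffOn ℝ ∞ (fun z : Fin 2 → ℝ => (z 0)⁻¹) halfPlane :=
  (contDiff_apply ℝ ℝ (0 : Fin 2)).contDiffOn.inv fun u (hu : 0 < u 0) => hu.ne'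

theorem pd_inv_coord (hu : u ∈ halfPlane) (i : Fin 2) :
    pd i (fun z : Fin 2 → ℝ => (z 0)⁻¹) u = -(if (0 : Fin 2) = i then 1 else 0) / u 0 ^ 2 := by
  have h : u 0 ≠ 0 := (show 0 < u 0 from hu).ne'
  rw [pd_inv i (differentiableAt_coord u 0) h, pd_coord]

theorem pd_pd_inv_coord (hu : u ∈ halfPlane) (i j : Fin 2) :
    pd i (pd j (fun z : Fin 2 → ℝ => (z 0)⁻¹)) u =
      2 * (if (0 : Fin 2) = i then 1 else 0) * (if (0 : Fin 2) = j then 1 else 0) / u 0 ^ 3 := by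
  have h : u 0 ≠ 0 := (show 0 < u 0 from hu).ne'
  have hi : DifferentiableAt ℝ (fun z : Fin 2 → ℝ => (z 0)⁻¹) u :=
    (differentiableAt_coord u 0).inv h
  have e : ∀ z ∈ halfPlane, pd j (fun z : Fin 2 → ℝ => (z 0)⁻¹) z =
      (-(if (0 : Fin 2) = j then 1 else 0)) * (z 0)⁻¹ ^ 2 := fun z hz => by
    rw [pd_inv_coord hz, inv_pow]; rfl
  rw [pd_congr_of_eqOn i isOpen_halfPlane hu e, pd_const_mul i _ (hi.fun_pow 2), pd_pow i 2 hi,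
    pd_inv i (differentiableAt_coord u 0) h, pd_coord]
  fin_cases i <;> fin_cases j <;> simp
  field_simp

/-- The coefficients of an operator `a ∂ₓ² + 2 b ∂ₓ∂ᵧ + c ∂ᵧ² + d₀ ∂ₓ + d₁ ∂ᵧ` at a point of
the half plane, compared with those of `∂ₓ² + ∂ᵧ² + 3 x⁻¹ ∂ₓ`, the Laplacian of `ℝ⁵` on functions
that are symmetric about an axis. -/
structure NearFlat (E : ℝ) (u : Fin 2 → ℝ) (a b c d₀ d₁ : ℝ) : Prop where
  pos : 0 < a
  det : 0 ≤ a * c - b ^ 2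
  a_le : |a - 1| ≤ E * invRadius u
  b_le : |b| ≤ E * invRadius u
  c_le : |c - 1| ≤ E * invRadius u
  d₀_le : |d₀ - 3 * a / u 0| ≤ E * invRadius u ^ 2
  d₁_le : |d₁| ≤ E * invRadius u ^ 2

/-- The operator `a ∂ₓ² + 2 b ∂ₓ∂ᵧ + c ∂ᵧ² + d₀ ∂ₓ + d₁ ∂ᵧ`. -/
noncomputable def secondOrderOp (a b c d₀ d₁ : ℝ) (v : (Fin 2 → ℝ) → ℝ) (u : Fin 2 → ℝ) : ℝ :=
  a * pd 0 (pd 0 v) u + 2 * b * pd 0 (pd 1 v) u + c * pd 1 (pd 1 v) u + d₀ * pd 0 v u +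
    d₁ * pd 1 v u

/-- The flat operator maps `r⁻³ - κ r⁻⁴` to `-4 κ r⁻⁶`, and the perturbation maps `r⁻³` to a
function bounded by `51 E r⁻⁶`; this determines the choice `κ = 51 E`. For large `r` the
perturbation of `κ r⁻⁴` is of lower order. -/
theorem NearFlat.barrier_neg {E a b c d₀ d₁ : ℝ} (h : NearFlat E u a b c d₀ d₁)
    (hu : u ∈ halfPlane) (hE : 0 < E) (hr : 102 * E * invRadius u ≤ 1) :
    secondOrderOp a b c d₀ d₁ (barrier (51 * E)) u < 0 := by
  unfold secondOrderOp
  have hx : 0 < u 0 := hu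
  have hρ : 0 < invRadius u := inv_pos.2 (radius_pos hu)
  have hx1 : |u 0| * invRadius u ≤ 1 := by
    rw [invRadius, ← div_eq_mul_inv, div_le_one (radius_pos hu)]; exact abs_apply_le_radius u 0
  have hy1 : |u 1| * invRadius u ≤ 1 := by
    rw [invRadius, ← div_eq_mul_inv, div_le_one (radius_pos hu)]; exact abs_apply_le_radius u 1
  have hrr : (u 0 ^ 2 + u 1 ^ 2) * invRadius u ^ 2 = 1 := by
    rw [← radius_sq, invRadius, inv_pow, mul_inv_cancel₀ (pow_pos (radius_pos hu) 2).ne']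
  rw [pd_pd_barrier _ hu, pd_pd_barrier _ hu, pd_pd_barrier _ hu, pd_barrier _ hu,
    pd_barrier _ hu]
  obtain ⟨-, -, ha, hb, hc, he, hd⟩ := h
  set ρ := invRadius u with hρdef
  set x := u 0
  set y := u 1
  obtain ⟨e, rfl⟩ : ∃ e, d₀ = 3 * a / x + e := ⟨d₀ - 3 * a / x, by ring⟩
  rw [add_sub_cancel_left] at he
  obtain ⟨α, rfl⟩ : ∃ α, a = 1 + α := ⟨a - 1, by ring⟩
  obtain ⟨γ, rfl⟩ : ∃ γ, c = 1 + γ := ⟨c - 1, by ring⟩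
  rw [add_sub_cancel_left] at ha hc
  -- the errors of the coefficients of the first and of the second derivatives of the barrier
  have h1 : |4 * α + γ + e * x + d₁ * y| ≤ 7 * E * ρ := by
    have hex : |e * x| ≤ E * ρ := by
      rw [abs_mul]
      calc |e| * |x| ≤ E * ρ ^ 2 * |x| := by gcongr
        _ = E * ρ * (|x| * ρ) := by ring
        _ ≤ E * ρ * 1 := by gcongr
        _ = E * ρ := by ring
    have hdy : |d₁ * y| ≤ E * ρ := by
      rw [abs_mul]
      calc |d₁| * |y| ≤ E * ρ ^ 2 * |y| := by gcongr
        _ = E * ρ * (|y| * ρ) := by ring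
        _ ≤ E * ρ * 1 := by gcongr
        _ = E * ρ := by ring
    rw [abs_le] at *
    constructor <;> linarith [ha.1, ha.2, hc.1, hc.2, hex.1, hex.2, hdy.1, hdy.2]
  have h2 : |α * (x * ρ) ^ 2 + 2 * b * (x * ρ) * (y * ρ) + γ * (y * ρ) ^ 2| ≤ 2 * E * ρ := by
    have hX : (x * ρ) ^ 2 + (y * ρ) ^ 2 = 1 := by linarith
    have hxy : |2 * (x * ρ) * (y * ρ)| ≤ 1 := by
      rw [abs_le]
      constructor <;> nlinarith [sq_nonneg (x * ρ + y * ρ), sq_nonneg (x * ρ - y * ρ)]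
    have hbb : |b * (2 * (x * ρ) * (y * ρ))| ≤ E * ρ := by
      rw [abs_mul]
      calc |b| * |2 * (x * ρ) * (y * ρ)| ≤ (E * ρ) * 1 := by gcongr
        _ = E * ρ := by ring
    have haa : |α * (x * ρ) ^ 2 + γ * (y * ρ) ^ 2| ≤ E * ρ := by
      calc |α * (x * ρ) ^ 2 + γ * (y * ρ) ^ 2|
          ≤ |α * (x * ρ) ^ 2| + |γ * (y * ρ) ^ 2| := abs_add_le _ _
        _ = |α| * (x * ρ) ^ 2 + |γ| * (y * ρ) ^ 2 := by
            rw [abs_mul, abs_mul, abs_of_nonneg (sq_nonneg (x * ρ)),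
              abs_of_nonneg (sq_nonneg (y * ρ))]
        _ ≤ (E * ρ) * (x * ρ) ^ 2 + (E * ρ) * (y * ρ) ^ 2 := by gcongr
        _ = E * ρ := by rw [← mul_add, hX, mul_one]
    have : α * (x * ρ) ^ 2 + 2 * b * (x * ρ) * (y * ρ) + γ * (y * ρ) ^ 2 =
      (α * (x * ρ) ^ 2 + γ * (y * ρ) ^ 2) + b * (2 * (x * ρ) * (y * ρ)) := by ring
    rw [this]
    refine (abs_add_le _ _).trans ?_
    linarith
  set s := 4 * α + γ + e * x + d₁ * y with hs
  set t := α * (x * ρ) ^ 2 + 2 * b * (x * ρ) * (y * ρ) + γ * (y * ρ) ^ 2 with ht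
  have key : (1 + α) * (x * x * (15 * ρ ^ 7 - 24 * (51 * E) * ρ ^ 8) -
        (if (0 : Fin 2) = 0 then 1 else 0) * (3 * ρ ^ 5 - 4 * (51 * E) * ρ ^ 6)) +
      2 * b * (x * y * (15 * ρ ^ 7 - 24 * (51 * E) * ρ ^ 8) -
        (if (1 : Fin 2) = 0 then 1 else 0) * (3 * ρ ^ 5 - 4 * (51 * E) * ρ ^ 6)) +
      (1 + γ) * (y * y * (15 * ρ ^ 7 - 24 * (51 * E) * ρ ^ 8) -
        (if (1 : Fin 2) = 1 then 1 else 0) * (3 * ρ ^ 5 - 4 * (51 * E) * ρ ^ 6)) +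
      (3 * (1 + α) / x + e) * -(x * (3 * ρ ^ 5 - 4 * (51 * E) * ρ ^ 6)) +
      d₁ * -(y * (3 * ρ ^ 5 - 4 * (51 * E) * ρ ^ 6)) =
      -(204 * E * ρ ^ 6) - s * (3 - 204 * E * ρ) * ρ ^ 5 + t * (15 - 1224 * E * ρ) * ρ ^ 5 := by
    have hdiv : 3 * (1 + α) / x * x = 3 * (1 + α) := by field_simp
    simp only [hs, ht, if_true, one_ne_zero, if_false]
    linear_combination (15 * ρ ^ 5 - 24 * (51 * E) * ρ ^ 6) * hrr -
      (3 * ρ ^ 5 - 4 * (51 * E) * ρ ^ 6) * hdiv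
  rw [key]
  have hEρ := mul_pos hE hρ
  have hm : |3 - 204 * E * ρ| ≤ 3 := by
    rw [abs_le]; constructor <;> linarith
  have hn : |15 - 1224 * E * ρ| ≤ 15 := by
    rw [abs_le]; constructor <;> linarith
  have hsm : |s * (3 - 204 * E * ρ)| ≤ 7 * E * ρ * 3 := by
    rw [abs_mul]; gcongr
  have htn : |t * (15 - 1224 * E * ρ)| ≤ 2 * E * ρ * 15 := by
    rw [abs_mul]; gcongr
  have hfin : -(204 * E * ρ) - s * (3 - 204 * E * ρ) + t * (15 - 1224 * E * ρ) < 0 := by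
    have := (abs_le.1 hsm).1
    have := (abs_le.1 htn).2
    linarith
  have := mul_neg_of_neg_of_pos hfin (pow_pos hρ 5)
  linarith

/-- The function `x⁻¹`, which is infinite on the axis, is a strict supersolution: the flat operator
maps it to `-x⁻³`. -/
theorem NearFlat.axis_neg {E a b c d₀ d₁ : ℝ} (h : NearFlat E u a b c d₀ d₁)
    (hu : u ∈ halfPlane) (hE : 0 < E) (hr : 102 * E * invRadius u ≤ 1) :
    secondOrderOp a b c d₀ d₁ (fun z => (z 0)⁻¹) u < 0 := by
  unfold secondOrderOp
  have hx : 0 < u 0 := hu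
  have hρ : 0 < invRadius u := inv_pos.2 (radius_pos hu)
  have hx1 : u 0 * invRadius u ≤ 1 := by
    rw [invRadius, ← div_eq_mul_inv, div_le_one (radius_pos hu)]
    exact (le_abs_self _).trans (abs_apply_le_radius u 0)
  rw [pd_pd_inv_coord hu, pd_pd_inv_coord hu, pd_pd_inv_coord hu, pd_inv_coord hu, pd_inv_coord hu]
  have ha := (abs_le.1 h.a_le).1
  have he := (abs_le.1 h.d₀_le).1
  obtain ⟨e, rfl⟩ : ∃ e, d₀ = 3 * a / u 0 + e := ⟨d₀ - 3 * a / u 0, by ring⟩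
  rw [add_sub_cancel_left] at he
  have hex : -(E * invRadius u) ≤ e * u 0 := by
    have h1 : E * invRadius u ^ 2 * u 0 ≤ E * invRadius u := by
      calc E * invRadius u ^ 2 * u 0 = E * invRadius u * (u 0 * invRadius u) := by ring
        _ ≤ E * invRadius u * 1 := by gcongr
        _ = _ := mul_one _
    nlinarith
  have : a * (2 * 1 * 1 / u 0 ^ 3) + (3 * a / u 0 + e) * (-1 / u 0 ^ 2) =
      -(a + e * u 0) / u 0 ^ 3 := by
    field_simp; ring
  simp
  norm_num at this
  rw [this]
  refine div_neg_of_neg_of_pos ?_ (pow_pos hx 3)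
  nlinarith

/-- The part of the half plane outside the circle of radius `R`. -/
def exterior (R : ℝ) : Set (Fin 2 → ℝ) := {u | u ∈ halfPlane ∧ R < radius u}

theorem secondOrderOp_sub_sub {V : Set (Fin 2 → ℝ)} (hV : IsOpen V) {q : Fin 2 → ℝ} (hq : q ∈ V)
    {f B G : (Fin 2 → ℝ) → ℝ} (hf : ContDiffOn ℝ ∞ f V) (hB : ContDiffOn ℝ ∞ B V)
    (hG : ContDiffOn ℝ ∞ G V) (C ε a b c d₀ d₁ : ℝ) :
    secondOrderOp a b c d₀ d₁ (fun z => f z - C * B z - ε * G z) q =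
      secondOrderOp a b c d₀ d₁ f q - C * secondOrderOp a b c d₀ d₁ B q -
        ε * secondOrderOp a b c d₀ d₁ G q := by
  have h1 : ∀ {f B G : (Fin 2 → ℝ) → ℝ}, ContDiffOn ℝ ∞ f V → ContDiffOn ℝ ∞ B V →
      ContDiffOn ℝ ∞ G V → ∀ i, ∀ z ∈ V, pd i (fun z => f z - C * B z - ε * G z) z =
        pd i f z - C * pd i B z - ε * pd i G z := by
    intro f B G hf hB hG i z hz
    have df := differentiableAt_of_contDiffOn hf hV hz
    have dB := differentiableAt_of_contDiffOn hB hV hz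
    have dG := differentiableAt_of_contDiffOn hG hV hz
    rw [pd_sub i (df.fun_sub (dB.const_mul C)) (dG.const_mul ε), pd_sub i df (dB.const_mul C),
      pd_const_mul i C dB, pd_const_mul i ε dG]
  have h2 : ∀ i j, pd i (pd j fun z => f z - C * B z - ε * G z) q =
      pd i (pd j f) q - C * pd i (pd j B) q - ε * pd i (pd j G) q := by
    intro i j
    rw [pd_congr_of_eqOn i hV hq (h1 hf hB hG j)]
    exact h1 (contDiffOn_pd hf hV j) (contDiffOn_pd hB hV j) (contDiffOn_pd hG hV j) i q hq
  simp only [secondOrderOp, h1 hf hB hG _ q hq, h2]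
  ring

/-- A function `f ≤ 1` with `L f = 0` outside a circle whose upper limit at infinity is at most
zero is dominated by a multiple of the barrier. The factor `2 R³` makes this multiple at least `1`
on the circle, and a term `ε / x` keeps the maximum of the difference away from the axis, where the
equation degenerates. -/
theorem le_barrier_of_elliptic {E R : ℝ} (hE : 0 < E) (hR : 0 < R) (hER : 102 * E ≤ R)
    {a b c d₀ d₁ f : (Fin 2 → ℝ) → ℝ} {V : Set (Fin 2 → ℝ)} (hV : IsOpen V)
    (hVh : V ⊆ halfPlane) (hRV : ∀ u ∈ halfPlane, R ≤ radius u → u ∈ V)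
    (hf : ContDiffOn ℝ ∞ f V)
    (hL : ∀ u ∈ exterior R, NearFlat E u (a u) (b u) (c u) (d₀ u) (d₁ u))
    (hLf : ∀ u ∈ exterior R, secondOrderOp (a u) (b u) (c u) (d₀ u) (d₁ u) f u = 0)
    (hbdd : ∀ u ∈ halfPlane, R ≤ radius u → f u ≤ 1)
    (hlim : ∀ ε > 0, ∃ R', ∀ u ∈ halfPlane, R' < radius u → f u ≤ ε)
    {u : Fin 2 → ℝ} (hu : u ∈ exterior R) :
    f u ≤ 2 * R ^ 3 * barrier (51 * E) u := by
  have hρ : ∀ z ∈ halfPlane, R ≤ radius z → 0 < invRadius z ∧ 102 * E * invRadius z ≤ 1 := by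
    intro z hz hRz
    have hr := radius_pos hz
    refine ⟨inv_pos.2 hr, ?_⟩
    rw [invRadius, ← div_eq_mul_inv, div_le_one hr]
    linarith
  have hBpos : ∀ z ∈ halfPlane, R ≤ radius z → 1 / 2 * invRadius z ^ 3 ≤ barrier (51 * E) z := by
    intro z hz hRz
    obtain ⟨h0, h1⟩ := hρ z hz hRz
    have : barrier (51 * E) z = invRadius z ^ 3 * (1 - 51 * E * invRadius z) := by
      rw [barrier]; ring
    rw [this, mul_comm]
    exact mul_le_mul_of_nonneg_left (by linarith) (pow_pos h0 3).le
  refine le_of_forall_pos_le_add fun ε₁ hε₁ => ?_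
  have hu0 : 0 < u 0 := hu.1
  obtain ⟨ε, hε, hεu⟩ : ∃ ε : ℝ, 0 < ε ∧ ε * (u 0)⁻¹ = ε₁ := ⟨ε₁ * u 0, by positivity, by
    field_simp⟩
  let v : (Fin 2 → ℝ) → ℝ := fun z => f z - 2 * R ^ 3 * barrier (51 * E) z - ε * (z 0)⁻¹
  suffices h : v u ≤ 0 by simp only [v, hεu] at h; linarith
  by_contra! hvu
  have hBV := (contDiffOn_barrier (51 * E)).mono hVh
  have hGV := contDiffOn_inv_coord.mono hVh
  have hvs : ContDiffOn ℝ ∞ v V :=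
    (hf.sub (contDiffOn_const.mul hBV)).sub (contDiffOn_const.mul hGV)
  obtain ⟨R', hR'⟩ := hlim (v u / 2) (by linarith)
  set R₁ := max R' (radius u) + 1
  have hBnn : ∀ z ∈ halfPlane, R ≤ radius z → 0 ≤ 2 * R ^ 3 * barrier (51 * E) z := by
    intro z hz hRz
    have := hBpos z hz hRz
    have h0 := pow_pos (hρ z hz hRz).1 3
    exact mul_nonneg (by positivity) (by linarith)
  -- near the axis the term `ε / x` dominates
  have haxis : ∀ z ∈ halfPlane, R ≤ radius z → z 0 ≤ ε → v z ≤ 0 := by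
    intro z hz hRz hzε
    have hz0 : 0 < z 0 := hz
    have h1 : 1 ≤ ε * (z 0)⁻¹ := by rw [← div_eq_mul_inv, one_le_div hz0]; exact hzε
    have h2 := hBnn z hz hRz
    have h3 := hbdd z hz hRz
    simp only [v]; linarith
  -- a compact region on whose boundary `v` is smaller than `v u`
  let K : Set (Fin 2 → ℝ) := {z | ε ≤ z 0 ∧ R ≤ radius z ∧ radius z ≤ R₁}
  have hKh : ∀ z ∈ K, z ∈ halfPlane := fun z hz => lt_of_lt_of_le hε hz.1
  have hK : IsCompact K := by
    refine Metric.isCompact_of_isClosed_isBounded ?_ ?_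
    · exact (isClosed_le continuous_const (continuous_apply 0)).inter
        ((isClosed_le continuous_const continuous_radius).inter
          (isClosed_le continuous_radius continuous_const))
    · refine (Metric.isBounded_closedBall (x := (0 : Fin 2 → ℝ)) (r := R₁)).subset fun z hz => ?_
      rw [mem_closedBall_zero_iff, pi_norm_le_iff_of_nonneg ((hR.le.trans hz.2.1).trans hz.2.2)]
      exact fun i => (abs_apply_le_radius z i).trans hz.2.2
  have huK : u ∈ K := by
    refine ⟨?_, hu.2.le, ?_⟩
    · by_contra! h
      exact absurd (haxis u hu.1 hu.2.le h.le) (not_le.2 hvu)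
    · have := le_max_right R' (radius u)
      linarith
  obtain ⟨q, hqK, hqmax⟩ := hK.exists_isMaxOn ⟨u, huK⟩
    (hvs.continuousOn.mono fun z hz => hRV z (hKh z hz) hz.2.1)
  have hqu : v u ≤ v q := hqmax huK
  have hqh := hKh q hqK
  have hqV := hRV q hqh hqK.2.1
  have hG0 : 0 < ε * (q 0)⁻¹ := mul_pos hε (inv_pos.2 hqh)
  -- the maximum is not attained on the boundary of `K`
  have h1 : ε < q 0 := by
    by_contra! h
    have := haxis q hqh hqK.2.1 h
    linarith
  have h2 : R < radius q := by
    refine lt_of_le_of_ne hqK.2.1 fun h => ?_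
    have hB := hBpos q hqh hqK.2.1
    have hb := hbdd q hqh hqK.2.1
    have hR3 : R ^ 3 * invRadius q ^ 3 = 1 := by
      rw [invRadius, ← h, ← mul_pow, mul_inv_cancel₀ hR.ne', one_pow]
    have h3 : 1 ≤ 2 * R ^ 3 * barrier (51 * E) q := by
      calc 1 = 2 * R ^ 3 * (1 / 2 * invRadius q ^ 3) := by linarith
        _ ≤ _ := mul_le_mul_of_nonneg_left hB (by positivity)
    have : v q < 0 := by simp only [v]; linarith
    linarith
  have h3 : radius q < R₁ := by
    refine lt_of_le_of_ne hqK.2.2 fun h => ?_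
    have hlt : R' < radius q := by
      have := le_max_left R' (radius u)
      rw [h]; linarith
    have hb := hR' q hqh hlt
    have := hBnn q hqh hqK.2.1
    have : v q ≤ v u / 2 := by simp only [v] at *; linarith
    linarith
  have hloc : IsLocalMax v q := by
    have hn : {z : Fin 2 → ℝ | ε < z 0} ∩ ({z | R < radius z} ∩ {z | radius z < R₁}) ∈ 𝓝 q :=
      ((isOpen_lt continuous_const (continuous_apply 0)).inter
        ((isOpen_lt continuous_const continuous_radius).inter
          (isOpen_lt continuous_radius continuous_const))).mem_nhds ⟨h1, h2, h3⟩
    filter_upwards [hn] with z hz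
    exact hqmax ⟨hz.1.le, hz.2.1.le, hz.2.2.le⟩
  have hgrad : ∀ i, pd i v q = 0 := fun i => by rw [pd, hloc.fderiv_eq_zero]; rfl
  have hqext : q ∈ exterior R := ⟨hqh, h2⟩
  have hN := hL q hqext
  have hHess : a q * pd 0 (pd 0 v) q + 2 * b q * pd 0 (pd 1 v) q + c q * pd 1 (pd 1 v) q ≤ 0 := by
    refine trace_nonpos hN.pos hN.det fun x y => ?_
    have h := secondDeriv_nonpos_of_isLocalMax hvs hV hqV hloc ![x, y]
    rw [Fin.sum_univ_two, Fin.sum_univ_two, Fin.sum_univ_two, pd_comm hvs hV hqV 1 0] at h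
    simp only [Matrix.cons_val_zero, Matrix.cons_val_one] at h
    linarith
  have hop : secondOrderOp (a q) (b q) (c q) (d₀ q) (d₁ q) v q ≤ 0 := by
    simpa only [secondOrderOp, hgrad, mul_zero, add_zero] using hHess
  rw [secondOrderOp_sub_sub hV hqV hf hBV hGV, hLf q hqext] at hop
  have hB := hN.barrier_neg hqh hE (hρ q hqh hqK.2.1).2
  have hG := hN.axis_neg hqh hE (hρ q hqh hqK.2.1).2
  have hB' := mul_neg_of_pos_of_neg (show 0 < 2 * R ^ 3 by positivity) hB
  have hG' := mul_neg_of_pos_of_neg hε hG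
  linarith

/-- A solution of a nearly flat elliptic equation outside a circle which tends to zero at infinity
decays like the fundamental solution `r⁻³` of the Laplacian of `ℝ⁵`. -/
theorem cubic_decay_of_elliptic {E R : ℝ}
    {a b c d₀ d₁ f : (Fin 2 → ℝ) → ℝ} {U : Set (Fin 2 → ℝ)} (hU : IsOpen U)
    (hUh : U ⊆ halfPlane) (hRU : exterior R ⊆ U) (hf : ContDiffOn ℝ ∞ f U)
    (hL : ∀ u ∈ exterior R, NearFlat E u (a u) (b u) (c u) (d₀ u) (d₁ u))
    (hLf : ∀ u ∈ exterior R, secondOrderOp (a u) (b u) (c u) (d₀ u) (d₁ u) f u = 0)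
    (hlim : ∀ ε > 0, ∃ R', ∀ u ∈ halfPlane, R' < radius u → |f u| ≤ ε) :
    CubicDecay U f := by
  obtain ⟨R', hR'⟩ := hlim 1 one_pos
  set F := max E 1
  have hF : 0 < F := lt_of_lt_of_le one_pos (le_max_right _ _)
  obtain ⟨R₀, h0, h1, h2, h3⟩ : ∃ R₀, 0 < R₀ ∧ R < R₀ ∧ R' < R₀ ∧ 102 * F ≤ R₀ := by
    refine ⟨max (max R R') (102 * F) + 1, ?_, ?_, ?_, ?_⟩
    · have := le_max_right (max R R') (102 * F); linarith
    · have := (le_max_left R R').trans (le_max_left _ (102 * F)); linarith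
    · have := (le_max_right R R').trans (le_max_left _ (102 * F)); linarith
    · have := le_max_right (max R R') (102 * F); linarith
  have hsub : exterior R₀ ⊆ exterior R := fun u hu => ⟨hu.1, h1.trans hu.2⟩
  have hNear : ∀ u ∈ exterior R₀, NearFlat F u (a u) (b u) (c u) (d₀ u) (d₁ u) := by
    intro u hu
    have h := hL u (hsub hu)
    have hEF : E ≤ F := le_max_left _ _
    have hρ : 0 ≤ invRadius u := (inv_pos.2 (radius_pos hu.1)).le
    have e1 : E * invRadius u ≤ F * invRadius u := by gcongr
    have e2 : E * invRadius u ^ 2 ≤ F * invRadius u ^ 2 := by gcongr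
    exact ⟨h.pos, h.det, h.a_le.trans e1, h.b_le.trans e1, h.c_le.trans e1, h.d₀_le.trans e2,
      h.d₁_le.trans e2⟩
  have hRV : ∀ u ∈ halfPlane, R₀ ≤ radius u → u ∈ U :=
    fun u hu hr => hRU ⟨hu, h1.trans_le hr⟩
  refine ⟨2 * R₀ ^ 3, R₀, h0, fun u hu hur => ?_⟩
  have hue : u ∈ exterior R₀ := ⟨hUh hu, hur⟩
  have hup := le_barrier_of_elliptic hF h0 h3 hU hUh hRV hf hNear
    (fun u hu => hLf u (hsub hu))
    (fun z hz hzr => (le_abs_self _).trans (hR' z hz (h2.trans_le hzr)))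
    (fun ε hε => (hlim ε hε).imp fun _ h z hz hzr => (le_abs_self _).trans (h z hz hzr)) hue
  have hdown := le_barrier_of_elliptic hF h0 h3 hU hUh hRV hf.neg hNear
    (fun u hu => by
      have := hLf u (hsub hu)
      have e : ∀ i, pd i (fun z => -f z) = fun z => -pd i f z := fun i => funext fun z => pd_neg i
      simp only [secondOrderOp, e, pd_neg] at this ⊢
      linarith)
    (fun z hz hzr => (neg_le_abs _).trans (hR' z hz (h2.trans_le hzr)))
    (fun ε hε => (hlim ε hε).imp fun _ h z hz hzr => (neg_le_abs _).trans (h z hz hzr)) hue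
  have hB : barrier (51 * F) u ≤ 1 / radius u ^ 3 := by
    have hρ := inv_pos.2 (radius_pos hue.1)
    have : 0 ≤ 51 * F * invRadius u ^ 4 := by unfold invRadius; positivity
    rw [barrier, one_div, ← inv_pow]
    have e : (radius u)⁻¹ ^ 3 = invRadius u ^ 3 := rfl
    rw [e]; linarith
  have hBm := mul_le_mul_of_nonneg_left hB (show 0 ≤ 2 * R₀ ^ 3 by positivity)
  rw [mul_one_div] at hBm
  rw [abs_le]
  constructor <;> linarith

end Elliptic

/-! ### The limit at infinity -/

section Limit

variable {f : (Fin 2 → ℝ) → ℝ} {R M : ℝ}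

theorem radius_polar {r θ : ℝ} (hr : 0 ≤ r) : radius ![r * Real.cos θ, r * Real.sin θ] = r := by
  rw [radius]
  simp only [Matrix.cons_val_zero, Matrix.cons_val_one]
  rw [show (r * Real.cos θ) ^ 2 + (r * Real.sin θ) ^ 2 = r ^ 2 by
    nlinarith [Real.sin_sq_add_cos_sq θ], Real.sqrt_sq hr]

theorem exists_polar {u : Fin 2 → ℝ} (hu : u ∈ halfPlane) :
    ∃ θ ∈ Set.Ioo (-(Real.pi / 2)) (Real.pi / 2),
      u = ![radius u * Real.cos θ, radius u * Real.sin θ] := by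
  have hx : 0 < u 0 := hu
  have hr := radius_pos hu
  have hsq := radius_sq u
  have hlt : |u 1 / radius u| < 1 := by
    rw [abs_div, abs_of_pos hr, div_lt_one hr]
    refine abs_lt_of_sq_lt_sq ?_ hr.le
    nlinarith
  have h1 := abs_lt.1 hlt
  refine ⟨Real.arcsin (u 1 / radius u), ⟨Real.neg_pi_div_two_lt_arcsin.2 h1.1,
    Real.arcsin_lt_pi_div_two.2 h1.2⟩, ?_⟩
  have hc : √(1 - (u 1 / radius u) ^ 2) = u 0 / radius u := by
    rw [show 1 - (u 1 / radius u) ^ 2 = (u 0 / radius u) ^ 2 by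
      field_simp; linarith, Real.sqrt_sq (by positivity)]
  ext i
  fin_cases i
  · simp only [Real.cos_arcsin, hc]
    simp
    field_simp
  · simp only [Real.sin_arcsin h1.1.le h1.2.le]
    simp
    field_simp

/-- A function whose derivatives are `O(r⁻³)` changes by `O(r⁻²)` along an arc. -/
theorem abs_sub_le_of_arc
    (hf : ∀ u ∈ exterior R, DifferentiableAt ℝ f u)
    (hM : ∀ u ∈ exterior R, ∀ a, |pd a f u| ≤ M * invRadius u ^ 3)
    {u : Fin 2 → ℝ} (hu : u ∈ exterior R) :
    |f u - f ![radius u, 0]| ≤ 4 * M * invRadius u ^ 2 := by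
  obtain ⟨θ, hθ, hpol⟩ := exists_polar hu.1
  set r := radius u with hr
  have hr0 : 0 < r := radius_pos hu.1
  have hmem : ∀ t ∈ Set.Ioo (-(Real.pi / 2)) (Real.pi / 2),
      ![r * Real.cos t, r * Real.sin t] ∈ exterior R := by
    intro t ht
    refine ⟨?_, ?_⟩
    · exact mul_pos hr0 (Real.cos_pos_of_mem_Ioo ht)
    · rw [radius_polar hr0.le]; exact hu.2
  have hder : ∀ t ∈ Set.Ioo (-(Real.pi / 2)) (Real.pi / 2),
      HasDerivWithinAt (fun t => f ![r * Real.cos t, r * Real.sin t])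
        (fderiv ℝ f ![r * Real.cos t, r * Real.sin t] ![r * -Real.sin t, r * Real.cos t])
        (Set.Ioo (-(Real.pi / 2)) (Real.pi / 2)) t := by
    intro t ht
    have hc : HasDerivAt (fun t => ![r * Real.cos t, r * Real.sin t])
        ![r * -Real.sin t, r * Real.cos t] t := by
      rw [hasDerivAt_pi]
      intro i
      fin_cases i
      · exact (Real.hasDerivAt_cos t).const_mul r
      · exact (Real.hasDerivAt_sin t).const_mul r
    exact ((hf _ (hmem t ht)).hasFDerivAt.comp_hasDerivAt t hc).hasDerivWithinAt
  have hbound : ∀ t ∈ Set.Ioo (-(Real.pi / 2)) (Real.pi / 2),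
      ‖fderiv ℝ f ![r * Real.cos t, r * Real.sin t] ![r * -Real.sin t, r * Real.cos t]‖ ≤
        2 * M * r⁻¹ ^ 2 := by
    intro t ht
    have hρ : invRadius ![r * Real.cos t, r * Real.sin t] = r⁻¹ := by
      rw [invRadius, radius_polar hr0.le]
    have h0 := hM _ (hmem t ht) 0
    have h1 := hM _ (hmem t ht) 1
    rw [hρ] at h0 h1
    rw [fderiv_apply_eq_sum_pd, Fin.sum_univ_two, Real.norm_eq_abs]
    simp only [Matrix.cons_val_zero, Matrix.cons_val_one]
    refine (abs_add_le _ _).trans ?_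
    have hs : |r * -Real.sin t| ≤ r := by
      rw [abs_mul, abs_neg, abs_of_pos hr0]
      exact mul_le_of_le_one_right hr0.le (Real.abs_sin_le_one t)
    have hc : |r * Real.cos t| ≤ r := by
      rw [abs_mul, abs_of_pos hr0]
      exact mul_le_of_le_one_right hr0.le (Real.abs_cos_le_one t)
    calc _ ≤ r * (M * r⁻¹ ^ 3) + r * (M * r⁻¹ ^ 3) := by
          refine add_le_add ?_ ?_
          · rw [abs_mul]; exact mul_le_mul hs h0 (abs_nonneg _) hr0.le
          · rw [abs_mul]; exact mul_le_mul hc h1 (abs_nonneg _) hr0.le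
      _ = 2 * M * r⁻¹ ^ 2 := by field_simp; ring
  have h := (convex_Ioo (-(Real.pi / 2)) (Real.pi / 2)).norm_image_sub_le_of_norm_hasDerivWithin_le
    hder hbound (x := 0) (y := θ) ⟨by linarith [Real.pi_pos], by linarith [Real.pi_pos]⟩ hθ
  simp only [Real.cos_zero, Real.sin_zero, mul_one, mul_zero, sub_zero, Real.norm_eq_abs] at h
  rw [← hpol] at h
  have hθ2 : |θ| ≤ 2 := by
    have := Real.pi_le_four
    rw [abs_le]; constructor <;> linarith [hθ.1, hθ.2]
  have hM0 : 0 ≤ 2 * M * r⁻¹ ^ 2 := (norm_nonneg _).trans (hbound θ hθ)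
  calc |f u - f ![r, 0]| ≤ 2 * M * r⁻¹ ^ 2 * |θ| := h
    _ ≤ 2 * M * r⁻¹ ^ 2 * 2 := by gcongr
    _ = 4 * M * invRadius u ^ 2 := by rw [invRadius]; ring

/-- A function whose derivatives are `O(r⁻³)` has a limit at infinity. -/
theorem exists_limit_of_pd_bound (hR : 0 < R) (hM0 : 0 ≤ M)
    (hf : ∀ u ∈ exterior R, DifferentiableAt ℝ f u)
    (hM : ∀ u ∈ exterior R, ∀ a, |pd a f u| ≤ M * invRadius u ^ 3) :
    ∃ l : ℝ, ∀ ε > 0, ∃ R', ∀ u ∈ halfPlane, R' < radius u → |f u - l| ≤ ε := by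
  have hrad : ∀ t : ℝ, 0 < t → radius ![t, 0] = t := by
    intro t ht
    simp [radius, Real.sqrt_sq ht.le]
  have hmem : ∀ t ∈ Set.Ioi R, ![t, 0] ∈ exterior R := by
    intro t ht
    have ht0 : 0 < t := hR.trans ht
    exact ⟨ht0, by rw [hrad t ht0]; exact ht⟩
  have hder : ∀ t ∈ Set.Ioi R, HasDerivAt (fun t => f ![t, 0]) (pd 0 f ![t, 0]) t := by
    intro t ht
    have hc : HasDerivAt (fun t : ℝ => ![t, 0]) (Pi.single 0 1 : Fin 2 → ℝ) t := by
      rw [hasDerivAt_pi]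
      intro i
      fin_cases i
      · exact hasDerivAt_id t
      · exact hasDerivAt_const t (0 : ℝ)
    exact (hf _ (hmem t ht)).hasFDerivAt.comp_hasDerivAt t hc
  have hder2 : ∀ t ∈ Set.Ioi R, HasDerivAt (fun t : ℝ => M / 2 * t⁻¹ ^ 2) (-(M * t⁻¹ ^ 3)) t := by
    intro t ht
    have ht0 : t ≠ 0 := (hR.trans ht).ne'
    have h := ((hasDerivAt_inv ht0).fun_pow 2).const_mul (M / 2)
    exact h.congr_deriv (by rw [← inv_pow]; push_cast; ring)
  have hb : ∀ t ∈ Set.Ioi R, |pd 0 f ![t, 0]| ≤ M * t⁻¹ ^ 3 := by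
    intro t ht
    have h := hM _ (hmem t ht) 0
    rwa [invRadius, hrad t (hR.trans ht)] at h
  -- along the ray `f` lies between a monotone and an antitone function with vanishing difference
  have hmono : MonotoneOn (fun t => f ![t, 0] - M / 2 * t⁻¹ ^ 2) (Set.Ioi R) := by
    refine monotoneOn_of_deriv_nonneg (convex_Ioi R) (fun t ht => ?_) (fun t ht => ?_)
      fun t ht => ?_
    · exact ((hder t ht).sub (hder2 t ht)).continuousAt.continuousWithinAt
    · rw [interior_Ioi] at ht
      exact ((hder t ht).sub (hder2 t ht)).differentiableAt.differentiableWithinAt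
    · rw [interior_Ioi] at ht
      rw [((hder t ht).fun_sub (hder2 t ht)).deriv]
      have := (abs_le.1 (hb t ht)).1
      linarith
  have hanti : AntitoneOn (fun t => f ![t, 0] + M / 2 * t⁻¹ ^ 2) (Set.Ioi R) := by
    refine antitoneOn_of_deriv_nonpos (convex_Ioi R) (fun t ht => ?_) (fun t ht => ?_)
      fun t ht => ?_
    · exact ((hder t ht).add (hder2 t ht)).continuousAt.continuousWithinAt
    · rw [interior_Ioi] at ht
      exact ((hder t ht).add (hder2 t ht)).differentiableAt.differentiableWithinAt
    · rw [interior_Ioi] at ht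
      rw [((hder t ht).fun_add (hder2 t ht)).deriv]
      have := (abs_le.1 (hb t ht)).2
      linarith
  have hle : ∀ s ∈ Set.Ioi R, ∀ t ∈ Set.Ioi R,
      f ![s, 0] - M / 2 * s⁻¹ ^ 2 ≤ f ![t, 0] + M / 2 * t⁻¹ ^ 2 := by
    intro s hs t ht
    have hm : max s t ∈ Set.Ioi R := lt_max_of_lt_left (Set.mem_Ioi.1 hs)
    have h1 := hmono hs hm (le_max_left s t)
    have h2 := hanti ht hm (le_max_right s t)
    have h3 : 0 ≤ M / 2 * (max s t)⁻¹ ^ 2 := by positivity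
    simp only at h1 h2
    linarith
  set S := (fun t => f ![t, 0] - M / 2 * t⁻¹ ^ 2) '' Set.Ioi R
  have hne : S.Nonempty := ⟨_, R + 1, by simp, rfl⟩
  have hbd : ∀ t ∈ Set.Ioi R, ∀ y ∈ S, y ≤ f ![t, 0] + M / 2 * t⁻¹ ^ 2 := by
    rintro t ht _ ⟨s, hs, rfl⟩
    exact hle s hs t ht
  have hR1 : R + 1 ∈ Set.Ioi R := by simp
  have hclose : ∀ u ∈ exterior R, |f u - sSup S| ≤ 5 * M * invRadius u ^ 2 := by
    intro u hu
    have h1 := abs_sub_le_of_arc hf hM hu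
    have h2 : f ![radius u, 0] - M / 2 * (radius u)⁻¹ ^ 2 ≤ sSup S :=
      le_csSup ⟨_, hbd _ hR1⟩ ⟨radius u, hu.2, rfl⟩
    have h3 : sSup S ≤ f ![radius u, 0] + M / 2 * (radius u)⁻¹ ^ 2 :=
      csSup_le hne (hbd _ hu.2)
    have e : (radius u)⁻¹ = invRadius u := rfl
    rw [e] at h2 h3
    have h4 : 0 ≤ M * invRadius u ^ 2 := by positivity
    rw [abs_le] at *
    constructor <;> linarith [h1.1, h1.2]
  refine ⟨sSup S, fun ε hε => ⟨max (max R 1) (5 * M / ε), fun u hu hur => ?_⟩⟩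
  have hR' : R < radius u := (le_max_left R 1).trans_lt ((le_max_left _ _).trans_lt hur)
  have h1 : 1 < radius u := (le_max_right R 1).trans_lt ((le_max_left _ _).trans_lt hur)
  have h2 : 5 * M / ε < radius u := (le_max_right _ _).trans_lt hur
  refine (hclose u ⟨hu, hR'⟩).trans ?_
  have hr := radius_pos hu
  rw [div_lt_iff₀ hε] at h2
  rw [invRadius, inv_pow, ← div_eq_mul_inv, div_le_iff₀ (by positivity)]
  nlinarith

end Limit

/-! ### Asymptotically Euclidean data near the axis -/

section Asymptotics

variable {g : TensorField 4} {U : Set (Fin 2 → ℝ)} {δ : ℝ} {u : Fin 2 → ℝ} {q : Fin 3 → ℝ}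

/-- The ratio of the norm `X` to its Euclidean value `x²`. -/
noncomputable def axialRatio (g : TensorField 4) (u : Fin 2 → ℝ) : ℝ := normSq g u * ((u 0)⁻¹) ^ 2

theorem IsQuasiStationary.contDiffOn_axialRatio (hg : IsQuasiStationary g U δ) :
    ContDiffOn ℝ ∞ (axialRatio g) U :=
  hg.contDiffOn_normSq.mul ((contDiffOn_inv_coord.mono hg.subset).pow 2)

theorem pd_mul_angle {f : (Fin 2 → ℝ) → ℝ} {c : ℝ → ℝ} {c' : ℝ}
    (hf : DifferentiableAt ℝ f (orbitProj q)) (hc : HasDerivAt c c' (q 2)) :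
    pd 0 (fun z => f (orbitProj z) * c (z 2)) q = pd 0 f (orbitProj q) * c (q 2) ∧
    pd 1 (fun z => f (orbitProj z) * c (z 2)) q = pd 1 f (orbitProj q) * c (q 2) ∧
    pd 2 (fun z => f (orbitProj z) * c (z 2)) q = f (orbitProj q) * c' := by
  obtain ⟨h0, h1, h2⟩ := pd_comp_orbitProj hf
  have dz : DifferentiableAt ℝ (fun z : Fin 3 → ℝ => z 2) q := differentiableAt_apply 2 q
  have df : DifferentiableAt ℝ (fun z => f (orbitProj z)) q :=
    hf.comp q (hasFDerivAt_orbitProj q).differentiableAt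
  have dc : DifferentiableAt ℝ (fun z : Fin 3 → ℝ => c (z 2)) q :=
    hc.differentiableAt.comp q dz
  have hcpd : ∀ i, pd i (fun z : Fin 3 → ℝ => c (z 2)) q = c' * if (2 : Fin 3) = i then 1 else 0 :=
    fun i => by rw [pd_comp_real i hc dz, pd_coord]
  refine ⟨?_, ?_, ?_⟩
  · rw [pd_mul 0 df dc, h0, hcpd]; simp
  · rw [pd_mul 1 df dc, h1, hcpd]; simp
  · rw [pd_mul 2 df dc, h2, hcpd]; simp

theorem cartPd_planePoint (f : (Fin 3 → ℝ) → ℝ) (u : Fin 2 → ℝ) :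
    cartPd 0 f (planePoint u) = pd 0 f (planePoint u) ∧
    cartPd 1 f (planePoint u) = (u 0)⁻¹ * pd 2 f (planePoint u) ∧
    cartPd 2 f (planePoint u) = pd 1 f (planePoint u) := by
  simp [cartPd, cartJacobian, planePoint, Fin.sum_univ_three]

theorem IsQuasiStationary.cartComp_metric (hg : IsQuasiStationary g U δ) (hq : orbitProj q ∈ U) :
    cartComp (metric g) q 0 0 = planeMetric g (orbitProj q) 0 0 * Real.cos (q 2) ^ 2 +
      axialRatio g (orbitProj q) * Real.sin (q 2) ^ 2 ∧
    cartComp (metric g) q 1 1 = planeMetric g (orbitProj q) 0 0 * Real.sin (q 2) ^ 2 +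
      axialRatio g (orbitProj q) * Real.cos (q 2) ^ 2 ∧
    cartComp (metric g) q 2 2 = planeMetric g (orbitProj q) 1 1 ∧
    cartComp (metric g) q 0 2 = planeMetric g (orbitProj q) 0 1 * Real.cos (q 2) ∧
    cartComp (metric g) q 1 2 = planeMetric g (orbitProj q) 0 1 * Real.sin (q 2) := by
  have h0 : orbitProj q 0 = q 0 := rfl
  simp only [cartComp, hg.metric_apply hq, cartJacobian, Fin.sum_univ_three, axialRatio, h0]
  refine ⟨?_, ?_, ?_, ?_, ?_⟩ <;> simp <;> ring

theorem IsQuasiStationary.cartComp_secondForm (hg : IsQuasiStationary g U δ)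
    (hq : orbitProj q ∈ U) :
    cartComp (secondForm g) q 0 0 = flow g (orbitProj q) 0 * (√(normSq g (orbitProj q)))⁻¹ *
      (orbitProj q 0)⁻¹ * (-2 * (Real.sin (q 2) * Real.cos (q 2))) ∧
    cartComp (secondForm g) q 0 2 = flow g (orbitProj q) 1 * (√(normSq g (orbitProj q)))⁻¹ *
      (orbitProj q 0)⁻¹ * -Real.sin (q 2) := by
  have h0 : orbitProj q 0 = q 0 := rfl
  simp only [cartComp, hg.secondForm_apply hq, cartJacobian, Fin.sum_univ_three, h0]
  refine ⟨?_, ?_⟩ <;> simp <;> ring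

/-- The estimates for asymptotically Euclidean data at a point of the orbit plane. The last three
come from the derivative along the axial circles: there the Cartesian components are rotated, so
that their derivatives control components divided by the distance `x` from the axis. -/
theorem IsQuasiStationary.asymptotic_bounds (hg : IsQuasiStationary g U δ) {C R : ℝ}
    (hu : u ∈ U) (hR : R < radius u)
    (hA : ∀ q : Fin 3 → ℝ, 0 < q 0 → R < radius ![q 0, q 1] → ∀ i j k l : Fin 3,
      |cartComp (metric g) q i j - (1 : Matrix (Fin 3) (Fin 3) ℝ) i j| ≤
          C / radius ![q 0, q 1] ∧
      |cartPd k (fun z => cartComp (metric g) z i j) q| ≤ C / radius ![q 0, q 1] ^ 2 ∧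
      |cartPd l (cartPd k (fun z => cartComp (metric g) z i j)) q| ≤
          C / radius ![q 0, q 1] ^ 3 ∧
      |cartComp (secondForm g) q i j| ≤ C / radius ![q 0, q 1] ^ 2 ∧
      |cartPd k (fun z => cartComp (secondForm g) z i j) q| ≤ C / radius ![q 0, q 1] ^ 3 ∧
      |lapse g q - 1| ≤ C / radius ![q 0, q 1] ∧
      |cartPd k (lapse g) q| ≤ C / radius ![q 0, q 1] ^ 2) :
    (|planeMetric g u 0 0 - 1| ≤ C * invRadius u ∧ |planeMetric g u 0 1| ≤ C * invRadius u ∧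
      |planeMetric g u 1 1 - 1| ≤ C * invRadius u ∧ |axialRatio g u - 1| ≤ C * invRadius u ∧
      |planeLapse g u - 1| ≤ C * invRadius u) ∧
    (∀ a : Fin 2, |pd a (fun z => planeMetric g z 0 0) u| ≤ C * invRadius u ^ 2 ∧
      |pd a (fun z => planeMetric g z 0 1) u| ≤ C * invRadius u ^ 2 ∧
      |pd a (fun z => planeMetric g z 1 1) u| ≤ C * invRadius u ^ 2 ∧
      |pd a (axialRatio g) u| ≤ C * invRadius u ^ 2 ∧
      |pd a (planeLapse g) u| ≤ C * invRadius u ^ 2) ∧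
    |planeMetric g u 0 1 * (u 0)⁻¹| ≤ C * invRadius u ^ 2 ∧
    ∀ a : Fin 2, |flow g u a * (√(normSq g u))⁻¹ * (u 0)⁻¹ ^ 2| ≤ C * invRadius u ^ 3 := by
  have hx : 0 < u 0 := hg.subset hu
  have hq : orbitProj (planePoint u) ∈ U := by simpa using hu
  have hV := isOpen_preimage_orbitProj hg.isOpen
  have hqV : planePoint u ∈ orbitProj ⁻¹' U := hq
  have hrad : radius ![planePoint u 0, planePoint u 1] = radius u :=
    congrArg radius (orbitProj_planePoint u)
  have hAu := hA (planePoint u) hx (by rwa [hrad])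
  rw [hrad] at hAu
  have e1 : C / radius u = C * invRadius u := div_eq_mul_inv _ _
  have e2 : ∀ n : ℕ, C / radius u ^ n = C * invRadius u ^ n := fun n => by
    rw [invRadius, inv_pow, div_eq_mul_inv]
  rw [e1, e2, e2] at hAu
  obtain ⟨m00, m11, m22, m02, -⟩ := hg.cartComp_metric hq
  have hφ : planePoint u 2 = 0 := rfl
  have dP := fun a b => differentiableAt_of_contDiffOn (hg.contDiffOn_planeMetric a b) hg.isOpen hq
  have dH := differentiableAt_of_contDiffOn hg.contDiffOn_axialRatio hg.isOpen hq
  have dN := differentiableAt_of_contDiffOn hg.contDiffOn_planeLapse hg.isOpen hq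
  have dK : ∀ a, DifferentiableAt ℝ (fun z => flow g z a * (√(normSq g z))⁻¹ * (z 0)⁻¹)
      (orbitProj (planePoint u)) := fun a => by
    refine differentiableAt_of_contDiffOn (U := U) ?_ hg.isOpen hq
    exact ((hg.contDiffOn_flow a).mul (hg.contDiffOn_sqrt_normSq.inv
      fun z hz => (hg.sqrt_normSq_pos hz).ne')).mul (contDiffOn_inv_coord.mono hg.subset)
  have dz : DifferentiableAt ℝ (fun z : Fin 3 → ℝ => z 2) (planePoint u) :=
    differentiableAt_apply 2 _
  have dproj := (hasFDerivAt_orbitProj (planePoint u)).differentiableAt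
  have hcos : HasDerivAt Real.cos 0 (planePoint u 2) := by
    simpa [hφ] using Real.hasDerivAt_cos (planePoint u 2)
  have hsin : HasDerivAt Real.sin 1 (planePoint u 2) := by
    simpa [hφ] using Real.hasDerivAt_sin (planePoint u 2)
  have hcos2 : HasDerivAt (fun t => Real.cos t ^ 2) 0 (planePoint u 2) := by
    simpa using hcos.fun_pow 2
  have hsin2 : HasDerivAt (fun t => Real.sin t ^ 2) 0 (planePoint u 2) := by
    simpa [hφ] using hsin.fun_pow 2
  have hsc : HasDerivAt (fun t => -2 * (Real.sin t * Real.cos t)) (-2) (planePoint u 2) := by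
    simpa [hφ] using (hsin.fun_mul hcos).const_mul (-2)
  -- the derivatives of the Cartesian components at `φ = 0`
  have dang : ∀ {f : (Fin 2 → ℝ) → ℝ} {c : ℝ → ℝ} {c' : ℝ},
      DifferentiableAt ℝ f (orbitProj (planePoint u)) → HasDerivAt c c' (planePoint u 2) →
      DifferentiableAt ℝ (fun z => f (orbitProj z) * c (z 2)) (planePoint u) := fun hf hc =>
    (hf.comp (planePoint u) dproj).fun_mul (hc.differentiableAt.comp (planePoint u) dz)
  have c00 : ∀ l, pd l (fun z => cartComp (metric g) z 0 0) (planePoint u) = _ := fun l =>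
    (pd_congr_of_eqOn l hV hqV fun z hz => (hg.cartComp_metric hz).1).trans
      (pd_add l (dang (dP 0 0) hcos2) (dang dH hsin2))
  have c11 : ∀ l, pd l (fun z => cartComp (metric g) z 1 1) (planePoint u) = _ := fun l =>
    (pd_congr_of_eqOn l hV hqV fun z hz => (hg.cartComp_metric hz).2.1).trans
      (pd_add l (dang (dP 0 0) hsin2) (dang dH hcos2))
  have c22 : ∀ l, pd l (fun z => cartComp (metric g) z 2 2) (planePoint u) = _ := fun l =>
    pd_congr_of_eqOn l hV hqV fun z hz => (hg.cartComp_metric hz).2.2.1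
  have c02 : ∀ l, pd l (fun z => cartComp (metric g) z 0 2) (planePoint u) = _ := fun l =>
    pd_congr_of_eqOn l hV hqV fun z hz => (hg.cartComp_metric hz).2.2.2.1
  have c12 : ∀ l, pd l (fun z => cartComp (metric g) z 1 2) (planePoint u) = _ := fun l =>
    pd_congr_of_eqOn l hV hqV fun z hz => (hg.cartComp_metric hz).2.2.2.2
  have k00 : ∀ l, pd l (fun z => cartComp (secondForm g) z 0 0) (planePoint u) = _ := fun l =>
    pd_congr_of_eqOn l hV hqV fun z hz => (hg.cartComp_secondForm hz).1
  have k02 : ∀ l, pd l (fun z => cartComp (secondForm g) z 0 2) (planePoint u) = _ := fun l =>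
    pd_congr_of_eqOn l hV hqV fun z hz => (hg.cartComp_secondForm hz).2
  have cN : ∀ l, pd l (lapse g) (planePoint u) = _ := fun l =>
    pd_congr_of_eqOn l hV hqV fun z hz => hg.lapse_eq hz
  obtain ⟨n0, n1, -⟩ := pd_comp_orbitProj dN
  obtain ⟨s0, s1, -⟩ := pd_comp_orbitProj (dP 1 1)
  obtain ⟨p0, p1, -⟩ := pd_mul_angle (dP 0 0) hcos2
  obtain ⟨p0', p1', -⟩ := pd_mul_angle (dP 0 0) hsin2
  obtain ⟨H0, H1, -⟩ := pd_mul_angle dH hcos2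
  obtain ⟨H0', H1', -⟩ := pd_mul_angle dH hsin2
  obtain ⟨r0, r1, -⟩ := pd_mul_angle (dP 0 1) hcos
  obtain ⟨-, -, r2⟩ := pd_mul_angle (dP 0 1) hsin
  obtain ⟨-, -, f0⟩ := pd_mul_angle (dK 0) hsc
  obtain ⟨-, -, f1⟩ := pd_mul_angle (dK 1) (hsin.fun_neg)
  have hproj := orbitProj_planePoint u
  have hcart := fun f => cartPd_planePoint f u
  refine ⟨⟨?_, ?_, ?_, ?_, ?_⟩, fun a => ?_, ?_, fun a => ?_⟩
  · simpa [m00, hφ, hproj] using (hAu 0 0 0 0).1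
  · simpa [m02, hφ, hproj] using (hAu 0 2 0 0).1
  · simpa [m22, hφ, hproj] using (hAu 2 2 0 0).1
  · simpa [m11, hφ, hproj] using (hAu 1 1 0 0).1
  · simpa [hg.lapse_eq hq, hproj] using (hAu 0 0 0 0).2.2.2.2.2.1
  · fin_cases a
    · have h1 := (hAu 0 0 0 0).2.1
      have h2 := (hAu 0 2 0 0).2.1
      have h3 := (hAu 2 2 0 0).2.1
      have h4 := (hAu 1 1 0 0).2.1
      have h5 := (hAu 0 0 0 0).2.2.2.2.2.2
      rw [(hcart _).1] at h1 h2 h3 h4 h5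
      rw [c00, p0, H0', hφ, hproj] at h1
      rw [c02, r0, hφ, hproj] at h2
      rw [c22, s0, hproj] at h3
      rw [c11, p0', H0, hφ, hproj] at h4
      rw [cN, n0, hproj] at h5
      simp only [Real.cos_zero, Real.sin_zero] at h1 h2 h4
      norm_num at h1 h2 h4
      exact ⟨h1, h2, h3, h4, h5⟩
    · have h1 := (hAu 0 0 2 0).2.1
      have h2 := (hAu 0 2 2 0).2.1
      have h3 := (hAu 2 2 2 0).2.1
      have h4 := (hAu 1 1 2 0).2.1
      have h5 := (hAu 0 0 2 0).2.2.2.2.2.2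
      rw [(hcart _).2.2] at h1 h2 h3 h4 h5
      rw [c00, p1, H1', hφ, hproj] at h1
      rw [c02, r1, hφ, hproj] at h2
      rw [c22, s1, hproj] at h3
      rw [c11, p1', H1, hφ, hproj] at h4
      rw [cN, n1, hproj] at h5
      simp only [Real.cos_zero, Real.sin_zero] at h1 h2 h4
      norm_num at h1 h2 h4
      exact ⟨h1, h2, h3, h4, h5⟩
  · have h := (hAu 1 2 1 0).2.1
    rw [(hcart _).2.1, c12, r2, hproj] at h
    rwa [mul_one, mul_comm] at h
  · fin_cases a
    · have h := (hAu 0 0 1 0).2.2.2.2.1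
      rw [(hcart _).2.1, k00, f0, hproj] at h
      have e : (u 0)⁻¹ * (flow g u 0 * (√(normSq g u))⁻¹ * (u 0)⁻¹ * -2) =
        -2 * (flow g u 0 * (√(normSq g u))⁻¹ * (u 0)⁻¹ ^ 2) := by ring
      rw [e, abs_mul, show |(-2 : ℝ)| = 2 by norm_num] at h
      have h0 := abs_nonneg (flow g u 0 * (√(normSq g u))⁻¹ * (u 0)⁻¹ ^ 2)
      change |flow g u 0 * (√(normSq g u))⁻¹ * (u 0)⁻¹ ^ 2| ≤ _
      linarith
    · have h := (hAu 0 2 1 0).2.2.2.2.1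
      rw [(hcart _).2.1, k02, f1, hproj] at h
      have e : (u 0)⁻¹ * (flow g u 1 * (√(normSq g u))⁻¹ * (u 0)⁻¹ * -1) =
        -(flow g u 1 * (√(normSq g u))⁻¹ * (u 0)⁻¹ ^ 2) := by ring
      rwa [e, abs_neg] at h

end Asymptotics

/-! ### Decay of the angular velocity -/

section Decay

variable {g : TensorField 4} {U : Set (Fin 2 → ℝ)} {δ : ℝ} {u : Fin 2 → ℝ}
  {Ω : (Fin 2 → ℝ) → ℝ}

theorem abs_mul_le_mul {x y X Y : ℝ} (hx : |x| ≤ X) (hy : |y| ≤ Y) : |x * y| ≤ X * Y := by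
  rw [abs_mul]
  exact mul_le_mul hx hy (abs_nonneg _) ((abs_nonneg _).trans hx)

/-- The regular part of the logarithmic derivative of the density: the full derivative also
contains the term `3 / x` in the direction of `x`. -/
noncomputable def logDensityReg (g : TensorField 4) (i : Fin 2) (u : Fin 2 → ℝ) : ℝ :=
  -(pd i (planeLapse g) u / planeLapse g u) + 3 / 2 * (pd i (axialRatio g) u / axialRatio g u)

theorem normSq_eq_axialRatio (hx : u 0 ≠ 0) : normSq g u = axialRatio g u * u 0 ^ 2 := by
  rw [axialRatio]; field_simp

theorem IsQuasiStationary.axialRatio_pos (hg : IsQuasiStationary g U δ) (hu : u ∈ U) :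
    0 < axialRatio g u :=
  mul_pos (hg.normSq_pos hu) (pow_pos (inv_pos.2 (hg.subset hu)) 2)

/-- The logarithmic derivative of the density, from `w = ½ N⁻¹ X^(3/2)` and `X = H x²`. -/
theorem IsQuasiStationary.pd_density (hg : IsQuasiStationary g U δ) (hu : u ∈ U) (i : Fin 2) :
    pd i (density g) u = density g u *
      (logDensityReg g i u + 3 / u 0 * if (0 : Fin 2) = i then 1 else 0) := by
  have hx : 0 < u 0 := hg.subset hu
  have hX := hg.normSq_pos hu
  have hY := hg.sqrt_normSq_pos hu
  have hN := hg.planeLapse_pos hu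
  have hH := hg.axialRatio_pos hu
  have dN := differentiableAt_of_contDiffOn hg.contDiffOn_planeLapse hg.isOpen hu
  have dX := differentiableAt_of_contDiffOn hg.contDiffOn_normSq hg.isOpen hu
  have dY := differentiableAt_of_contDiffOn hg.contDiffOn_sqrt_normSq hg.isOpen hu
  have dH := differentiableAt_of_contDiffOn hg.contDiffOn_axialRatio hg.isOpen hu
  have dx := differentiableAt_coord u 0
  have dNi : DifferentiableAt ℝ (fun z => (planeLapse g z)⁻¹) u := dN.inv hN.ne'
  have hYpd : pd i (fun z => √(normSq g z)) u = 1 / (2 * √(normSq g u)) * pd i (normSq g) u :=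
    pd_comp_real i (Real.hasDerivAt_sqrt hX.ne') dX
  have hXpd : pd i (normSq g) u = pd i (axialRatio g) u * u 0 ^ 2 +
      axialRatio g u * (2 * u 0 * if (0 : Fin 2) = i then 1 else 0) := by
    rw [pd_congr_of_eqOn i hg.isOpen hu
      fun z hz => normSq_eq_axialRatio (g := g) (hg.subset hz : 0 < z 0).ne',
      pd_mul i dH (dx.fun_pow 2), pd_pow i 2 dx, pd_coord]
    norm_num
  have e : density g = fun z => 1 / 2 * (planeLapse g z)⁻¹ * √(normSq g z) ^ 3 := rfl
  have hsq : √(normSq g u) ^ 2 = axialRatio g u * u 0 ^ 2 := by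
    rw [Real.sq_sqrt hX.le, normSq_eq_axialRatio hx.ne']
  rw [e, pd_mul i (dNi.const_mul (1 / 2)) (dY.fun_pow 3), pd_const_mul i _ dNi,
    pd_inv i dN hN.ne', pd_pow i 3 dY, hYpd, hXpd, logDensityReg]
  beta_reduce
  generalize √(normSq g u) = Y at *
  generalize axialRatio g u = H at *
  generalize pd i (planeLapse g) u = N'
  generalize pd i (axialRatio g) u = H'
  generalize (if (0 : Fin 2) = i then (1 : ℝ) else 0) = ι
  push_cast
  field_simp
  linear_combination (-(3 : ℝ) * planeLapse g u * (H' * u 0 + 2 * H * ι)) * hsq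

/-- The contractions `Pᵃᵇ (∂ₐ Pᵦ꜀ - ½ ∂꜀ Pₐᵦ)`, multiplied by the determinant of `P`. -/
noncomputable def contractedChristoffel (g : TensorField 4) (u : Fin 2 → ℝ) : Fin 2 → ℝ :=
  ![planeMetric g u 1 1 * pd 0 (fun z => planeMetric g z 0 0) u / 2
      - planeMetric g u 0 1 * pd 1 (fun z => planeMetric g z 0 0) u
      + planeMetric g u 0 0 * (pd 1 (fun z => planeMetric g z 0 1) u
        - pd 0 (fun z => planeMetric g z 1 1) u / 2),
    planeMetric g u 0 0 * pd 1 (fun z => planeMetric g z 1 1) u / 2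
      - planeMetric g u 0 1 * pd 0 (fun z => planeMetric g z 1 1) u
      + planeMetric g u 1 1 * (pd 0 (fun z => planeMetric g z 0 1) u
        - pd 1 (fun z => planeMetric g z 0 0) u / 2)]

/-- The determinant of the metric of the orbit plane. -/
noncomputable def planeDet (g : TensorField 4) (u : Fin 2 → ℝ) : ℝ :=
  planeMetric g u 0 0 * planeMetric g u 1 1 - planeMetric g u 0 1 ^ 2

/-- The coefficient of `∂ₓ Ω` in the expanded momentum constraint. -/
noncomputable def driftX (g : TensorField 4) (u : Fin 2 → ℝ) : ℝ :=
  planeMetric g u 1 1 * (logDensityReg g 0 u + 3 / u 0) - planeMetric g u 0 1 * logDensityReg g 1 u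
    - (planeMetric g u 1 1 * contractedChristoffel g u 0
      - planeMetric g u 0 1 * contractedChristoffel g u 1) / planeDet g u

/-- The coefficient of `∂ᵧ Ω` in the expanded momentum constraint. -/
noncomputable def driftY (g : TensorField 4) (u : Fin 2 → ℝ) : ℝ :=
  planeMetric g u 0 0 * logDensityReg g 1 u - planeMetric g u 0 1 * (logDensityReg g 0 u + 3 / u 0)
    - (planeMetric g u 0 0 * contractedChristoffel g u 1
      - planeMetric g u 0 1 * contractedChristoffel g u 0) / planeDet g u

/-- The equation `∇ᵃ(w ∂ₐ Ω) = 0`, expanded and multiplied by `w⁻¹ det P`. -/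
theorem IsQuasiStationary.secondOrderOp_eq_zero (hg : IsQuasiStationary g U δ)
    (hΩ : IsAngularVelocity g U Ω) (hM : MomentumConstraint g U) (hu : u ∈ U) :
    secondOrderOp (planeMetric g u 1 1) (-planeMetric g u 0 1) (planeMetric g u 0 0) (driftX g u)
      (driftY g u) Ω u = 0 := by
  have h := (hg.momentumConstraint_iff_potential hΩ).1 hM u hu
  have hD : planeDet g u ≠ 0 := (hg.planeMetric_det_pos hu).ne'
  have dw := differentiableAt_of_contDiffOn hg.contDiffOn_density hg.isOpen hu
  have dΩ := fun a => differentiableAt_of_contDiffOn (contDiffOn_pd hΩ.1 hg.isOpen a) hg.isOpen hu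
  have hw := (hg.density_pos hu).ne'
  rw [divCovector_eq hg.isOpen hu (fun z hz => hg.planeMetric_symm hz) hD] at h
  rw [pd_mul 0 dw (dΩ 0), pd_mul 0 dw (dΩ 1), pd_mul 1 dw (dΩ 0), pd_mul 1 dw (dΩ 1),
    hg.pd_density hu, hg.pd_density hu, pd_comm hΩ.1 hg.isOpen hu 1 0] at h
  have hD' : planeMetric g u 0 0 * planeMetric g u 1 1 - planeMetric g u 0 1 ^ 2 =
    planeDet g u := rfl
  rw [hD'] at h
  simp only [if_true, show ((0 : Fin 2) = 1) = False by simp, if_false, mul_one, mul_zero,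
    add_zero] at h
  have key : density g u * secondOrderOp (planeMetric g u 1 1) (-planeMetric g u 0 1)
      (planeMetric g u 0 0) (driftX g u) (driftY g u) Ω u = planeDet g u * 0 := by
    rw [← h]
    simp only [secondOrderOp, driftX, driftY, contractedChristoffel, Matrix.cons_val_zero,
      Matrix.cons_val_one]
    field_simp
    ring
  rw [mul_zero] at key
  exact (mul_eq_zero.1 key).resolve_left hw

/-- The estimate of the drift coefficients, with `y = 1 / x`: the only singular term `3 x⁻¹ r` of
the second coefficient is controlled because `r = Pₓᵧ` vanishes on the axis. -/
theorem drift_bounds {p r s D T₀ T₁ l₀ l₁ y m : ℝ} (hm : 0 ≤ m) (hp : |p| ≤ 5 / 4)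
    (hr : |r| ≤ 1 / 4) (hs : |s| ≤ 5 / 4) (hD : 1 / 2 ≤ D) (hT₀ : |T₀| ≤ 3 * m)
    (hT₁ : |T₁| ≤ 3 * m) (hl₀ : |l₀| ≤ 4 * m) (hl₁ : |l₁| ≤ 4 * m) (hy : |r * y| ≤ m) :
    |s * (l₀ + 3 * y) - r * l₁ - (s * T₀ - r * T₁) / D - 3 * s * y| ≤ 18 * m ∧
    |p * l₁ - r * (l₀ + 3 * y) - (p * T₁ - r * T₀) / D| ≤ 18 * m := by
  have hdiv : ∀ t : ℝ, |t| ≤ 9 / 2 * m → |t / D| ≤ 9 * m := by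
    intro t ht
    rw [abs_div, abs_of_pos (by linarith : 0 < D), div_le_iff₀ (by linarith)]
    nlinarith
  have a1 := abs_le.1 (abs_mul_le_mul hs hl₀)
  have a2 := abs_le.1 (abs_mul_le_mul hr hl₁)
  have a3 := abs_le.1 (abs_mul_le_mul hs hT₀)
  have a4 := abs_le.1 (abs_mul_le_mul hr hT₁)
  have b1 := abs_le.1 (abs_mul_le_mul hp hl₁)
  have b2 := abs_le.1 (abs_mul_le_mul hr hl₀)
  have b3 := abs_le.1 (abs_mul_le_mul hp hT₁)
  have b4 := abs_le.1 (abs_mul_le_mul hr hT₀)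
  have hy' := abs_le.1 hy
  have c1 := abs_le.1 (hdiv (s * T₀ - r * T₁) (abs_le.2 ⟨by linarith, by linarith⟩))
  have c2 := abs_le.1 (hdiv (p * T₁ - r * T₀) (abs_le.2 ⟨by linarith, by linarith⟩))
  constructor <;> rw [abs_le] <;> constructor <;> linarith

theorem christoffel_bound {p r s p₀ p₁ r₁ s₀ m : ℝ} (hm : 0 ≤ m) (hp : |p| ≤ 5 / 4)
    (hr : |r| ≤ 1 / 4) (hs : |s| ≤ 5 / 4) (hp₀ : |p₀| ≤ m) (hp₁ : |p₁| ≤ m) (hr₁ : |r₁| ≤ m)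
    (hs₀ : |s₀| ≤ m) : |s * p₀ / 2 - r * p₁ + p * (r₁ - s₀ / 2)| ≤ 3 * m := by
  have a1 := abs_le.1 (abs_mul_le_mul hs hp₀)
  have a2 := abs_le.1 (abs_mul_le_mul hr hp₁)
  have a3 := abs_le.1 (abs_mul_le_mul hp hr₁)
  have a4 := abs_le.1 (abs_mul_le_mul hp hs₀)
  rw [abs_le]
  constructor <;> linarith

theorem log_deriv_bound {N H N' H' m : ℝ} (hm : 0 ≤ m) (hN : 3 / 4 ≤ N) (hH : 3 / 4 ≤ H)
    (hN' : |N'| ≤ m) (hH' : |H'| ≤ m) : |-(N' / N) + 3 / 2 * (H' / H)| ≤ 4 * m := by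
  have h : ∀ a b : ℝ, 3 / 4 ≤ b → |a| ≤ m → |a / b| ≤ 4 / 3 * m := by
    intro a b hb ha
    rw [abs_div, abs_of_pos (by linarith : 0 < b), div_le_iff₀ (by linarith)]
    nlinarith
  have a1 := abs_le.1 (h N' N hN hN')
  have a2 := abs_le.1 (h H' H hH hH')
  rw [abs_le]
  constructor <;> linarith

theorem IsAngularVelocity.sub_const (hΩ : IsAngularVelocity g U Ω) (hU : IsOpen U) (l : ℝ) :
    IsAngularVelocity g U fun u => Ω u - l := by
  refine ⟨hΩ.1.sub contDiffOn_const, fun u hu a => ?_⟩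
  rw [pd_sub a (differentiableAt_of_contDiffOn hΩ.1 hU hu) (differentiableAt_const l),
    pd_const, sub_zero, hΩ.2 u hu]

/-- For asymptotically Euclidean data, the momentum constraint normalizes the angular velocity
potential to decay like `r⁻³`. -/
theorem IsQuasiStationary.exists_cubicDecay (hg : IsQuasiStationary g U δ)
    (hA : IsAsymptoticallyEuclidean g U) (hM : MomentumConstraint g U)
    (hΩ : IsAngularVelocity g U Ω) : ∃ l : ℝ, CubicDecay U fun u => Ω u - l := by
  obtain ⟨C, R, hR, hRU, hA⟩ := hA
  -- beyond the radius `4 C` all deviations from the flat values are at most `1 / 4`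
  set R₂ := max R (4 * C) with hR₂
  have hR₂pos : 0 < R₂ := hR.trans_le (le_max_left _ _)
  have hmem : ∀ u ∈ exterior R₂, u ∈ U := fun u hu =>
    hRU u hu.1 ((le_max_left _ _).trans_lt hu.2)
  have hbounds := fun u (hu : u ∈ exterior R₂) =>
    hg.asymptotic_bounds (hmem u hu) ((le_max_left _ _).trans_lt hu.2) hA
  have hsmall : ∀ u ∈ exterior R₂, 0 ≤ C ∧ C * invRadius u ≤ 1 / 4 := by
    intro u hu
    have hr := radius_pos hu.1
    have hρ : 0 < invRadius u := inv_pos.2 hr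
    refine ⟨?_, ?_⟩
    · have := (abs_nonneg _).trans (hbounds u hu).1.1
      exact nonneg_of_mul_nonneg_left this hρ
    · have : 4 * C < radius u := (le_max_right _ _).trans_lt hu.2
      rw [invRadius, ← div_eq_mul_inv, div_le_iff₀ hr]
      linarith
  have hgrad : ∀ u ∈ exterior R₂, ∀ a, |pd a Ω u| ≤ 4 * |C| * invRadius u ^ 3 := by
    intro u hu a
    obtain ⟨hC, hk⟩ := hsmall u hu
    obtain ⟨⟨-, -, -, hH, hN⟩, -, -, hf⟩ := hbounds u hu
    have hf := hf a
    have hx : 0 < u 0 := hu.1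
    have hY := hg.sqrt_normSq_pos (hmem u hu)
    have hsq : √(normSq g u) ^ 2 = axialRatio g u * u 0 ^ 2 := by
      rw [Real.sq_sqrt (hg.normSq_pos (hmem u hu)).le, normSq_eq_axialRatio hx.ne']
    have hN0 := hg.planeLapse_pos (hmem u hu)
    have hH0 := hg.axialRatio_pos (hmem u hu)
    have e : pd a Ω u = 2 * planeLapse g u / axialRatio g u *
        (flow g u a * (√(normSq g u))⁻¹ * (u 0)⁻¹ ^ 2) := by
      rw [hg.flow_eq_of_isAngularVelocity hΩ (hmem u hu), density]
      have : axialRatio g u = √(normSq g u) ^ 2 / u 0 ^ 2 := by rw [hsq]; field_simp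
      rw [this]
      field_simp
    have hcoef : |2 * planeLapse g u / axialRatio g u| ≤ 4 := by
      rw [abs_of_pos (by positivity), div_le_iff₀ hH0]
      have := (abs_le.1 hN).2
      have := (abs_le.1 hH).1
      linarith
    rw [e, abs_of_nonneg hC, mul_assoc 4 C]
    exact abs_mul_le_mul hcoef hf
  obtain ⟨l, hl⟩ := exists_limit_of_pd_bound hR₂pos (by positivity)
    (fun u hu => differentiableAt_of_contDiffOn hΩ.1 hg.isOpen (hmem u hu)) hgrad
  refine ⟨l, ?_⟩
  have hΩl := hΩ.sub_const hg.isOpen l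
  refine cubic_decay_of_elliptic (E := 18 * C) (R := R₂) hg.isOpen hg.subset hmem hΩl.1
    (fun u hu => ?_) (fun u hu => hg.secondOrderOp_eq_zero hΩl hM (hmem u hu)) hl
  obtain ⟨hC, hk⟩ := hsmall u hu
  obtain ⟨⟨hp, hr, hs, hH, hN⟩, hd, hrx, -⟩ := hbounds u hu
  have hρ : 0 < invRadius u := inv_pos.2 (radius_pos hu.1)
  have hk0 : 0 ≤ C * invRadius u := by positivity
  have hm : 0 ≤ C * invRadius u ^ 2 := by positivity
  have hp' := abs_le.1 hp
  have hs' := abs_le.1 hs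
  have hp2 : |planeMetric g u 0 0| ≤ 5 / 4 := abs_le.2 ⟨by linarith, by linarith⟩
  have hs2 : |planeMetric g u 1 1| ≤ 5 / 4 := abs_le.2 ⟨by linarith, by linarith⟩
  have hr2 : |planeMetric g u 0 1| ≤ 1 / 4 := hr.trans hk
  have hN2 : 3 / 4 ≤ planeLapse g u := by linarith [(abs_le.1 hN).1]
  have hH2 : 3 / 4 ≤ axialRatio g u := by linarith [(abs_le.1 hH).1]
  have hD : 1 / 2 ≤ planeDet g u := by
    have := abs_le.1 hr2
    have : planeMetric g u 0 1 ^ 2 ≤ 1 / 16 := by nlinarith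
    have : 9 / 16 ≤ planeMetric g u 0 0 * planeMetric g u 1 1 := by nlinarith
    rw [planeDet]; linarith
  have hl' : ∀ i, |logDensityReg g i u| ≤ 4 * (C * invRadius u ^ 2) := fun i =>
    log_deriv_bound hm hN2 hH2 (hd i).2.2.2.2 (hd i).2.2.2.1
  have hT₀ : |contractedChristoffel g u 0| ≤ 3 * (C * invRadius u ^ 2) :=
    christoffel_bound hm hp2 hr2 hs2 (hd 0).1 (hd 1).1 (hd 1).2.1 (hd 0).2.2.1
  have hT₁ : |contractedChristoffel g u 1| ≤ 3 * (C * invRadius u ^ 2) :=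
    christoffel_bound hm hs2 hr2 hp2 (hd 1).2.2.1 (hd 0).2.2.1 (hd 0).2.1 (hd 1).1
  obtain ⟨h₀, h₁⟩ := drift_bounds hm hp2 hr2 hs2 hD hT₀ hT₁ (hl' 0) (hl' 1) hrx
  refine ⟨hg.planeMetric_pos (hmem u hu) 1, ?_, ?_, ?_, ?_, ?_, ?_⟩
  · have := hg.planeMetric_det_pos (hmem u hu)
    linarith
  · linarith
  · rw [abs_neg]; linarith
  · linarith
  · rw [mul_assoc]
    simpa only [driftX, div_eq_mul_inv (3 : ℝ), div_eq_mul_inv (3 * planeMetric g u 1 1)] using h₀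
  · rw [mul_assoc]
    simpa only [driftY, div_eq_mul_inv (3 : ℝ)] using h₁

/-- Cubic decay fixes the additive constant, because the domain is unbounded. -/
theorem eq_zero_of_cubicDecay {Ω₁ Ω₂ : (Fin 2 → ℝ) → ℝ} {R c : ℝ}
    (hRU : ∀ u ∈ halfPlane, R < radius u → u ∈ U) (h₁ : CubicDecay U Ω₁) (h₂ : CubicDecay U Ω₂)
    (hc : ∀ u ∈ U, Ω₁ u = Ω₂ u + c) : c = 0 := by
  obtain ⟨C₁, R₁, -, h₁⟩ := h₁
  obtain ⟨C₂, R₂, -, h₂⟩ := h₂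
  have hbound : ∀ t : ℝ, 1 < t → R < t → R₁ < t → R₂ < t → |c| * t ≤ C₁ + C₂ := by
    intro t ht hR hR₁ hR₂
    have ht0 : 0 < t := one_pos.trans ht
    have hr : radius ![t, 0] = t := by simp [radius, Real.sqrt_sq ht0.le]
    have hu : ![t, 0] ∈ U := hRU _ ht0 (by rwa [hr])
    have b₁ := h₁ _ hu (by rwa [hr])
    have b₂ := h₂ _ hu (by rwa [hr])
    have hcu := hc _ hu
    rw [hr] at b₁ b₂
    have hcle : |c| ≤ (C₁ + C₂) / t ^ 3 := by
      rw [show c = Ω₁ ![t, 0] - Ω₂ ![t, 0] by linarith, add_div]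
      exact (abs_sub _ _).trans (add_le_add b₁ b₂)
    rw [le_div_iff₀ (by positivity)] at hcle
    have : t ≤ t ^ 3 := le_self_pow₀ ht.le (by norm_num)
    nlinarith [mul_le_mul_of_nonneg_left this (abs_nonneg c)]
  by_contra hne
  have hpos : 0 < |c| := abs_pos.2 hne
  set t := max (max 1 R) (max (max R₁ R₂) ((C₁ + C₂) / |c|)) + 1
  have e1 := le_max_left (max 1 R) (max (max R₁ R₂) ((C₁ + C₂) / |c|))
  have e2 := le_max_right (max 1 R) (max (max R₁ R₂) ((C₁ + C₂) / |c|))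
  have e3 := le_max_left (max R₁ R₂) ((C₁ + C₂) / |c|)
  have e4 := le_max_right (max R₁ R₂) ((C₁ + C₂) / |c|)
  have h := hbound t (by linarith [le_max_left 1 R]) (by linarith [le_max_right 1 R])
    (by linarith [le_max_left R₁ R₂]) (by linarith [le_max_right R₁ R₂])
  have : (C₁ + C₂) / |c| < t := by linarith
  rw [div_lt_iff₀ hpos] at this
  linarith

end Decay

end QuasiStationary

open QuasiStationary in
theorem mainTheorem2 (g : TensorField 4) (U : Set (Fin 2 → ℝ)) (δ : ℝ)
    (hg : IsQuasiStationary g U δ) :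
    -- the momentum constraint is the continuity equation of the flow
    (MomentumConstraint g U ↔
      ∀ u ∈ U, divCovector (planeMetric g) (flow g) u = 0) ∧
    -- the rescaled field is curl-free
    (∀ u ∈ U, ∀ a b,
      covDeriv (planeMetric g) (rescaled g) u a b =
        covDeriv (planeMetric g) (rescaled g) u b a) ∧
    -- the angular velocity exists and is unique up to a constant
    (∃ Ω, IsAngularVelocity g U Ω) ∧
    (∀ Ω₁ Ω₂, IsAngularVelocity g U Ω₁ → IsAngularVelocity g U Ω₂ →
      ∃ c : ℝ, ∀ u ∈ U, Ω₁ u = Ω₂ u + c) ∧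
    -- its normalization at infinity
    (IsAsymptoticallyEuclidean g U → MomentumConstraint g U →
      ∃ Ω, IsAngularVelocity g U Ω ∧ CubicDecay U Ω ∧
        ∀ Ω₁, IsAngularVelocity g U Ω₁ → CubicDecay U Ω₁ → Set.EqOn Ω₁ Ω U) ∧
    -- the momentum constraint as an equation for the potential, and the stream function
    (∀ Ω, IsAngularVelocity g U Ω →
      (MomentumConstraint g U ↔
        ∀ u ∈ U,
          divCovector (planeMetric g) (fun z a => density g z * pd a Ω z) u = 0) ∧
      (MomentumConstraint g U ↔ ∃ Ψ, IsStreamFunction g U Ω Ψ)) ∧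
    -- the same in isothermal coordinates, with the Beltrami equation
    (Isothermal g U → ∀ Ω, IsAngularVelocity g U Ω →
      (MomentumConstraint g U ↔
        ∀ u ∈ U, pd 0 (fun z => flow g z 0) u + pd 1 (fun z => flow g z 1) u = 0) ∧
      (∀ u ∈ U,
        pd 0 (fun z => planeLapse g z * (√(normSq g z) ^ 3)⁻¹ * flow g z 1) u =
          pd 1 (fun z => planeLapse g z * (√(normSq g z) ^ 3)⁻¹ * flow g z 0) u) ∧
      (MomentumConstraint g U ↔
        ∀ u ∈ U, pd 0 (fun z => density g z * pd 0 Ω z) u +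
          pd 1 (fun z => density g z * pd 1 Ω z) u = 0) ∧
      (∀ Ψ, IsStreamFunction g U Ω Ψ ↔
        ContDiffOn ℝ ∞ Ψ U ∧ ∀ u ∈ U,
          density g u * pd 0 Ω u = pd 1 Ψ u ∧ density g u * pd 1 Ω u = -pd 0 Ψ u) ∧
      (∀ Ψ, IsStreamFunction g U Ω Ψ → ∀ u ∈ U,
        pd 0 (fun z => (density g z)⁻¹ * pd 0 Ψ z) u +
          pd 1 (fun z => (density g z)⁻¹ * pd 1 Ψ z) u = 0 ∧
        pd 0 Ω u * pd 0 Ψ u + pd 1 Ω u * pd 1 Ψ u = 0 ∧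
        |(1 - density g u) / (1 + density g u)| < 1 ∧
        dzbar (fun z => (Ω z : ℂ) + Complex.I * (Ψ z : ℂ)) u =
          (((1 - density g u) / (1 + density g u) : ℝ) : ℂ) *
            (starRingEnd ℂ) (dz (fun z => (Ω z : ℂ) + Complex.I * (Ψ z : ℂ)) u))) := by
  refine ⟨hg.momentumConstraint_iff, fun u hu a b => hg.rescaled_curl_free hu a b,
    ⟨_, hg.isAngularVelocity_shiftPotential⟩, fun Ω₁ Ω₂ h₁ h₂ => hg.angularVelocity_unique h₁ h₂,
    fun hA hM => ?_, fun Ω hΩ => ⟨hg.momentumConstraint_iff_potential hΩ,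
      hg.momentumConstraint_iff_stream hΩ⟩, fun hI Ω hΩ => ⟨hg.momentumConstraint_iff_continuity hI,
      fun u hu => ?_, ?_, fun Ψ => hg.isStreamFunction_iff hI,
      fun Ψ hΨ u hu => hg.stream_properties hI hΩ hΨ hu⟩⟩
  · obtain ⟨l, hl⟩ := hg.exists_cubicDecay hA hM hg.isAngularVelocity_shiftPotential
    have hΩ := hg.isAngularVelocity_shiftPotential.sub_const hg.isOpen l
    refine ⟨_, hΩ, hl, fun Ω₁ hΩ₁ hd u hu => ?_⟩
    obtain ⟨c, hc⟩ := hg.angularVelocity_unique hΩ₁ hΩ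
    obtain ⟨-, R, -, hRU, -⟩ := hA
    rw [hc u hu, eq_zero_of_cubicDecay hRU hd hl hc, add_zero]
  · rw [pd_congr_of_eqOn 0 hg.isOpen hu fun z hz => hg.lapse_mul_flow hz 1,
      pd_congr_of_eqOn 1 hg.isOpen hu fun z hz => hg.lapse_mul_flow hz 0]
    exact hg.pd_pd_shiftPotential_comm hu _ 0 1
  · rw [hg.momentumConstraint_iff_continuity hI]
    refine forall₂_congr fun u hu => ?_
    rw [pd_congr_of_eqOn 0 hg.isOpen hu fun z hz => hg.flow_eq_of_isAngularVelocity hΩ hz 0,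
      pd_congr_of_eqOn 1 hg.isOpen hu fun z hz => hg.flow_eq_of_isAngularVelocity hΩ hz 1]
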